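/- Let $n\ge 1$, let $S^n\subset D^{n+1}\subset\mathbb R^{n+1}$ be the unit sphere and the closed unit disk, let $M$ be a topological space (in the application, a compact oriented manifold), and let $M^{S^n}$ be the space of continuous maps $S^n\to M$ with the compact-open topology. **The operad.** Let $T$ be a planar rooted binary tree whose trivalent vertices are decorated by affine oriented hyperplanes of $\mathbb R^{n+1}$. Starting from a subset $U$ at the root, associate to every vertex a subset: if $V$ is associated to a trivalent vertex decorated by $P$, then the parts of $V$ strictly on the negative and on the positive side of $P$ are associated to the ends of its left-going and right-going edge. For $U\subseteq S^n$, the tree is *$U$-cleaving* if at each trivalent vertex $P$ intersects $V$ transversally and both parts are nonempty. The subsets of $S^n$ at the leaves of $S^n$-cleaving trees are called timber; applying the same process to $D^{n+1}$ associates to such a leaf a convex subset $W$ of $D^{n+1}$, called a region of the timber. The colours of the coloured operad $\mathrm{Cleav}_{S^n}$ are the timber whose complement in $S^n$ is homotopy equivalent to a finite discrete space. Its $k$-ary operations with incoming colour $U$ are the $U$-cleaving trees with $k$ leaves labelled by $1,\dots,k$ whose subsets $U_1,\dots,U_k$ at the leaves are again colours (the outgoing colours); two such trees are identified if they have the same $U$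 and the same $U_1,\dots,U_k$. Composition is grafting, the unit of a colour is the tree without trivalent vertices, and $\Sigma_k$ permutes the labels. **Correspondences.** Let $\mathrm{Corr}(\mathrm{Top})$ be the symmetric monoidal category whose objects are the topological spaces, whose morphisms are isomorphism classes of spans $X\leftarrow Z\to Y$, composed by pullback, and whose tensor product is $\times$. The endomorphism operad of an object $A$ has as $k$-ary operations the morphisms between $A^k$ and $A$ in $\mathrm{Corr}(\mathrm{Top})$. **Theorem.** There is an action of $\mathrm{Cleav}_{S^n}$ on $M^{S^n}$ in $(\mathrm{Corr}(\mathrm{Top}),\times)$, i.e. a functor of coloured operads (compatible with units, with all compositions $\circ_i$ and with the symmetric groups) from $\mathrm{Cleav}_{S^n}$ to the endomorphism operad of $M^{S^n}$, which on each operation $[T]$ with incoming colour $U$ and $k$ outgoing colours, where $k\ge 2$ or $U=S^n$, is given by the following pullback construction, for every choice of a tree $T$ representing the operation and of a region $W$ of $U$. Let $W_1,\dots,W_k$ be the subsets at the leaves of $T$ when the process is started from $W$, and let $\beta=D^{n+1}\setminus\bigcup_i W_i$ be the blueprint. Each component of $S^n\setminus U_i$ has its boundary in a single path-component of $\beta$;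 this gives a map $c\colon\coprod_i (S^n\setminus U_i)\to\pi_0(\beta)$, which induces a continuous map $\phi\colon M^{\pi_0(\beta)}\to\prod_i M^{S^n\setminus U_i}$. Let $M^{S^n}_{[T]}\subseteq M^{S^n}$ be the subspace of the maps that are constant along the intersection of $S^n$ with each path-component of $\beta$. Then there is a pullback square of topological spaces $$\begin{array}{ccc} M^{S^n}_{[T]} & \xrightarrow{\ \phi^*\ } & (M^{S^n})^k\\ \downarrow & & \downarrow{\scriptstyle\mathrm{res}}\\ M^{\pi_0(\beta)} & \xrightarrow{\ \phi\ } & \prod_{i=1}^k M^{S^n\setminus U_i}\end{array}$$ where $\mathrm{res}$ is the restriction, the left-hand map takes the values on the components of $\beta$, and the $i$-th component of $\phi^*(f)$ agrees with $f$ on $U_i$; and the action sends $[T]$ to the class of $M^{S^n}\hookleftarrow M^{S^n}_{[T]}\xrightarrow{\phi^*}(M^{S^n})^k$. (In the remaining case $k=1$, $U\ne S^n$, there are no hyperplanes, the operation is the unit of $U$, and it acts by the identity correspondence.) -/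

import Mathlib

open CategoryTheory MonoidalCategory

universe u v w v' w'

set_option linter.checkUnivs false

/-! ## Coloured operads -/

namespace OperadIndex

/-- Relabelling of the inputs of a partial composite along relabellings of its two factors. -/
def congr {I I' J J' : Type} (e : I ≃ I') (i : I) (e' : J ≃ J') :
    {x : I // x ≠ i} ⊕ J ≃ {x : I' // x ≠ e i} ⊕ J' :=
  Equiv.sumCongr (e.subtypeEquiv fun _ => e.injective.ne_iff.symm) e'

/-- The index set of `(f ∘ᵢ g) ∘ⱼ h` is that of `f ∘ᵢ (g ∘ⱼ h)`. -/
def assoc {I J L : Type} (i : I) (j : J) :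
    {x : {x : I // x ≠ i} ⊕ J // x ≠ Sum.inr j} ⊕ L ≃
      {x : I // x ≠ i} ⊕ ({y : J // y ≠ j} ⊕ L) where
  toFun
    | Sum.inl ⟨Sum.inl x, _⟩ => Sum.inl x
    | Sum.inl ⟨Sum.inr y, h⟩ => Sum.inr (Sum.inl ⟨y, fun hy => h (congrArg Sum.inr hy)⟩)
    | Sum.inr l => Sum.inr (Sum.inr l)
  invFun
    | Sum.inl x => Sum.inl ⟨Sum.inl x, Sum.inl_ne_inr⟩
    | Sum.inr (Sum.inl y) => Sum.inl ⟨Sum.inr y.1, fun h => y.2 (Sum.inr_injective h)⟩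
    | Sum.inr (Sum.inr l) => Sum.inr l
  left_inv := by rintro (⟨_ | _, _⟩ | _) <;> rfl
  right_inv := by rintro (_ | _ | _) <;> rfl

/-- The index set of `(f ∘ᵢ g) ∘ᵣ s` is that of `(f ∘ᵣ s) ∘ᵢ g`, for distinct inputs `i`, `r`. -/
def swap {I J L : Type} {i r : I} (h : r ≠ i) :
    {x : {x : I // x ≠ i} ⊕ J // x ≠ Sum.inl ⟨r, h⟩} ⊕ L ≃
      {x : {x : I // x ≠ r} ⊕ L // x ≠ Sum.inl ⟨i, h.symm⟩} ⊕ J where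
  toFun
    | Sum.inl ⟨Sum.inl x, hx⟩ =>
        Sum.inl ⟨Sum.inl ⟨x.1, fun e => hx (congrArg Sum.inl (Subtype.ext e))⟩,
          fun e => x.2 (congrArg Subtype.val (Sum.inl_injective e))⟩
    | Sum.inl ⟨Sum.inr y, _⟩ => Sum.inr y
    | Sum.inr l => Sum.inl ⟨Sum.inr l, Sum.inr_ne_inl⟩
  invFun
    | Sum.inl ⟨Sum.inl x, hx⟩ =>
        Sum.inl ⟨Sum.inl ⟨x.1, fun e => hx (congrArg Sum.inl (Subtype.ext e))⟩,
          fun e => x.2 (congrArg Subtype.val (Sum.inl_injective e))⟩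
    | Sum.inl ⟨Sum.inr l, _⟩ => Sum.inr l
    | Sum.inr y => Sum.inl ⟨Sum.inr y, Sum.inr_ne_inl⟩
  left_inv := by rintro (⟨_ | _, _⟩ | _) <;> rfl
  right_inv := by rintro (⟨_ | _, _⟩ | _) <;> rfl

open Classical in
/-- The index set of `f ∘ᵢ 1` is that of `f`. -/
noncomputable def unitRight {I : Type} (i : I) : {x : I // x ≠ i} ⊕ Unit ≃ I where
  toFun
    | Sum.inl x => x.1
    | Sum.inr _ => i
  invFun x := if h : x = i then Sum.inr () else Sum.inl ⟨x, h⟩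
  left_inv := by
    rintro (⟨x, hx⟩ | _)
    · simp [hx]
    · simp
  right_inv := by
    intro x
    by_cases h : x = i <;> simp [h]

/-- The index set of `1 ∘ f` is that of `f`. -/
def unitLeft {J : Type} : {x : Unit // x ≠ ()} ⊕ J ≃ J where
  toFun
    | Sum.inl x => (x.2 rfl).elim
    | Sum.inr j => j
  invFun j := Sum.inr j
  left_inv := by
    rintro (x | _)
    · exact (x.2 rfl).elim
    · rfl
  right_inv := fun _ => rfl

end OperadIndex

/-- A (symmetric) coloured operad. The operations are indexed by the finite sets `I` that label
their outgoing colours (for `I = {1, …, k}` these are the `k`-ary operations); `Op I` is the set of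
all operations with label set `I`, whatever their colours, `inc` is the incoming colour and `out`
is the family of outgoing colours. The symmetric groups act by relabelling along bijections, and
`comp f i g` is the partial composite `f ∘ᵢ g`, whose outgoing colours are those of `f` other than
the `i`-th one, and those of `g`. -/
structure ColouredOperad where
  /-- the colours -/
  Ob : Type v
  /-- the operations -/
  Op : (I : Type) → [Finite I] → Type w
  /-- the incoming colour -/
  inc : ∀ {I : Type} [Finite I], Op I → Ob
  /-- the outgoing colours -/
  out : ∀ {I : Type} [Finite I], Op I → I → Ob
  /-- the units -/
  one : Ob → Op Unit
  /-- the action of bijections (in particular, of permutations) -/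
  relabel : ∀ {I J : Type} [Finite I] [Finite J], (I ≃ J) → Op I → Op J
  /-- partial composition -/
  comp : ∀ {I J : Type} [Finite I] [Finite J] (f : Op I) (i : I) (g : Op J),
    inc g = out f i → Op ({x : I // x ≠ i} ⊕ J)
  inc_one : ∀ a, inc (one a) = a
  out_one : ∀ a x, out (one a) x = a
  inc_relabel : ∀ {I J : Type} [Finite I] [Finite J] (e : I ≃ J) (f : Op I),
    inc (relabel e f) = inc f
  out_relabel : ∀ {I J : Type} [Finite I] [Finite J] (e : I ≃ J) (f : Op I) (i : I),
    out (relabel e f) (e i) = out f i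
  inc_comp : ∀ {I J : Type} [Finite I] [Finite J] (f : Op I) (i : I) (g : Op J)
    (h : inc g = out f i), inc (comp f i g h) = inc f
  out_comp_inl : ∀ {I J : Type} [Finite I] [Finite J] (f : Op I) (i : I) (g : Op J)
    (h : inc g = out f i) (x : {x : I // x ≠ i}), out (comp f i g h) (Sum.inl x) = out f x
  out_comp_inr : ∀ {I J : Type} [Finite I] [Finite J] (f : Op I) (i : I) (g : Op J)
    (h : inc g = out f i) (y : J), out (comp f i g h) (Sum.inr y) = out g y
  relabel_refl : ∀ {I : Type} [Finite I] (f : Op I), relabel (Equiv.refl I) f = f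
  relabel_trans : ∀ {I J K : Type} [Finite I] [Finite J] [Finite K] (e : I ≃ J) (e' : J ≃ K)
    (f : Op I), relabel (e.trans e') f = relabel e' (relabel e f)
  /-- equivariance of partial composition -/
  comp_relabel : ∀ {I I' J J' : Type} [Finite I] [Finite I'] [Finite J] [Finite J']
    (e : I ≃ I') (e' : J ≃ J') (f : Op I) (i : I) (g : Op J) (h : inc g = out f i),
    comp (relabel e f) (e i) (relabel e' g)
        ((inc_relabel e' g).trans (h.trans (out_relabel e f i).symm)) =
      relabel (OperadIndex.congr e i e') (comp f i g h)
  /-- sequential associativity -/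
  comp_assoc : ∀ {I J L : Type} [Finite I] [Finite J] [Finite L] (f : Op I) (i : I) (g : Op J)
    (j : J) (s : Op L) (h : inc g = out f i) (h' : inc s = out g j),
    relabel (OperadIndex.assoc i j)
        (comp (comp f i g h) (Sum.inr j) s (h'.trans (out_comp_inr f i g h j).symm)) =
      comp f i (comp g j s h') ((inc_comp g j s h').trans h)
  /-- parallel associativity -/
  comp_comm : ∀ {I J L : Type} [Finite I] [Finite J] [Finite L] (f : Op I) (i r : I)
    (hr : r ≠ i) (g : Op J) (s : Op L) (h : inc g = out f i) (h' : inc s = out f r),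
    relabel (OperadIndex.swap hr)
        (comp (comp f i g h) (Sum.inl ⟨r, hr⟩) s
          (h'.trans (out_comp_inl f i g h ⟨r, hr⟩).symm)) =
      comp (comp f r s h') (Sum.inl ⟨i, hr.symm⟩) g
        (h.trans (out_comp_inl f r s h' ⟨i, hr.symm⟩).symm)
  /-- right unit -/
  comp_one : ∀ {I : Type} [Finite I] (f : Op I) (i : I),
    relabel (OperadIndex.unitRight i) (comp f i (one (out f i)) (inc_one _)) = f
  /-- left unit -/
  one_comp : ∀ {I : Type} [Finite I] (f : Op I),
    relabel OperadIndex.unitLeft (comp (one (inc f)) () f (out_one _ _).symm) = f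

/-- A functor (morphism) of coloured operads. -/
structure OperadFunctor (P : ColouredOperad.{v, w}) (Q : ColouredOperad.{v', w'}) where
  /-- the map on colours -/
  onOb : P.Ob → Q.Ob
  /-- the map on operations -/
  onOp : ∀ {I : Type} [Finite I], P.Op I → Q.Op I
  map_inc : ∀ {I : Type} [Finite I] (f : P.Op I), Q.inc (onOp f) = onOb (P.inc f)
  map_out : ∀ {I : Type} [Finite I] (f : P.Op I) (i : I), Q.out (onOp f) i = onOb (P.out f i)
  map_one : ∀ a, onOp (P.one a) = Q.one (onOb a)
  map_relabel : ∀ {I J : Type} [Finite I] [Finite J] (e : I ≃ J) (f : P.Op I),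
    onOp (P.relabel e f) = Q.relabel e (onOp f)
  map_comp : ∀ {I J : Type} [Finite I] [Finite J] (f : P.Op I) (i : I) (g : P.Op J)
    (h : P.inc g = P.out f i),
    onOp (P.comp f i g h) =
      Q.comp (onOp f) i (onOp g) ((map_inc g).trans ((congrArg onOb h).trans (map_out f i).symm))

/-! ## The symmetric monoidal category of correspondences of topological spaces -/

/-- A span `X ← Z → Y` of topological spaces. -/
structure TopSpan (X Y : TopCat.{u}) where
  /-- the apex `Z` -/
  apex : TopCat.{u}
  /-- the map `Z → X` -/
  left : C(apex, X)
  /-- the map `Z → Y` -/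
  right : C(apex, Y)

namespace TopSpan

variable {X Y Z W : TopCat.{u}}

/-- Two spans are isomorphic if their apices are homeomorphic over both ends. -/
def Iso (S T : TopSpan X Y) : Prop :=
  ∃ e : S.apex ≃ₜ T.apex, (∀ z, T.left (e z) = S.left z) ∧ ∀ z, T.right (e z) = S.right z

instance setoid (X Y : TopCat.{u}) : Setoid (TopSpan X Y) where
  r := Iso
  iseqv :=
    { refl := fun _ => ⟨Homeomorph.refl _, fun _ => rfl, fun _ => rfl⟩
      symm := by
        rintro S T ⟨e, h₁, h₂⟩
        exact ⟨e.symm, fun z => by simp [← h₁], fun z => by simp [← h₂]⟩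
      trans := by
        rintro S T U ⟨e, h₁, h₂⟩ ⟨e', h₁', h₂'⟩
        exact ⟨e.trans e', fun z => by simp [h₁, h₁'], fun z => by simp [h₂, h₂']⟩ }

/-- The span `X = X → Y` of a homeomorphism. -/
def graph (h : X ≃ₜ Y) : TopSpan X Y := ⟨X, ContinuousMap.id X, h⟩

/-- Composition of spans by forming the pullback. -/
def comp (S : TopSpan X Y) (T : TopSpan Y Z) : TopSpan X Z where
  apex := TopCat.of {p : S.apex × T.apex // S.right p.1 = T.left p.2}
  left := ⟨fun p => S.left p.1.1, by fun_prop⟩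
  right := ⟨fun p => T.right p.1.2, by fun_prop⟩

/-- The product of two spans. -/
def prod {X' Y' : TopCat.{u}} (S : TopSpan X Y) (T : TopSpan X' Y') :
    TopSpan (TopCat.of (X × X')) (TopCat.of (Y × Y')) where
  apex := TopCat.of (S.apex × T.apex)
  left := ⟨fun p => (S.left p.1, T.left p.2), by fun_prop⟩
  right := ⟨fun p => (S.right p.1, T.right p.2), by fun_prop⟩

theorem comp_congr {S S' : TopSpan X Y} {T T' : TopSpan Y Z} (hS : S ≈ S') (hT : T ≈ T') :
    S.comp T ≈ S'.comp T' := by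
  obtain ⟨e, h₁, h₂⟩ := hS
  obtain ⟨e', h₁', h₂'⟩ := hT
  refine ⟨⟨⟨fun p => ⟨(e p.1.1, e' p.1.2), by rw [h₂, h₁', p.2]⟩,
    fun p => ⟨(e.symm p.1.1, e'.symm p.1.2), ?_⟩, fun p => ?_, fun p => ?_⟩, ?_, ?_⟩,
    fun p => h₁ _, fun p => h₂' _⟩
  · rw [← h₂, ← h₁']; simpa using p.2
  · exact Subtype.ext (Prod.ext (e.symm_apply_apply _) (e'.symm_apply_apply _))
  · exact Subtype.ext (Prod.ext (e.apply_symm_apply _) (e'.apply_symm_apply _))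
  · fun_prop
  · fun_prop

theorem prod_congr {X' Y' : TopCat.{u}} {S S' : TopSpan X Y} {T T' : TopSpan X' Y'}
    (hS : S ≈ S') (hT : T ≈ T') : S.prod T ≈ S'.prod T' := by
  obtain ⟨e, h₁, h₂⟩ := hS
  obtain ⟨e', h₁', h₂'⟩ := hT
  exact ⟨e.prodCongr e', fun p => Prod.ext (h₁ _) (h₁' _), fun p => Prod.ext (h₂ _) (h₂' _)⟩

theorem comp_assoc (S : TopSpan X Y) (T : TopSpan Y Z) (U : TopSpan Z W) :
    (S.comp T).comp U ≈ S.comp (T.comp U) :=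
  ⟨⟨⟨fun p => ⟨(p.1.1.1.1, ⟨(p.1.1.1.2, p.1.2), p.2⟩), p.1.1.2⟩,
    fun p => ⟨(⟨(p.1.1, p.1.2.1.1), p.2⟩, p.1.2.1.2), p.1.2.2⟩,
    fun _ => rfl, fun _ => rfl⟩, by fun_prop, by fun_prop⟩, fun _ => rfl, fun _ => rfl⟩

/-- Precomposing with the span of a homeomorphism changes the left leg only. -/
theorem graph_comp (h : X ≃ₜ Y) (S : TopSpan Y Z) :
    (graph h).comp S ≈ ⟨S.apex, (h.symm : C(Y, X)).comp S.left, S.right⟩ :=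
  ⟨⟨⟨fun p => p.1.2, fun z => ⟨(h.symm (S.left z), z), h.apply_symm_apply _⟩,
    fun p => Subtype.ext (Prod.ext ((h.symm_apply_eq).2 p.2.symm) rfl), fun _ => rfl⟩,
    by fun_prop, by fun_prop⟩, fun p => (h.symm_apply_eq).2 p.2.symm, fun _ => rfl⟩

/-- Postcomposing with the span of a homeomorphism changes the right leg only. -/
theorem comp_graph (S : TopSpan X Y) (h : Y ≃ₜ Z) :
    S.comp (graph h) ≈ ⟨S.apex, S.left, (h : C(Y, Z)).comp S.right⟩ :=
  ⟨⟨⟨fun p => p.1.1, fun z => ⟨(z, S.right z), rfl⟩,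
    fun p => Subtype.ext (Prod.ext rfl p.2), fun _ => rfl⟩,
    by fun_prop, by fun_prop⟩, fun _ => rfl, fun p => congrArg h p.2⟩

theorem comp_prod {X' Y' Z' : TopCat.{u}} (S : TopSpan X Y) (T : TopSpan Y Z)
    (S' : TopSpan X' Y') (T' : TopSpan Y' Z') :
    (S.prod S').comp (T.prod T') ≈ (S.comp T).prod (S'.comp T') :=
  ⟨⟨⟨fun p => (⟨(p.1.1.1, p.1.2.1), congrArg Prod.fst p.2⟩,
      ⟨(p.1.1.2, p.1.2.2), congrArg Prod.snd p.2⟩),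
    fun p => ⟨((p.1.1.1, p.2.1.1), (p.1.1.2, p.2.1.2)), Prod.ext p.1.2 p.2.2⟩,
    fun _ => rfl, fun _ => rfl⟩, by fun_prop, by fun_prop⟩, fun _ => rfl, fun _ => rfl⟩

end TopSpan

/-- The category of correspondences of topological spaces: its objects are the topological
spaces. -/
structure Corr where
  /-- the object given by a topological space -/
  of ::
  /-- the underlying topological space -/
  space : TopCat.{u}

namespace Corr

/-- Isomorphism classes of spans. -/
def Hom (X Y : Corr.{u}) : Type (u + 1) := Quotient (TopSpan.setoid X.space Y.space)

/-- Composition of correspondences, by forming pullbacks. -/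
def Hom.comp {X Y Z : Corr.{u}} (f : Hom X Y) (g : Hom Y Z) : Hom X Z :=
  Quotient.map₂ TopSpan.comp (fun _ _ h _ _ h' => TopSpan.comp_congr h h') f g

/-- The product of correspondences. -/
def Hom.prod {X Y X' Y' : Corr.{u}} (f : Hom X Y) (g : Hom X' Y') :
    Hom (of (TopCat.of (X.space × X'.space))) (of (TopCat.of (Y.space × Y'.space))) :=
  Quotient.map₂ TopSpan.prod (fun _ _ h _ _ h' => TopSpan.prod_congr h h') f g

instance : Category Corr.{u} where
  Hom := Hom
  id X := (Quotient.mk _ (TopSpan.graph (Homeomorph.refl X.space)) : Hom X X)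
  comp := Hom.comp
  id_comp f := by
    induction f using Quotient.inductionOn with
    | _ S => exact Quotient.sound (TopSpan.graph_comp _ S)
  comp_id f := by
    induction f using Quotient.inductionOn with
    | _ S => exact Quotient.sound (TopSpan.comp_graph S _)
  assoc f g h := by
    induction f using Quotient.inductionOn with
    | _ S =>
    induction g using Quotient.inductionOn with
    | _ T =>
    induction h using Quotient.inductionOn with
    | _ U => exact Quotient.sound (TopSpan.comp_assoc S T U)

/-- The morphism of correspondences given by a span. -/
def mk {X Y : TopCat.{u}} (S : TopSpan X Y) : of X ⟶ of Y := (Quotient.mk _ S : Hom _ _)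

variable {X Y Z X' Y' Z' : TopCat.{u}}

theorem mk_eq {S T : TopSpan X Y} (h : S ≈ T) : mk S = mk T := Quotient.sound h

theorem ind {X Y : Corr.{u}} {p : (X ⟶ Y) → Prop}
    (h : ∀ S : TopSpan X.space Y.space, p (mk S)) (f : X ⟶ Y) : p f :=
  Quotient.inductionOn f h

theorem mk_comp (S : TopSpan X Y) (T : TopSpan Y Z) : mk S ≫ mk T = mk (S.comp T) := rfl

/-- The isomorphism in the category of correspondences given by a homeomorphism. -/
def isoOfHomeomorph (h : X ≃ₜ Y) : of X ≅ of Y where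
  hom := mk (TopSpan.graph h)
  inv := mk (TopSpan.graph h.symm)
  hom_inv_id := by
    refine (mk_eq (TopSpan.comp_graph _ _)).trans (congrArg mk ?_)
    exact congrArg (TopSpan.mk X (ContinuousMap.id X)) (ContinuousMap.ext h.symm_apply_apply)
  inv_hom_id := by
    refine (mk_eq (TopSpan.comp_graph _ _)).trans (congrArg mk ?_)
    exact congrArg (TopSpan.mk Y (ContinuousMap.id Y)) (ContinuousMap.ext h.apply_symm_apply)

/-- The isomorphism in the category of correspondences given by a homeomorphism, for objects that
are not syntactically of the form `of X`. -/
def mkIso {X Y : Corr.{u}} (h : X.space ≃ₜ Y.space) : X ≅ Y := isoOfHomeomorph h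

theorem mkIso_comp {X Y : Corr.{u}} {Z : TopCat.{u}} (h : X.space ≃ₜ Y.space)
    (S : TopSpan Y.space Z) :
    (mkIso h).hom ≫ mk S =
      mk ⟨S.apex, (h.symm : C(Y.space, X.space)).comp S.left, S.right⟩ :=
  mk_eq (TopSpan.graph_comp h S)

theorem comp_mkIso {X : TopCat.{u}} {Y Z : Corr.{u}} (S : TopSpan X Y.space)
    (h : Y.space ≃ₜ Z.space) :
    (mk S : of X ⟶ Y) ≫ (mkIso h).hom =
      mk ⟨S.apex, S.left, (h : C(Y.space, Z.space)).comp S.right⟩ :=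
  mk_eq (TopSpan.comp_graph S h)

theorem mkIso_trans {X Y Z : Corr.{u}} (h : X.space ≃ₜ Y.space) (k : Y.space ≃ₜ Z.space) :
    (mkIso h).hom ≫ (mkIso k).hom = (mkIso (X := X) (Y := Z) (h.trans k)).hom :=
  mk_eq (TopSpan.comp_graph _ k)

theorem mkIso_congr {X Y : Corr.{u}} {h k : X.space ≃ₜ Y.space} (e : ∀ x, h x = k x) :
    (mkIso h).hom = (mkIso k).hom := by
  rw [Homeomorph.ext e]

instance : MonoidalCategoryStruct Corr.{u} where
  tensorObj X Y := of (TopCat.of (X.space × Y.space))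
  tensorHom f g := Hom.prod f g
  whiskerLeft X _ _ f := Hom.prod (𝟙 X) f
  whiskerRight f Y := Hom.prod f (𝟙 Y)
  tensorUnit := of (TopCat.of PUnit)
  associator X Y Z := mkIso (Homeomorph.prodAssoc X.space Y.space Z.space)
  leftUnitor X := mkIso (Homeomorph.punitProd X.space)
  rightUnitor X := mkIso (Homeomorph.prodPUnit X.space)

instance : MonoidalCategory Corr.{u} :=
  MonoidalCategory.ofTensorHom
    (id_tensorHom_id := fun _ _ => rfl)
    (id_tensorHom := fun _ _ _ _ => rfl)
    (tensorHom_id := fun _ _ => rfl)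
    (tensorHom_comp_tensorHom := fun f f' g g' => by
      induction f using ind with
      | _ S =>
      induction f' using ind with
      | _ S' =>
      induction g using ind with
      | _ T =>
      induction g' using ind with
      | _ T' => exact mk_eq (TopSpan.comp_prod S T S' T'))
    (associator_naturality := fun f g h => by
      induction f using ind with
      | _ S =>
      induction g using ind with
      | _ T =>
      induction h using ind with
      | _ U =>
        refine (comp_mkIso ((S.prod T).prod U) _).trans
          (Eq.trans ?_ (mkIso_comp _ (S.prod (T.prod U))).symm)
        exact mk_eq ⟨Homeomorph.prodAssoc _ _ _, fun _ => rfl, fun _ => rfl⟩)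
    (leftUnitor_naturality := fun {X Y} f => by
      induction f using ind with
      | _ S =>
        refine (comp_mkIso ((TopSpan.graph (Homeomorph.refl _)).prod S) _).trans
          (Eq.trans ?_ (mkIso_comp _ S).symm)
        exact mk_eq ⟨Homeomorph.punitProd _, fun _ => rfl, fun _ => rfl⟩)
    (rightUnitor_naturality := fun {X Y} f => by
      induction f using ind with
      | _ S =>
        refine (comp_mkIso (S.prod (TopSpan.graph (Homeomorph.refl _))) _).trans
          (Eq.trans ?_ (mkIso_comp _ S).symm)
        exact mk_eq ⟨Homeomorph.prodPUnit _, fun _ => rfl, fun _ => rfl⟩)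
    (pentagon := fun W X Y Z => by
      change (mkIso (X := ((W ⊗ X) ⊗ Y) ⊗ Z) (Y := (W ⊗ X ⊗ Y) ⊗ Z)
          ((Homeomorph.prodAssoc _ _ _).prodCongr (Homeomorph.refl _))).hom ≫
        (mkIso (X := (W ⊗ X ⊗ Y) ⊗ Z) (Y := W ⊗ (X ⊗ Y) ⊗ Z) (Homeomorph.prodAssoc _ _ _)).hom ≫
        (mkIso (X := W ⊗ (X ⊗ Y) ⊗ Z) (Y := W ⊗ X ⊗ Y ⊗ Z)
          ((Homeomorph.refl _).prodCongr (Homeomorph.prodAssoc _ _ _))).hom =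
        (mkIso (X := ((W ⊗ X) ⊗ Y) ⊗ Z) (Y := (W ⊗ X) ⊗ Y ⊗ Z) (Homeomorph.prodAssoc _ _ _)).hom ≫
        (mkIso (X := (W ⊗ X) ⊗ Y ⊗ Z) (Y := W ⊗ X ⊗ Y ⊗ Z) (Homeomorph.prodAssoc _ _ _)).hom
      rw [mkIso_trans, mkIso_trans, mkIso_trans]
      exact mkIso_congr fun _ => rfl)
    (triangle := fun X Y => by
      change (mkIso (X := (X ⊗ 𝟙_ Corr) ⊗ Y) (Y := X ⊗ 𝟙_ Corr ⊗ Y)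
          (Homeomorph.prodAssoc _ _ _)).hom ≫
        (mkIso (X := X ⊗ 𝟙_ Corr ⊗ Y) (Y := X ⊗ Y)
          ((Homeomorph.refl _).prodCongr (Homeomorph.punitProd _))).hom =
        (mkIso (X := (X ⊗ 𝟙_ Corr) ⊗ Y) (Y := X ⊗ Y)
          ((Homeomorph.prodPUnit _).prodCongr (Homeomorph.refl _))).hom
      rw [mkIso_trans]
      exact mkIso_congr fun _ => rfl)

instance : SymmetricCategory Corr.{u} where
  braiding X Y := mkIso (X := X ⊗ Y) (Y := Y ⊗ X) (Homeomorph.prodComm X.space Y.space)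
  braiding_naturality_right X {Y Z} f := by
    induction f using ind with
    | _ S =>
      refine (comp_mkIso ((TopSpan.graph (Homeomorph.refl _)).prod S) _).trans
        (Eq.trans ?_ (mkIso_comp _ (S.prod (TopSpan.graph (Homeomorph.refl _)))).symm)
      exact mk_eq ⟨Homeomorph.prodComm _ _, fun _ => rfl, fun _ => rfl⟩
  braiding_naturality_left {X Y} f Z := by
    induction f using ind with
    | _ S =>
      refine (comp_mkIso (S.prod (TopSpan.graph (Homeomorph.refl _))) _).trans
        (Eq.trans ?_ (mkIso_comp _ ((TopSpan.graph (Homeomorph.refl _)).prod S)).symm)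
      exact mk_eq ⟨Homeomorph.prodComm _ _, fun _ => rfl, fun _ => rfl⟩
  hexagon_forward X Y Z := by
    change (mkIso (X := (X ⊗ Y) ⊗ Z) (Y := X ⊗ Y ⊗ Z) (Homeomorph.prodAssoc _ _ _)).hom ≫
      (mkIso (X := X ⊗ Y ⊗ Z) (Y := (Y ⊗ Z) ⊗ X) (Homeomorph.prodComm _ _)).hom ≫
      (mkIso (X := (Y ⊗ Z) ⊗ X) (Y := Y ⊗ Z ⊗ X) (Homeomorph.prodAssoc _ _ _)).hom =
      (mkIso (X := (X ⊗ Y) ⊗ Z) (Y := (Y ⊗ X) ⊗ Z)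
        ((Homeomorph.prodComm _ _).prodCongr (Homeomorph.refl _))).hom ≫
      (mkIso (X := (Y ⊗ X) ⊗ Z) (Y := Y ⊗ X ⊗ Z) (Homeomorph.prodAssoc _ _ _)).hom ≫
      (mkIso (X := Y ⊗ X ⊗ Z) (Y := Y ⊗ Z ⊗ X)
        ((Homeomorph.refl _).prodCongr (Homeomorph.prodComm _ _))).hom
    rw [mkIso_trans, mkIso_trans, mkIso_trans, mkIso_trans]
    exact mkIso_congr fun _ => rfl
  hexagon_reverse X Y Z := by
    change (mkIso (X := X ⊗ Y ⊗ Z) (Y := (X ⊗ Y) ⊗ Z) (Homeomorph.prodAssoc _ _ _).symm).hom ≫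
      (mkIso (X := (X ⊗ Y) ⊗ Z) (Y := Z ⊗ X ⊗ Y) (Homeomorph.prodComm _ _)).hom ≫
      (mkIso (X := Z ⊗ X ⊗ Y) (Y := (Z ⊗ X) ⊗ Y) (Homeomorph.prodAssoc _ _ _).symm).hom =
      (mkIso (X := X ⊗ Y ⊗ Z) (Y := X ⊗ Z ⊗ Y)
        ((Homeomorph.refl _).prodCongr (Homeomorph.prodComm _ _))).hom ≫
      (mkIso (X := X ⊗ Z ⊗ Y) (Y := (X ⊗ Z) ⊗ Y) (Homeomorph.prodAssoc _ _ _).symm).hom ≫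
      (mkIso (X := (X ⊗ Z) ⊗ Y) (Y := (Z ⊗ X) ⊗ Y)
        ((Homeomorph.prodComm _ _).prodCongr (Homeomorph.refl _))).hom
    rw [mkIso_trans, mkIso_trans, mkIso_trans, mkIso_trans]
    exact mkIso_congr fun _ => rfl
  symmetry X Y := (mkIso_trans _ _).trans (mkIso_congr fun _ => rfl)

end Corr

/-! ## The endomorphism operad of an object of the category of correspondences -/

namespace Corr

/-- The tensor power of an object, indexed by a set of labels. -/
abbrev pow (A : Corr.{u}) (I : Type) : Corr.{u} := of (TopCat.of (I → A.space))

/-- Permutation of the factors of a tensor power. -/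
def powCongr (A : Corr.{u}) {I J : Type} (e : I ≃ J) : (A.pow J).space ≃ₜ (A.pow I).space where
  toFun x := x ∘ e
  invFun x := x ∘ e.symm
  left_inv x := funext fun j => congrArg x (e.apply_symm_apply j)
  right_inv x := funext fun i => congrArg x (e.symm_apply_apply i)
  continuous_toFun := by fun_prop
  continuous_invFun := by fun_prop

/-- Splitting a tensor power into two blocks. -/
def powSum (A : Corr.{u}) (I J : Type) :
    (A.pow (I ⊕ J)).space ≃ₜ (A.pow I ⊗ A.pow J).space where
  toFun x := (x ∘ Sum.inl, x ∘ Sum.inr)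
  invFun p := Sum.elim p.1 p.2
  left_inv x := Sum.elim_comp_inl_inr x
  right_inv _ := rfl
  continuous_toFun := by fun_prop
  continuous_invFun := continuous_pi (by
    rintro (i | j)
    · exact (continuous_apply i).comp continuous_fst
    · exact (continuous_apply j).comp continuous_snd)

open Classical in
/-- Inserting the `i`-th factor into a tensor power. -/
noncomputable def powInsert (A : Corr.{u}) {I : Type} (i : I) :
    (A.pow {x : I // x ≠ i} ⊗ A).space ≃ₜ (A.pow I).space :=
  (Homeomorph.prodComm _ _).trans (Homeomorph.funSplitAt A.space i).symm

/-- Partial composition: `g` is inserted into the `i`-th tensor factor of the source of `f`. -/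
noncomputable def insertComp {A : Corr.{u}} {I J : Type} (f : A.pow I ⟶ A) (i : I)
    (g : A.pow J ⟶ A) : A.pow ({x : I // x ≠ i} ⊕ J) ⟶ A :=
  (mkIso (A.powSum {x : I // x ≠ i} J)).hom ≫ (A.pow {x : I // x ≠ i} ◁ g) ≫
    (mkIso (A.powInsert i)).hom ≫ f

/-- The partial composite of two spans, as a fibre product. -/
def spanInsert {A : TopCat.{u}} {I J : Type} (S : TopSpan (TopCat.of (I → A)) A) (i : I)
    (T : TopSpan (TopCat.of (J → A)) A) :
    TopSpan (TopCat.of ({x : I // x ≠ i} ⊕ J → A)) A where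
  apex := TopCat.of {p : S.apex × T.apex // S.left p.1 i = T.right p.2}
  left := ⟨fun p => Sum.elim (fun x => S.left p.1.1 x.1) (T.left p.1.2),
    continuous_pi (by
      rintro (x | y)
      · exact (continuous_apply x.1).comp (S.left.continuous.comp
          (continuous_fst.comp continuous_subtype_val))
      · exact (continuous_apply y).comp (T.left.continuous.comp
          (continuous_snd.comp continuous_subtype_val)))⟩
  right := ⟨fun p => S.right p.1.1, by fun_prop⟩

theorem insertComp_mk {A : TopCat.{u}} {I J : Type} (S : TopSpan (TopCat.of (I → A)) A) (i : I)
    (T : TopSpan (TopCat.of (J → A)) A) :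
    insertComp (A := of A) (mk S) i (mk T) = mk (spanInsert S i T) := by
  have key : ∀ q : ({x : I // x ≠ i} → A) × A, ∀ y : I → A,
      q = ((of A).powInsert i).symm y ↔ (∀ x : {x : I // x ≠ i}, q.1 x = y x) ∧ q.2 = y i := by
    rintro ⟨q₁, q₂⟩ y
    constructor
    · intro h
      rw [h]
      exact ⟨fun _ => rfl, rfl⟩
    · rintro ⟨h₁, h₂⟩
      exact Prod.ext (funext h₁) h₂
  unfold insertComp
  rw [mkIso_comp]
  refine (congrArg (_ ≫ ·) (mk_comp ((TopSpan.graph (Homeomorph.refl _)).prod T) _)).trans ?_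
  refine (mkIso_comp _ _).trans (mk_eq ?_)
  refine ⟨⟨⟨fun q => ⟨(q.1.2, q.1.1.2), (((key _ _).1 q.2).2).symm⟩,
    fun p => ⟨((fun x => S.left p.1.1 x.1, p.1.2), p.1.1), (key _ _).2 ⟨fun _ => rfl, p.2.symm⟩⟩,
    fun q => Subtype.ext (Prod.ext (Prod.ext (funext fun x => (((key _ _).1 q.2).1 x).symm) rfl)
      rfl), fun _ => rfl⟩, ?_, ?_⟩, ?_, fun _ => rfl⟩
  · fun_prop
  · refine Continuous.subtype_mk (Continuous.prodMk (Continuous.prodMk ?_ (by fun_prop))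
      (by fun_prop)) _
    exact continuous_pi fun x => (continuous_apply x.1).comp (S.left.continuous.comp
          (continuous_fst.comp continuous_subtype_val))
  · intro q
    refine funext ?_
    rintro (x | y)
    · exact (((key _ _).1 q.2).1 x).symm
    · rfl

/-- The action of bijections on spans. -/
def spanRelabel {A : TopCat.{u}} {I J : Type} (e : I ≃ J) (S : TopSpan (TopCat.of (I → A)) A) :
    TopSpan (TopCat.of (J → A)) A where
  apex := S.apex
  left := (((of A).powCongr e).symm : C(I → A, J → A)).comp S.left
  right := S.right

theorem relabel_mk {A : TopCat.{u}} {I J : Type} (e : I ≃ J)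
    (S : TopSpan (TopCat.of (I → A)) A) :
    (mkIso ((of A).powCongr e)).hom ≫ mk S = mk (spanRelabel e S) := mkIso_comp _ _

end Corr

open Corr in
/-- The endomorphism operad of an object `A` in the symmetric monoidal category of correspondences:
it has a single colour, and its `k`-ary operations are the morphisms `A ⊗ ⋯ ⊗ A ⟶ A`. -/
noncomputable def EndOperad (A : Corr.{u}) : ColouredOperad.{0, u + 1} where
  Ob := Unit
  Op I _ := A.pow I ⟶ A
  inc _ := ()
  out _ _ := ()
  one _ := (mkIso (X := A.pow Unit) (Homeomorph.funUnique Unit A.space)).hom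
  relabel e f := (mkIso (A.powCongr e)).hom ≫ f
  comp f i g _ := insertComp f i g
  inc_one _ := rfl
  out_one _ _ := rfl
  inc_relabel _ _ := rfl
  out_relabel _ _ _ := rfl
  inc_comp _ _ _ _ := rfl
  out_comp_inl _ _ _ _ _ := rfl
  out_comp_inr _ _ _ _ _ := rfl
  relabel_refl f := by
    induction f using ind with
    | _ S => exact relabel_mk _ S
  relabel_trans e e' f := by
    rw [← Category.assoc, mkIso_trans]
    rfl
  comp_relabel e e' f i g _ := by
    induction f using ind with
    | _ S =>
    induction g using ind with
    | _ T =>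
      rw [relabel_mk, relabel_mk, insertComp_mk, insertComp_mk, relabel_mk]
      have h : ∀ x : S.apex, (spanRelabel e S).left x (e i) = S.left x i := fun x =>
        congrArg (S.left x) (e.symm_apply_apply i)
      refine mk_eq ⟨⟨⟨fun p => ⟨p.1, (h _).symm.trans p.2⟩, fun p => ⟨p.1, (h _).trans p.2⟩,
        fun _ => rfl, fun _ => rfl⟩, by fun_prop, by fun_prop⟩, fun p => ?_, fun _ => rfl⟩
      refine funext ?_
      rintro (x | y) <;> rfl
  comp_assoc f i g j s _ _ := by
    induction f using ind with
    | _ S =>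
    induction g using ind with
    | _ T =>
    induction s using ind with
    | _ U =>
      rw [insertComp_mk, insertComp_mk, insertComp_mk, insertComp_mk, relabel_mk]
      refine mk_eq ⟨⟨⟨fun p => ⟨(p.1.1.1.1, ⟨(p.1.1.1.2, p.1.2), p.2⟩), p.1.1.2⟩,
        fun p => ⟨(⟨(p.1.1, p.1.2.1.1), p.2⟩, p.1.2.1.2), p.1.2.2⟩,
        fun _ => rfl, fun _ => rfl⟩, by fun_prop, by fun_prop⟩, fun p => ?_, fun _ => rfl⟩
      refine funext ?_
      rintro (x | y | z) <;> rfl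
  comp_comm f i r hr g s _ _ := by
    induction f using ind with
    | _ S =>
    induction g using ind with
    | _ T =>
    induction s using ind with
    | _ U =>
      rw [insertComp_mk, insertComp_mk, insertComp_mk, insertComp_mk, relabel_mk]
      refine mk_eq ⟨⟨⟨fun p => ⟨(⟨(p.1.1.1.1, p.1.2), p.2⟩, p.1.1.1.2), p.1.1.2⟩,
        fun p => ⟨(⟨(p.1.1.1.1, p.1.2), p.2⟩, p.1.1.1.2), p.1.1.2⟩,
        fun _ => rfl, fun _ => rfl⟩, by fun_prop, by fun_prop⟩, fun p => ?_, fun _ => rfl⟩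
      refine funext ?_
      rintro (⟨_ | _, _⟩ | _) <;> rfl
  comp_one f i := by
    induction f using ind with
    | _ S =>
      refine (congrArg ((mkIso (A.powCongr _)).hom ≫ ·)
        (insertComp_mk S i (TopSpan.graph (Homeomorph.funUnique Unit A.space)))).trans ?_
      refine (relabel_mk _ _).trans (mk_eq ⟨⟨⟨fun p => p.1.1, fun x => ⟨(x, fun _ => S.left x i), rfl⟩,
        fun p => Subtype.ext (Prod.ext rfl (funext fun _ => p.2)), fun _ => rfl⟩,
        by fun_prop, ?_⟩, fun p => ?_, fun _ => rfl⟩)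
      · exact Continuous.subtype_mk (Continuous.prodMk (by fun_prop)
          (continuous_pi fun _ => (continuous_apply i).comp S.left.continuous)) _
      · refine ((of A.space).powCongr (OperadIndex.unitRight i)).eq_symm_apply.2 (funext ?_)
        rintro (x | y)
        · rfl
        · exact p.2
  one_comp f := by
    induction f using ind with
    | _ S =>
      refine (congrArg ((mkIso (A.powCongr _)).hom ≫ ·)
        (insertComp_mk (TopSpan.graph (Homeomorph.funUnique Unit A.space)) () S)).trans ?_
      refine (relabel_mk _ _).trans (mk_eq ⟨⟨⟨fun p => p.1.2, fun x => ⟨(fun _ => S.right x, x), rfl⟩,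
        fun p => Subtype.ext (Prod.ext (funext fun _ => p.2.symm) rfl), fun _ => rfl⟩,
        by fun_prop, ?_⟩, fun p => rfl, fun p => p.2.symm⟩)
      exact Continuous.subtype_mk (Continuous.prodMk
          (continuous_pi fun _ => S.right.continuous) (by fun_prop)) _

/-! ## Cleaving trees -/

/-- Euclidean space of dimension `n + 1`. -/
abbrev Euc (n : ℕ) : Type := EuclideanSpace ℝ (Fin (n + 1))

/-- The unit sphere `Sⁿ` as a subset of `ℝⁿ⁺¹`. -/
abbrev unitSphere (n : ℕ) : Set (Euc n) := Metric.sphere 0 1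

/-- The closed unit disk `Dⁿ⁺¹`. -/
abbrev unitDisk (n : ℕ) : Set (Euc n) := Metric.closedBall 0 1

/-- Affine oriented hyperplanes of `ℝⁿ⁺¹`. An oriented linear hyperplane is given by its unit
normal vector, and it is translated by `offset` times that vector. -/
structure Hyp (n : ℕ) where
  /-- the unit normal vector -/
  normal : unitSphere n
  /-- the translation -/
  offset : ℝ

namespace Hyp

variable {n : ℕ}

/-- The points of the hyperplane. -/
def points (P : Hyp n) : Set (Euc n) := {x | inner ℝ P.normal.1 x = P.offset}

/-- The open half-space in the direction of the normal vector. -/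
def plus (P : Hyp n) : Set (Euc n) := {x | P.offset < inner ℝ P.normal.1 x}

/-- The open half-space in the direction opposite to the normal vector. -/
def minus (P : Hyp n) : Set (Euc n) := {x | inner ℝ P.normal.1 x < P.offset}

/-- The hyperplane intersects the open subset `U` of the sphere transversally: at each point of the
intersection, the tangent space of the sphere (the orthogonal complement of the point) and the
direction of the hyperplane (the orthogonal complement of the normal vector) span `ℝⁿ⁺¹`. -/
def Transverse (P : Hyp n) (U : Set (Euc n)) : Prop :=
  ∀ x ∈ P.points ∩ U, (ℝ ∙ x)ᗮ ⊔ (ℝ ∙ P.normal.1)ᗮ = ⊤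

end Hyp

/-- Planar rooted binary trees whose trivalent vertices are decorated by affine oriented
hyperplanes: `node P l r` has `P` at the vertex next to the root, `l` on its left-going and `r` on
its right-going edge. -/
inductive CutTree (n : ℕ) : Type
  | leaf : CutTree n
  | node (P : Hyp n) (l r : CutTree n) : CutTree n

namespace CutTree

variable {n : ℕ}

/-- The leaves of a tree. -/
def Leaf : CutTree n → Type
  | leaf => Unit
  | node _ l r => Leaf l ⊕ Leaf r

/-- The subset associated to a leaf by the recursive cleaving process, starting from `U`: at each
trivalent vertex, the left-going edge gets the part on the negative side of the decorating
hyperplane, and the right-going edge the part on its positive side. -/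
def piece : (t : CutTree n) → Set (Euc n) → t.Leaf → Set (Euc n)
  | leaf, U, _ => U
  | node P l _, U, Sum.inl x => piece l (U ∩ P.minus) x
  | node P _ r, U, Sum.inr x => piece r (U ∩ P.plus) x

/-- The tree is `U`-cleaving: at each trivalent vertex, the decorating hyperplane intersects the
subset associated to the vertex transversally, and it leaves a nonempty part on both sides. -/
def Cleaves : CutTree n → Set (Euc n) → Prop
  | leaf, _ => True
  | node P l r, U => P.Transverse U ∧ (U ∩ P.minus).Nonempty ∧ (U ∩ P.plus).Nonempty ∧
      Cleaves l (U ∩ P.minus) ∧ Cleaves r (U ∩ P.plus)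

/-- Grafting the tree `s` onto a leaf of `t`. -/
def graft : (t : CutTree n) → t.Leaf → CutTree n → CutTree n
  | leaf, _, s => s
  | node P l r, Sum.inl x, s => node P (graft l x s) r
  | node P l r, Sum.inr x, s => node P l (graft r x s)

/-- The inclusion of the remaining leaves of `t` in the leaves of the grafted tree. -/
def graftInl : (t : CutTree n) → (x : t.Leaf) → (s : CutTree n) →
    {y : t.Leaf // y ≠ x} → (t.graft x s).Leaf
  | leaf, _, _, y => (y.2 rfl).elim
  | node _ l _, Sum.inl x, s, ⟨Sum.inl y, h⟩ =>
      Sum.inl (graftInl l x s ⟨y, fun e => h (congrArg Sum.inl e)⟩)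
  | node _ _ _, Sum.inl _, _, ⟨Sum.inr y, _⟩ => Sum.inr y
  | node _ _ _, Sum.inr _, _, ⟨Sum.inl y, _⟩ => Sum.inl y
  | node _ _ r, Sum.inr x, s, ⟨Sum.inr y, h⟩ =>
      Sum.inr (graftInl r x s ⟨y, fun e => h (congrArg Sum.inr e)⟩)

/-- The inclusion of the leaves of `s` in the leaves of the grafted tree. -/
def graftInr : (t : CutTree n) → (x : t.Leaf) → (s : CutTree n) → s.Leaf → (t.graft x s).Leaf
  | leaf, _, _, y => y
  | node _ l _, Sum.inl x, s, y => Sum.inl (graftInr l x s y)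
  | node _ _ r, Sum.inr x, s, y => Sum.inr (graftInr r x s y)

theorem graft_bijective : ∀ (t : CutTree n) (x : t.Leaf) (s : CutTree n),
    Function.Bijective (Sum.elim (graftInl t x s) (graftInr t x s))
  | leaf, _, s => by
    refine ⟨?_, fun z => ⟨Sum.inr z, rfl⟩⟩
    rintro (⟨a, ha⟩ | a) (⟨b, hb⟩ | b) h
    · exact (ha rfl).elim
    · exact (ha rfl).elim
    · exact (hb rfl).elim
    · exact congrArg Sum.inr h
  | node P l r, Sum.inl x, s => by
    obtain ⟨hi, hs⟩ := graft_bijective l x s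
    constructor
    · rintro (⟨a | a, ha⟩ | a) (⟨b | b, hb⟩ | b) h
      · have := @hi (Sum.inl ⟨a, fun e => ha (congrArg Sum.inl e)⟩)
          (Sum.inl ⟨b, fun e => hb (congrArg Sum.inl e)⟩) (Sum.inl_injective h)
        cases this; rfl
      · cases h
      · have := @hi (Sum.inl ⟨a, fun e => ha (congrArg Sum.inl e)⟩) (Sum.inr b)
          (Sum.inl_injective h)
        cases this
      · cases h
      · cases h; rfl
      · cases h
      · have := @hi (Sum.inr a) (Sum.inl ⟨b, fun e => hb (congrArg Sum.inl e)⟩)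
          (Sum.inl_injective h)
        cases this
      · cases h
      · have := @hi (Sum.inr a) (Sum.inr b) (Sum.inl_injective h)
        cases this; rfl
    · rintro (z | z)
      · obtain ⟨⟨y, hy⟩ | y, rfl⟩ := hs z
        · exact ⟨Sum.inl ⟨Sum.inl y, fun e => hy (Sum.inl_injective e)⟩, rfl⟩
        · exact ⟨Sum.inr y, rfl⟩
      · exact ⟨Sum.inl ⟨Sum.inr z, Sum.inr_ne_inl⟩, rfl⟩
  | node P l r, Sum.inr x, s => by
    obtain ⟨hi, hs⟩ := graft_bijective r x s
    constructor
    · rintro (⟨a | a, ha⟩ | a) (⟨b | b, hb⟩ | b) h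
      · cases h; rfl
      · cases h
      · cases h
      · cases h
      · have := @hi (Sum.inl ⟨a, fun e => ha (congrArg Sum.inr e)⟩)
          (Sum.inl ⟨b, fun e => hb (congrArg Sum.inr e)⟩) (Sum.inr_injective h)
        cases this; rfl
      · have := @hi (Sum.inl ⟨a, fun e => ha (congrArg Sum.inr e)⟩) (Sum.inr b)
          (Sum.inr_injective h)
        cases this
      · cases h
      · have := @hi (Sum.inr a) (Sum.inl ⟨b, fun e => hb (congrArg Sum.inr e)⟩)
          (Sum.inr_injective h)
        cases this
      · have := @hi (Sum.inr a) (Sum.inr b) (Sum.inr_injective h)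
        cases this; rfl
    · rintro (z | z)
      · exact ⟨Sum.inl ⟨Sum.inl z, Sum.inl_ne_inr⟩, rfl⟩
      · obtain ⟨⟨y, hy⟩ | y, rfl⟩ := hs z
        · exact ⟨Sum.inl ⟨Sum.inr y, fun e => hy (Sum.inr_injective e)⟩, rfl⟩
        · exact ⟨Sum.inr y, rfl⟩

/-- The leaves of a grafted tree. -/
noncomputable def graftEquiv (t : CutTree n) (x : t.Leaf) (s : CutTree n) :
    {y : t.Leaf // y ≠ x} ⊕ s.Leaf ≃ (t.graft x s).Leaf :=
  Equiv.ofBijective _ (graft_bijective t x s)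

theorem piece_graft_inl : ∀ (t : CutTree n) (x : t.Leaf) (s : CutTree n)
    (y : {y : t.Leaf // y ≠ x}) (U : Set (Euc n)),
    (t.graft x s).piece U (graftInl t x s y) = t.piece U y.1
  | leaf, _, _, y, _ => (y.2 rfl).elim
  | node P l _, Sum.inl x, s, ⟨Sum.inl y, h⟩, U =>
      piece_graft_inl l x s ⟨y, fun e => h (congrArg Sum.inl e)⟩ (U ∩ P.minus)
  | node _ _ _, Sum.inl _, _, ⟨Sum.inr _, _⟩, _ => rfl
  | node _ _ _, Sum.inr _, _, ⟨Sum.inl _, _⟩, _ => rfl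
  | node P _ r, Sum.inr x, s, ⟨Sum.inr y, h⟩, U =>
      piece_graft_inl r x s ⟨y, fun e => h (congrArg Sum.inr e)⟩ (U ∩ P.plus)

theorem piece_graft_inr : ∀ (t : CutTree n) (x : t.Leaf) (s : CutTree n) (y : s.Leaf)
    (U : Set (Euc n)),
    (t.graft x s).piece U (graftInr t x s y) = s.piece (t.piece U x) y
  | leaf, _, _, _, _ => rfl
  | node P l _, Sum.inl x, s, y, U => piece_graft_inr l x s y (U ∩ P.minus)
  | node P _ r, Sum.inr x, s, y, U => piece_graft_inr r x s y (U ∩ P.plus)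

theorem cleaves_graft : ∀ (t : CutTree n) (x : t.Leaf) (s : CutTree n) (U : Set (Euc n)),
    t.Cleaves U → s.Cleaves (t.piece U x) → (t.graft x s).Cleaves U
  | leaf, _, _, _, _, h => h
  | node P l _, Sum.inl x, s, U, ⟨h₁, h₂, h₃, h₄, h₅⟩, h =>
      ⟨h₁, h₂, h₃, cleaves_graft l x s (U ∩ P.minus) h₄ h, h₅⟩
  | node P _ r, Sum.inr x, s, U, ⟨h₁, h₂, h₃, h₄, h₅⟩, h =>
      ⟨h₁, h₂, h₃, h₄, cleaves_graft r x s (U ∩ P.plus) h₅ h⟩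

end CutTree

/-! ## The cleavage operad of the sphere -/

/-- Timber: the subsets of the sphere associated to the leaves of the cleaving trees of the
sphere. -/
def IsTimber (n : ℕ) (U : Set (Euc n)) : Prop :=
  ∃ t : CutTree n, t.Cleaves (unitSphere n) ∧ ∃ x : t.Leaf, t.piece (unitSphere n) x = U

/-- The complement of `U` in the sphere is homotopy equivalent to a finite discrete space, i.e. it
is the disjoint union of finitely many (possibly no) contractible components. -/
def HasContractibleComplement (n : ℕ) (U : Set (Euc n)) : Prop :=
  ∃ m : ℕ, Nonempty (ContinuousMap.HomotopyEquiv ↥(unitSphere n \ U) (Fin m))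

/-- The colours of the cleavage operad. -/
def Colour (n : ℕ) : Type :=
  {U : Set (Euc n) // IsTimber n U ∧ HasContractibleComplement n U}

/-- The operations of the pre-cleavage operad on the colours above, with label set `I`: decorated
trees with leaves labelled by `I` which cleave the incoming colour. -/
structure PreCleavage (n : ℕ) (I : Type) where
  /-- the incoming colour -/
  source : Colour n
  /-- the decorated tree -/
  tree : CutTree n
  /-- the labelling of the leaves -/
  label : I ≃ tree.Leaf
  cleaves : tree.Cleaves source.1
  /-- the outgoing timber has contractible complement components -/
  contractible : ∀ i, HasContractibleComplement n (tree.piece source.1 (label i))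

namespace PreCleavage

variable {n : ℕ} {I J : Type}

/-- The outgoing timber. -/
def timber (p : PreCleavage n I) (i : I) : Set (Euc n) := p.tree.piece p.source.1 (p.label i)

theorem isTimber (p : PreCleavage n I) (i : I) : IsTimber n (p.timber i) := by
  obtain ⟨t, ht, x, hx⟩ := p.source.2.1
  refine ⟨t.graft x p.tree, t.cleaves_graft x p.tree _ ht (by rw [hx]; exact p.cleaves),
    t.graftInr x p.tree (p.label i), ?_⟩
  rw [t.piece_graft_inr, hx]
  rfl

/-- The outgoing colours. -/
def target (p : PreCleavage n I) (i : I) : Colour n := ⟨p.timber i, p.isTimber i, p.contractible i⟩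

/-- Chop-equivalence: the incoming colours agree, and so do the outgoing colours, label by
label. -/
def Chop (p q : PreCleavage n I) : Prop :=
  p.source = q.source ∧ ∀ i, p.target i = q.target i

instance chop (n : ℕ) (I : Type) : Setoid (PreCleavage n I) where
  r := Chop
  iseqv :=
    { refl := fun _ => ⟨rfl, fun _ => rfl⟩
      symm := fun h => ⟨h.1.symm, fun i => (h.2 i).symm⟩
      trans := fun h h' => ⟨h.1.trans h'.1, fun i => (h.2 i).trans (h'.2 i)⟩ }

/-- The tree without trivalent vertices. -/
def trivial (U : Colour n) : PreCleavage n Unit where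
  source := U
  tree := .leaf
  label := Equiv.refl Unit
  cleaves := True.intro
  contractible _ := U.2.2

/-- Relabelling of the leaves. -/
def relabel (e : I ≃ J) (p : PreCleavage n I) : PreCleavage n J where
  source := p.source
  tree := p.tree
  label := e.symm.trans p.label
  cleaves := p.cleaves
  contractible j := p.contractible (e.symm j)

/-- Grafting of decorated trees, with its labels. -/
noncomputable def graftLabel (p : PreCleavage n I) (i : I) (q : PreCleavage n J) :
    {x : I // x ≠ i} ⊕ J ≃ (p.tree.graft (p.label i) q.tree).Leaf :=
  (OperadIndex.congr p.label i q.label).trans (p.tree.graftEquiv (p.label i) q.tree)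

theorem piece_graft_inl (p : PreCleavage n I) (i : I) (q : PreCleavage n J)
    (x : {x : I // x ≠ i}) :
    (p.tree.graft (p.label i) q.tree).piece p.source.1 (graftLabel p i q (Sum.inl x)) =
      p.timber x.1 :=
  CutTree.piece_graft_inl _ _ _ _ _

theorem piece_graft_inr (p : PreCleavage n I) (i : I) (q : PreCleavage n J)
    (h : q.source = p.target i) (y : J) :
    (p.tree.graft (p.label i) q.tree).piece p.source.1 (graftLabel p i q (Sum.inr y)) =
      q.timber y := by
  refine (CutTree.piece_graft_inr _ _ _ _ _).trans ?_
  have h' : q.source.1 = p.tree.piece p.source.1 (p.label i) := congrArg Subtype.val h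
  rw [← h']
  rfl

/-- Operadic composition: grafting of the trees, retaining all decorations. -/
noncomputable def graft (p : PreCleavage n I) (i : I) (q : PreCleavage n J)
    (h : q.source = p.target i) : PreCleavage n ({x : I // x ≠ i} ⊕ J) where
  source := p.source
  tree := p.tree.graft (p.label i) q.tree
  label := graftLabel p i q
  cleaves := by
    refine p.tree.cleaves_graft (p.label i) q.tree _ p.cleaves ?_
    have h' : q.source.1 = p.tree.piece p.source.1 (p.label i) := congrArg Subtype.val h
    rw [← h']
    exact q.cleaves
  contractible := by
    rintro (x | y)
    · rw [piece_graft_inl]; exact p.contractible x.1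
    · rw [piece_graft_inr p i q h]; exact q.contractible y

theorem target_graft_inl (p : PreCleavage n I) (i : I) (q : PreCleavage n J)
    (h : q.source = p.target i) (x : {x : I // x ≠ i}) :
    (p.graft i q h).target (Sum.inl x) = p.target x.1 :=
  Subtype.ext (piece_graft_inl p i q x)

theorem target_graft_inr (p : PreCleavage n I) (i : I) (q : PreCleavage n J)
    (h : q.source = p.target i) (y : J) :
    (p.graft i q h).target (Sum.inr y) = q.target y :=
  Subtype.ext (piece_graft_inr p i q h y)

end PreCleavage

/-- The operations of the cleavage operad: decorated trees modulo chop-equivalence. -/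
def Cleavage (n : ℕ) (I : Type) : Type := Quotient (PreCleavage.chop n I)

namespace Cleavage

variable {n : ℕ} {I J : Type}

/-- The class of a decorated tree. -/
def mk (p : PreCleavage n I) : Cleavage n I := Quotient.mk _ p

/-- The incoming colour. -/
def source (f : Cleavage n I) : Colour n :=
  Quotient.lift PreCleavage.source (fun p q (h : p.Chop q) => h.1) f

/-- The outgoing colours. -/
def target (f : Cleavage n I) : I → Colour n :=
  Quotient.lift PreCleavage.target (fun p q (h : p.Chop q) => funext h.2) f

theorem ext {f g : Cleavage n I} (h : f.source = g.source) (h' : ∀ i, f.target i = g.target i) :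
    f = g := by
  induction f using Quotient.inductionOn with
  | _ p =>
  induction g using Quotient.inductionOn with
  | _ q => exact Quotient.sound ⟨h, h'⟩

theorem source_out (f : Cleavage n I) : (Quotient.out f).source = f.source :=
  congrArg source (Quotient.out_eq f)

theorem target_out (f : Cleavage n I) (i : I) : (Quotient.out f).target i = f.target i :=
  congrFun (congrArg target (Quotient.out_eq f)) i

/-- Relabelling. -/
def relabel (e : I ≃ J) (f : Cleavage n I) : Cleavage n J :=
  Quotient.map (PreCleavage.relabel e)
    (fun p q (h : p.Chop q) => ⟨h.1, fun j => h.2 (e.symm j)⟩) f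

/-- Operadic composition, through representatives; `mk_comp_mk` says that it does not depend on
their choice. -/
noncomputable def comp (f : Cleavage n I) (i : I) (g : Cleavage n J)
    (h : g.source = f.target i) : Cleavage n ({x : I // x ≠ i} ⊕ J) :=
  mk ((Quotient.out f).graft i (Quotient.out g)
    ((source_out g).trans (h.trans (target_out f i).symm)))

theorem source_relabel (e : I ≃ J) (f : Cleavage n I) : (f.relabel e).source = f.source := by
  induction f using Quotient.inductionOn with
  | _ p => rfl

theorem target_relabel (e : I ≃ J) (f : Cleavage n I) (j : J) :
    (f.relabel e).target j = f.target (e.symm j) := by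
  induction f using Quotient.inductionOn with
  | _ p => rfl

theorem source_comp (f : Cleavage n I) (i : I) (g : Cleavage n J) (h : g.source = f.target i) :
    (f.comp i g h).source = f.source := source_out f

theorem target_comp_inl (f : Cleavage n I) (i : I) (g : Cleavage n J)
    (h : g.source = f.target i) (x : {x : I // x ≠ i}) :
    (f.comp i g h).target (Sum.inl x) = f.target x.1 :=
  (PreCleavage.target_graft_inl _ _ _ _ x).trans (target_out f x.1)

theorem target_comp_inr (f : Cleavage n I) (i : I) (g : Cleavage n J)
    (h : g.source = f.target i) (y : J) :
    (f.comp i g h).target (Sum.inr y) = g.target y :=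
  (PreCleavage.target_graft_inr _ _ _ _ y).trans (target_out g y)

theorem mk_comp_mk (p : PreCleavage n I) (i : I) (q : PreCleavage n J)
    (h : q.source = p.target i) : (mk p).comp i (mk q) h = mk (p.graft i q h) := by
  refine ext (source_comp _ _ _ _) ?_
  rintro (x | y)
  · exact (target_comp_inl _ _ _ _ x).trans (PreCleavage.target_graft_inl p i q h x).symm
  · exact (target_comp_inr _ _ _ _ y).trans (PreCleavage.target_graft_inr p i q h y).symm

end Cleavage

/-- The cleavage operad of the unit sphere `Sⁿ`. -/
noncomputable def Cleav (n : ℕ) : ColouredOperad.{0, 0} where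
  Ob := Colour n
  Op I _ := Cleavage n I
  inc f := f.source
  out f := f.target
  one U := Cleavage.mk (PreCleavage.trivial U)
  relabel e f := f.relabel e
  comp f i g h := f.comp i g h
  inc_one _ := rfl
  out_one _ _ := rfl
  inc_relabel := Cleavage.source_relabel
  out_relabel e f i := by rw [Cleavage.target_relabel, e.symm_apply_apply]
  inc_comp := Cleavage.source_comp
  out_comp_inl := Cleavage.target_comp_inl
  out_comp_inr := Cleavage.target_comp_inr
  relabel_refl f := Cleavage.ext (Cleavage.source_relabel _ f)
    fun i => Cleavage.target_relabel _ f i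
  relabel_trans e e' f := Cleavage.ext (by simp only [Cleavage.source_relabel])
    fun i => by simp only [Cleavage.target_relabel]; rfl
  comp_relabel e e' f i g h := by
    refine Cleavage.ext (by simp only [Cleavage.source_relabel, Cleavage.source_comp]) ?_
    rintro (x | y)
    · rw [Cleavage.target_comp_inl, Cleavage.target_relabel, Cleavage.target_relabel]
      exact (Cleavage.target_comp_inl f i g h
        (⟨e.symm x.1, fun hx => x.2 (e.symm_apply_eq.1 hx)⟩)).symm
    · rw [Cleavage.target_comp_inr, Cleavage.target_relabel, Cleavage.target_relabel]
      exact (Cleavage.target_comp_inr f i g h _).symm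
  comp_assoc f i g j s h h' := by
    refine Cleavage.ext (by simp only [Cleavage.source_relabel, Cleavage.source_comp]) ?_
    intro z
    rw [Cleavage.target_relabel]
    rcases z with x | y | l
    · refine (Cleavage.target_comp_inl (f.comp i g h) _ s _ ⟨Sum.inl x, Sum.inl_ne_inr⟩).trans ?_
      rw [Cleavage.target_comp_inl, Cleavage.target_comp_inl]
    · refine (Cleavage.target_comp_inl (f.comp i g h) _ s _
        ⟨Sum.inr y.1, fun h => y.2 (Sum.inr_injective h)⟩).trans ?_
      rw [Cleavage.target_comp_inr, Cleavage.target_comp_inr, Cleavage.target_comp_inl]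
    · refine (Cleavage.target_comp_inr (f.comp i g h) _ s _ l).trans ?_
      rw [Cleavage.target_comp_inr, Cleavage.target_comp_inr]
  comp_comm f i r hr g s h h' := by
    refine Cleavage.ext (by simp only [Cleavage.source_relabel, Cleavage.source_comp]) ?_
    intro z
    rw [Cleavage.target_relabel]
    rcases z with ⟨x | l, hz⟩ | y
    · refine (Cleavage.target_comp_inl (f.comp i g h) _ s _
        ⟨Sum.inl ⟨x.1, fun e => hz (congrArg Sum.inl (Subtype.ext e))⟩,
          fun e => x.2 (congrArg Subtype.val (Sum.inl_injective e))⟩).trans ?_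
      rw [Cleavage.target_comp_inl, Cleavage.target_comp_inl]
      exact (Cleavage.target_comp_inl f r s h' x).symm
    · refine (Cleavage.target_comp_inr (f.comp i g h) _ s _ l).trans ?_
      rw [Cleavage.target_comp_inl]
      exact (Cleavage.target_comp_inr f r s h' l).symm
    · refine (Cleavage.target_comp_inl (f.comp i g h) _ s _ ⟨Sum.inr y, Sum.inr_ne_inl⟩).trans ?_
      rw [Cleavage.target_comp_inr, Cleavage.target_comp_inr]
  comp_one f i := by
    refine Cleavage.ext ((Cleavage.source_relabel _ _).trans (Cleavage.source_comp _ _ _ _)) ?_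
    intro x
    obtain ⟨z, rfl⟩ := (OperadIndex.unitRight i).surjective x
    rw [Cleavage.target_relabel, Equiv.symm_apply_apply]
    rcases z with x | y
    · exact Cleavage.target_comp_inl _ _ _ _ _
    · exact Cleavage.target_comp_inr _ _ _ _ _
  one_comp f := by
    refine Cleavage.ext (by simp only [Cleavage.source_relabel, Cleavage.source_comp]; rfl) ?_
    intro x
    rw [Cleavage.target_relabel]
    exact Cleavage.target_comp_inr _ _ _ _ _

/-! ## The pullback construction -/

/-- `W` is the convex region of the disk that belongs to the timber `U`: the same recursive process
that produces `U` at a leaf of a cleaving tree of the sphere produces `W` when it is applied to the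
disk. -/
def IsRegionOf {n : ℕ} (U W : Set (Euc n)) : Prop :=
  ∃ t : CutTree n, t.Cleaves (unitSphere n) ∧ ∃ x : t.Leaf,
    t.piece (unitSphere n) x = U ∧ t.piece (unitDisk n) x = W

/-- The blueprint of a decorated tree: what remains of the disk when the parts associated to the
leaves are removed. Here `W` is the region of the disk at the root. -/
def CutTree.blueprint {n : ℕ} (t : CutTree n) (W : Set (Euc n)) : Set (Euc n) :=
  unitDisk n \ ⋃ x : t.Leaf, t.piece W x

namespace PreCleavage

variable {n : ℕ} {I : Type}

/-- The blueprint, for the region `W` of the incoming colour. -/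
def blueprint (p : PreCleavage n I) (W : Set (Euc n)) : Set (Euc n) := p.tree.blueprint W

/-- The complement in the sphere of the `i`-th outgoing timber. -/
def compl (p : PreCleavage n I) (i : I) : Set (Euc n) := unitSphere n \ p.timber i

/-- The space of continuous maps `Sⁿ → M` (with the compact-open topology) that are constant along
each path-component of the blueprint. -/
abbrev ConstantMaps (p : PreCleavage n I) (W : Set (Euc n)) (M : Type u) [TopologicalSpace M] :
    Type u :=
  {f : C(unitSphere n, M) // ∀ (x y : unitSphere n) (hx : x.1 ∈ p.blueprint W)
    (hy : y.1 ∈ p.blueprint W),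
    ZerothHomotopy.mk (X := p.blueprint W) ⟨x.1, hx⟩ = ZerothHomotopy.mk ⟨y.1, hy⟩ → f x = f y}

/-- The restriction map to the complements of the outgoing timber. -/
def res (p : PreCleavage n I) (M : Type u) [TopologicalSpace M] :
    C(I → C(unitSphere n, M), (i : I) → C(p.compl i, M)) where
  toFun f i := (f i).comp ⟨Set.inclusion Set.sdiff_subset, continuous_inclusion Set.sdiff_subset⟩
  continuous_toFun := by fun_prop

/-- `ξ`, a morphism of correspondences from the `I`-th power of `C(Sⁿ, M)` to `C(Sⁿ, M)`, is the one
that the pullback construction associates to the decorated tree `p`: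
* `c` sends each component of the complement of the `i`-th timber to the path-component of the
  blueprint that contains the boundary of this component;
* `φ : M ^ π₀(β) → ∏ᵢ M ^ (Sⁿ \ Uᵢ)` is induced by `c`;
* the maps that are constant along the components of the blueprint are the pullback of `φ` and of
  the restriction map, by `ev`, which takes the values on the components of the blueprint, and by
  `φ'`, whose `i`-th component does not change the map on the `i`-th timber;
* `ξ` is the span of `φ'` and the inclusion. -/
def IsPullbackConstruction (p : PreCleavage n I) (W : Set (Euc n)) (M : Type u)
    [TopologicalSpace M]
    (ξ : (Corr.of (TopCat.of C(unitSphere n, M))).pow I ⟶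
      Corr.of (TopCat.of C(unitSphere n, M))) : Prop :=
  ∃ (c : (i : I) → p.compl i → ZerothHomotopy (p.blueprint W))
    (φ : C(ZerothHomotopy (p.blueprint W) → M, (i : I) → C(p.compl i, M)))
    (ev : C(p.ConstantMaps W M, ZerothHomotopy (p.blueprint W) → M))
    (φ' : C(p.ConstantMaps W M, I → C(unitSphere n, M))),
    (∀ (i : I) (x : p.compl i), ∀ y ∈ connectedComponentIn (p.compl i) x ∩ closure (p.timber i),
      ∃ hy : y ∈ p.blueprint W, c i x = ZerothHomotopy.mk ⟨y, hy⟩) ∧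
    (∀ (g : ZerothHomotopy (p.blueprint W) → M) (i : I) (x : p.compl i), φ g i x = g (c i x)) ∧
    (∀ (f : p.ConstantMaps W M) (x : unitSphere n) (hx : x.1 ∈ p.blueprint W),
      ev f (ZerothHomotopy.mk ⟨x.1, hx⟩) = f.1 x) ∧
    (∀ (f : p.ConstantMaps W M) (i : I) (x : unitSphere n), x.1 ∈ p.timber i →
      φ' f i x = f.1 x) ∧
    IsPullback (TopCat.ofHom φ') (TopCat.ofHom ev) (TopCat.ofHom (p.res M)) (TopCat.ofHom φ) ∧
    ξ = Corr.mk ⟨TopCat.of (p.ConstantMaps W M), φ', ⟨Subtype.val, continuous_subtype_val⟩⟩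

end PreCleavage

/-! Each colour at the leaves of a tree is the trace on the sphere of an open convex set `O i`, an
intersection of half-spaces; the `O i` are pairwise disjoint and the blueprint β is the disk minus
their union. `IsCarving` records the geometry that is needed. β is a finite union of closed convex
sets, so every function constant along its path-components is locally constant, and every
path-component of β reaches the sphere.

The `i`-th component of φ* is f ∘ `pick`, where `pick` is the identity on the timber and moves each
component of its complement to one of its boundary points. Choices do not matter: the radial
retraction onto the closure of `O i` pushes a path in the complement of the timber, which may cross
other members, into β, so the whole boundary of a complement component lies in one path-component of
β. Thus f ∘ `pick` agrees with f on the closure of the timber and is locally constant on its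
complement, hence continuous. The square is a pullback by gluing: a compatible pair (a, b) comes
from the map equal to b on β and to a i on the `i`-th timber.

Chop-equivalent trees may have different blueprints, but the relation "joined in β" between points
of the sphere depends on the timber only (`joinedIn_of_timber_eq`). The argument is additive. Take
an integer function g, locally constant on the trace of β and constant on the boundary of each
complement component. Radial projection from a point of timber `i` spreads the values of g on these
boundaries to a function G i on the disk outside `O i`. Then g − ∑ G i extends to a locally constant
function on the connected sphere, so it is constant; as ∑ G i is constant along paths in β, so is g
between points of the sphere joined in β. Apply this to the indicator of a path-component of the
other blueprint.

For a grafted tree, with family Q inside `O i`, the blueprint is the union of the blueprint of O and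
of the part of the blueprint of Q in the closure of `O i`. A map f is constant along it exactly when
f is constant along the first blueprint and f ∘ `pick` along that of Q
(`isConstantAlong_extend_of_insert`, `isConstantAlong_insert`). This is the fibre product by which
correspondences compose.

Operations with one input have no hyperplanes. They act by the diagonal, here the identity
correspondence, and this agrees with the pullback construction when the colour is the whole sphere.
-/

open Set Topology Filter

/-! ## Locally constant functions on closed sets -/

/-- `k` is locally constant on `B`, and `B` is closed. -/
def LocConstOn {E X : Type*} [TopologicalSpace E] (k : E → X) (B : Set E) : Prop :=
  ∀ A : Set X, IsClosed (B ∩ k ⁻¹' A)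

namespace LocConstOn

variable {E X Y : Type*} [TopologicalSpace E] {k k' : E → X} {B B' : Set E}

theorem isClosed (h : LocConstOn k B) : IsClosed B := by simpa using h univ

theorem mono (h : LocConstOn k B) (hB : B' ⊆ B) (hc : IsClosed B') : LocConstOn k B' := by
  intro A
  have : B' ∩ k ⁻¹' A = B' ∩ (B ∩ k ⁻¹' A) := by
    rw [← inter_assoc, inter_eq_self_of_subset_left hB]
  rw [this]
  exact hc.inter (h A)

theorem congr (h : LocConstOn k B) (e : ∀ x ∈ B, k' x = k x) : LocConstOn k' B := by
  intro A
  have : B ∩ k' ⁻¹' A = B ∩ k ⁻¹' A := by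
    ext x
    exact and_congr_right fun hx => by simp [e x hx]
  rw [this]
  exact h A

theorem union (h : LocConstOn k B) (h' : LocConstOn k B') : LocConstOn k (B ∪ B') := by
  intro A
  rw [union_inter_distrib_right]
  exact (h A).union (h' A)

theorem iUnion {ι : Type*} [Finite ι] {B : ι → Set E} (h : ∀ i, LocConstOn k (B i)) :
    LocConstOn k (⋃ i, B i) := by
  intro A
  rw [iUnion_inter]
  exact isClosed_iUnion_of_finite fun i => h i A

theorem postcomp (h : LocConstOn k B) (g : X → Y) : LocConstOn (g ∘ k) B := fun A => h (g ⁻¹' A)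

theorem const (hB : IsClosed B) (x : X) (h : ∀ y ∈ B, k y = x) : LocConstOn k B := by
  intro A
  by_cases hx : x ∈ A
  · convert hB using 1
    ext y
    exact ⟨fun hy => hy.1, fun hy => ⟨hy, by simpa [h y hy] using hx⟩⟩
  · convert isClosed_empty using 1
    ext y
    refine ⟨fun hy => hx ?_, fun hy => hy.elim⟩
    rw [← h y hy.1]
    exact hy.2

theorem continuousOn [TopologicalSpace X] (h : LocConstOn k B) : ContinuousOn k B := by
  rw [continuousOn_iff_isClosed]
  intro t _
  exact ⟨B ∩ k ⁻¹' t, h t, by rw [inter_comm, inter_assoc, inter_comm _ B, ← inter_assoc,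
    inter_self]⟩

theorem of_continuousOn [TopologicalSpace X] [DiscreteTopology X] (hB : IsClosed B)
    (h : ContinuousOn k B) : LocConstOn k B := by
  intro A
  obtain ⟨u, hu, e⟩ := continuousOn_iff_isClosed.1 h A (isClosed_discrete A)
  rw [inter_comm, e]
  exact hu.inter hB

theorem eq_of_isPreconnected (h : LocConstOn k B) {T : Set E} (hT : IsPreconnected T)
    (hTB : T ⊆ B) {x y : E} (hx : x ∈ T) (hy : y ∈ T) : k x = k y := by
  -- The codomain carries no topology; with the discrete one, local constancy becomes continuity.
  let _ : TopologicalSpace X := ⊥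
  have : DiscreteTopology X := ⟨rfl⟩
  exact hT.constant (h.continuousOn.mono hTB) hx hy

theorem eq_of_joinedIn (h : LocConstOn k B) {x y : E} (hxy : JoinedIn B x y) : k x = k y :=
  h.eq_of_isPreconnected
    (isPathConnected_pathComponentIn hxy.source_mem).isConnected.isPreconnected
    pathComponentIn_subset (mem_pathComponentIn_self hxy.source_mem) hxy

/-- A function of two variables that is continuous in the first one and locally constant in the
second one is continuous. -/
theorem continuousOn_prod {Z M : Type*} [TopologicalSpace Z] [TopologicalSpace M]
    (h : LocConstOn k B) {F : Z × E → M} (hF : ∀ x ∈ B, Continuous fun z => F (z, x))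
    (hk : ∀ z, ∀ x ∈ B, ∀ y ∈ B, k x = k y → F (z, x) = F (z, y)) :
    ContinuousOn F (univ ×ˢ B) := by
  rintro ⟨z, x⟩ ⟨-, hx⟩
  -- Near x, the function k takes only the value k x on B, so F coincides there with F(·, x), which
  -- is continuous. No local compactness is involved.
  have hk' : ∀ᶠ y in 𝓝[B] x, y ∈ B ∧ k y = k x := by
    have : (B ∩ k ⁻¹' {k x}ᶜ)ᶜ ∈ 𝓝 x := (h _).isOpen_compl.mem_nhds (by simp)
    filter_upwards [mem_nhdsWithin_of_mem_nhds this, self_mem_nhdsWithin] with y hy hyB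
    refine ⟨hyB, ?_⟩
    by_contra hne
    exact hy ⟨hyB, hne⟩
  refine (((hF x hx).comp continuous_fst).continuousAt.continuousWithinAt).congr_of_eventuallyEq
    ?_ rfl
  rw [nhdsWithin_prod_eq]
  filter_upwards [(tendsto_snd (f := 𝓝[univ] z) (g := 𝓝[B] x)).eventually hk'] with p hp
  exact hk p.1 p.2 hp.1 x hx hp.2

end LocConstOn

/-! ## Finite unions of closed convex sets -/

/-- The set is a finite union of closed convex sets. -/
def FinConvex {E : Type*} [TopologicalSpace E] [AddCommGroup E] [Module ℝ E] (B : Set E) : Prop :=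
  ∃ F : Set (Set E), F.Finite ∧ (∀ K ∈ F, IsClosed K ∧ Convex ℝ K) ∧ B = ⋃₀ F

namespace FinConvex

variable {E X : Type*} [TopologicalSpace E] [AddCommGroup E] [Module ℝ E] {B B' : Set E}

theorem of_convex (h : IsClosed B) (h' : Convex ℝ B) : FinConvex B :=
  ⟨{B}, finite_singleton B, by simp [h, h'], by simp⟩

theorem union (h : FinConvex B) (h' : FinConvex B') : FinConvex (B ∪ B') := by
  obtain ⟨F, hF, hK, rfl⟩ := h
  obtain ⟨F', hF', hK', rfl⟩ := h'
  exact ⟨F ∪ F', hF.union hF', fun K hK'' => hK''.elim (hK K) (hK' K), sUnion_union F F' |>.symm⟩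

theorem inter (h : FinConvex B) (h' : FinConvex B') : FinConvex (B ∩ B') := by
  obtain ⟨F, hF, hK, rfl⟩ := h
  obtain ⟨F', hF', hK', rfl⟩ := h'
  refine ⟨image2 (· ∩ ·) F F', hF.image2 _ hF', ?_, ?_⟩
  · rintro _ ⟨K, h₁, K', h₂, rfl⟩
    exact ⟨(hK K h₁).1.inter (hK' K' h₂).1, (hK K h₁).2.inter (hK' K' h₂).2⟩
  · ext x
    constructor
    · rintro ⟨⟨K, h₁, hx⟩, K', h₂, hx'⟩
      exact ⟨K ∩ K', ⟨K, h₁, K', h₂, rfl⟩, hx, hx'⟩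
    · rintro ⟨_, ⟨K, h₁, K', h₂, rfl⟩, hx, hx'⟩
      exact ⟨⟨K, h₁, hx⟩, K', h₂, hx'⟩

theorem isClosed (h : FinConvex B) : IsClosed B := by
  obtain ⟨F, hF, hK, rfl⟩ := h
  rw [sUnion_eq_biUnion]
  exact hF.isClosed_biUnion fun K h => (hK K h).1

/-- A function that is constant along the path-components is locally constant. -/
theorem locConstOn [ContinuousAdd E] [ContinuousSMul ℝ E] (h : FinConvex B) {k : E → X}
    (hk : ∀ x y, JoinedIn B x y → k x = k y) : LocConstOn k B := by
  intro A
  obtain ⟨F, hF, hK, rfl⟩ := h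
  -- Convex pieces are path-connected, so the preimage of A consists of whole pieces, and there are
  -- finitely many.
  have : ⋃₀ F ∩ k ⁻¹' A = ⋃₀ {K ∈ F | (K ∩ k ⁻¹' A).Nonempty} := by
    ext x
    constructor
    · rintro ⟨⟨K, h₁, hx⟩, hA⟩
      exact ⟨K, ⟨h₁, x, hx, hA⟩, hx⟩
    · rintro ⟨K, ⟨h₁, y, hy, hA⟩, hx⟩
      refine ⟨⟨K, h₁, hx⟩, ?_⟩
      have hj : JoinedIn (⋃₀ F) x y :=
        (JoinedIn.of_segment_subset ((hK K h₁).2.segment_subset hx hy)).mono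
          (subset_sUnion_of_mem h₁)
      simpa [hk x y hj] using hA
  rw [this, sUnion_eq_biUnion]
  exact (hF.subset (sep_subset _ _)).isClosed_biUnion fun K h => (hK K h.1).1

end FinConvex

/-! ## Projections onto convex sets and onto the sphere -/

/-- The radial retraction, with centre `w`, of the space to the closure of the open convex set
`O`. -/
noncomputable def radialRetract {E : Type*} [AddCommGroup E] [Module ℝ E] (O : Set E) (w z : E) :
    E :=
  w + (max 1 (gauge ((w + ·) ⁻¹' O) (z - w)))⁻¹ • (z - w)

section RadialRetract

variable {E : Type*} [NormedAddCommGroup E] [NormedSpace ℝ E] {O : Set E} {w : E}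

theorem continuous_radialRetract (hO : IsOpen O) (hc : Convex ℝ O) (hw : w ∈ O) :
    Continuous (radialRetract O w) := by
  have h₀ : (w + ·) ⁻¹' O ∈ 𝓝 (0 : E) :=
    (hO.preimage (continuous_const_add w)).mem_nhds (by simpa using hw)
  have hg := (continuous_gauge (hc.translate_preimage_right w) h₀).comp (continuous_sub_right w)
  unfold radialRetract
  refine continuous_const.add (Continuous.smul (Continuous.inv₀ (continuous_const.max hg) ?_)
    (continuous_sub_right w))
  intro z
  exact (lt_of_lt_of_le one_pos (le_max_left _ _)).ne'

theorem radialRetract_eq (hO : IsOpen O) (hc : Convex ℝ O) (hw : w ∈ O) {z : E}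
    (hz : z ∈ closure O) : radialRetract O w z = z := by
  have h₀ : (w + ·) ⁻¹' O ∈ 𝓝 (0 : E) :=
    (hO.preimage (continuous_const_add w)).mem_nhds (by simpa using hw)
  have h : gauge ((w + ·) ⁻¹' O) (z - w) ≤ 1 := by
    rw [gauge_le_one_iff_mem_closure (hc.translate_preimage_right w) h₀]
    have := (Homeomorph.addLeft w).preimage_closure O
    change z - w ∈ closure ((Homeomorph.addLeft w) ⁻¹' O)
    rw [← this]
    simpa using hz
  simp [radialRetract, max_eq_left h]

theorem one_le_gauge_translate (hO : IsOpen O) (hc : Convex ℝ O) (hw : w ∈ O) {z : E} (hz : z ∉ O) :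
    1 ≤ gauge ((w + ·) ⁻¹' O) (z - w) := by
  have h₀ : (w + ·) ⁻¹' O ∈ 𝓝 (0 : E) :=
    (hO.preimage (continuous_const_add w)).mem_nhds (by simpa using hw)
  by_contra h
  rw [not_le, gauge_lt_one_iff_mem_interior (hc.translate_preimage_right w) h₀,
    (hO.preimage (continuous_const_add w)).interior_eq] at h
  exact hz (by simpa using h)

theorem radialRetract_mem_closure (hO : IsOpen O) (hc : Convex ℝ O) (hw : w ∈ O) (z : E) :
    radialRetract O w z ∈ closure O := by
  have h₀ : (w + ·) ⁻¹' O ∈ 𝓝 (0 : E) :=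
    (hO.preimage (continuous_const_add w)).mem_nhds (by simpa using hw)
  have key : (max 1 (gauge ((w + ·) ⁻¹' O) (z - w)))⁻¹ • (z - w) ∈ closure ((w + ·) ⁻¹' O) := by
    rw [← gauge_le_one_iff_mem_closure (hc.translate_preimage_right w) h₀,
      gauge_smul_of_nonneg (by positivity), smul_eq_mul]
    exact (inv_mul_le_one₀ (by positivity)).2 (le_max_right _ _)
  have := (Homeomorph.addLeft w).preimage_closure O
  change _ ∈ closure ((Homeomorph.addLeft w) ⁻¹' O) at key
  rw [← this] at key
  exact key

/-- Outside `O` the gauge is at least 1, so the rescaling brings it to exactly 1: the image lies on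
the frontier. -/
theorem radialRetract_notMem (hO : IsOpen O) (hc : Convex ℝ O) (hw : w ∈ O) {z : E}
    (hz : z ∉ O) : radialRetract O w z ∉ O := by
  have h₀ : (w + ·) ⁻¹' O ∈ 𝓝 (0 : E) :=
    (hO.preimage (continuous_const_add w)).mem_nhds (by simpa using hw)
  have h := one_le_gauge_translate hO hc hw hz
  intro hmem
  have : gauge ((w + ·) ⁻¹' O) ((max 1 (gauge ((w + ·) ⁻¹' O) (z - w)))⁻¹ • (z - w)) < 1 := by
    rw [gauge_lt_one_iff_mem_interior (hc.translate_preimage_right w) h₀,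
      (hO.preimage (continuous_const_add w)).interior_eq]
    exact hmem
  rw [max_eq_right h, gauge_smul_of_nonneg (by positivity), smul_eq_mul,
    inv_mul_cancel₀ (by positivity)] at this
  exact this.false

theorem radialRetract_mem_segment (z : E) : radialRetract O w z ∈ segment ℝ w z := by
  rw [segment_eq_image']
  refine ⟨(max 1 (gauge ((w + ·) ⁻¹' O) (z - w)))⁻¹, ⟨by positivity, ?_⟩, rfl⟩
  exact inv_le_one_of_one_le₀ (le_max_left _ _)

end RadialRetract

/-- The radial projection of the unit disk to the unit sphere, with centre the point `w` of the
sphere. -/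
noncomputable def radialProj {E : Type*} [NormedAddCommGroup E] [InnerProductSpace ℝ E] (w z : E) :
    E :=
  w + (-2 * inner ℝ w (z - w) / ‖z - w‖ ^ 2) • (z - w)

section RadialProj

variable {E : Type*} [NormedAddCommGroup E] [InnerProductSpace ℝ E] {w z : E}

theorem continuousOn_radialProj (w : E) : ContinuousOn (radialProj w) {w}ᶜ := by
  unfold radialProj
  refine continuousOn_const.add (ContinuousOn.smul (ContinuousOn.div (by fun_prop) (by fun_prop) ?_)
    (by fun_prop))
  intro z hz
  have : z - w ≠ 0 := sub_ne_zero.2 hz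
  positivity

/-- Expansion of ‖w + (z − w)‖². With z − w scaled by t, the norm is again 1 for the nonzero root t
of 2t⟨w, z − w⟩ + t²‖z − w‖², which is the coefficient in `radialProj`. -/
theorem norm_sq_eq_of_centre (hw : ‖w‖ = 1) :
    ‖z‖ ^ 2 = 1 + 2 * inner ℝ w (z - w) + ‖z - w‖ ^ 2 := by
  have := norm_add_sq_real w (z - w)
  rw [add_sub_cancel, hw] at this
  linarith

theorem norm_radialProj (hw : ‖w‖ = 1) (hz : z ≠ w) : ‖radialProj w z‖ = 1 := by
  have h0 : ‖z - w‖ ^ 2 ≠ 0 := by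
    have : z - w ≠ 0 := sub_ne_zero.2 hz
    positivity
  have h : ‖radialProj w z‖ ^ 2 = 1 := by
    rw [norm_sq_eq_of_centre hw]
    simp only [radialProj, add_sub_cancel_left, inner_smul_right, norm_smul, mul_pow,
      Real.norm_eq_abs, sq_abs]
    field_simp
    ring
  exact (pow_eq_one_iff_of_nonneg (norm_nonneg _) two_ne_zero).1 h

theorem radialProj_eq (hw : ‖w‖ = 1) (hz : ‖z‖ = 1) (hne : z ≠ w) : radialProj w z = z := by
  have h0 : ‖z - w‖ ^ 2 ≠ 0 := by
    have : z - w ≠ 0 := sub_ne_zero.2 hne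
    positivity
  have h := norm_sq_eq_of_centre (z := z) hw
  rw [hz] at h
  have : -2 * inner ℝ w (z - w) / ‖z - w‖ ^ 2 = 1 := by
    rw [div_eq_one_iff_eq h0]
    linarith
  rw [radialProj, this, one_smul, add_sub_cancel]

/-- By the norm identity, ‖z‖ ≤ 1 makes the coefficient of `radialProj` at least 1, so its inverse
is a parameter on the segment. -/
theorem mem_segment_radialProj (hw : ‖w‖ = 1) (hz : ‖z‖ ≤ 1) (hne : z ≠ w) :
    z ∈ segment ℝ w (radialProj w z) := by
  have h0 : 0 < ‖z - w‖ ^ 2 := by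
    have : z - w ≠ 0 := sub_ne_zero.2 hne
    positivity
  have h := norm_sq_eq_of_centre (z := z) hw
  have h1 : 1 ≤ -2 * inner ℝ w (z - w) / ‖z - w‖ ^ 2 := by
    rw [one_le_div h0]
    nlinarith [norm_nonneg z]
  rw [segment_eq_image']
  refine ⟨(-2 * inner ℝ w (z - w) / ‖z - w‖ ^ 2)⁻¹, ⟨by positivity, inv_le_one_of_one_le₀ h1⟩, ?_⟩
  simp only [radialProj, add_sub_cancel_left]
  rw [inv_smul_smul₀ (by positivity), add_sub_cancel]

end RadialProj

theorem LocConstOn.preimage {E E' X : Type*} [TopologicalSpace E] [TopologicalSpace E']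
    {k : E → X} {B : Set E} (h : LocConstOn k B) {g : E' → E} (hg : Continuous g) :
    LocConstOn (k ∘ g) (g ⁻¹' B) := fun A => (h A).preimage hg

/-! ## Components of the complement of a timber -/

/-- The index is the equivalence with `Fin m`. The homotopy from the round trip to the identity
joins each point to the image of its index under the homotopy inverse, so points of equal index are
joined to each other. -/
theorem HasContractibleComplement.exists_index {n : ℕ} {U : Set (Euc n)}
    (h : HasContractibleComplement n U) (hc : IsClosed (unitSphere n \ U)) :
    ∃ κ : Euc n → ℕ, LocConstOn κ (unitSphere n \ U) ∧ ∀ x ∈ unitSphere n \ U,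
      ∀ y ∈ unitSphere n \ U, κ x = κ y → JoinedIn (unitSphere n \ U) x y := by
  classical
  obtain ⟨m, ⟨e⟩⟩ := h
  -- The value 0 off the complement is never used: both conclusions only concern points of the
  -- complement.
  refine ⟨fun x => if hx : x ∈ unitSphere n \ U then (e ⟨x, hx⟩ : Fin m).val else 0, ?_, ?_⟩
  · intro A
    have : unitSphere n \ U ∩ (fun x => if hx : x ∈ unitSphere n \ U then
        (e ⟨x, hx⟩ : Fin m).val else 0) ⁻¹' A =
        Subtype.val '' (e ⁻¹' (Fin.val ⁻¹' A)) := by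
      ext x
      constructor
      · rintro ⟨hx, hA⟩
        refine ⟨⟨x, hx⟩, ?_, rfl⟩
        simpa only [mem_preimage, dif_pos hx] using hA
      · rintro ⟨⟨x, hx⟩, hA, rfl⟩
        refine ⟨hx, ?_⟩
        simpa only [mem_preimage, dif_pos hx] using hA
    rw [this]
    exact hc.isClosedEmbedding_subtypeVal.isClosedMap _
      ((isClosed_discrete _).preimage e.continuous)
  · intro x hx y hy hxy
    simp only [dif_pos hx, dif_pos hy] at hxy
    have hxy' : e ⟨x, hx⟩ = e ⟨y, hy⟩ := Fin.val_injective hxy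
    rw [joinedIn_iff_joined hx hy]
    obtain ⟨H⟩ := e.left_inv
    have hj : ∀ z : ↥(unitSphere n \ U), Joined (e.invFun (e z)) z := fun z => ⟨H.evalAt z⟩
    exact (hj ⟨x, hx⟩).symm.trans (hxy' ▸ hj ⟨y, hy⟩)

/-- A connected set cannot change index, and points of equal index are joined by paths. Components
are therefore path-connected and closed. -/
theorem connectedComponentIn_eq_of_index {E : Type*} [TopologicalSpace E] {B : Set E} {κ : E → ℕ}
    (h : LocConstOn κ B) (hκ : ∀ x ∈ B, ∀ y ∈ B, κ x = κ y → JoinedIn B x y) {x : E} (hx : x ∈ B) :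
    connectedComponentIn B x = B ∩ κ ⁻¹' {κ x} := by
  ext y
  constructor
  · intro hy
    have hyB := connectedComponentIn_subset B x hy
    exact ⟨hyB, h.eq_of_isPreconnected isPreconnected_connectedComponentIn
      (connectedComponentIn_subset B x) hy (mem_connectedComponentIn hx)⟩
  · rintro ⟨hyB, hy⟩
    have hj := hκ x hx y hyB (Eq.symm hy)
    exact (isPathConnected_pathComponentIn hx).isConnected.isPreconnected.subset_connectedComponentIn
      (mem_pathComponentIn_self hx) pathComponentIn_subset hj

namespace HasContractibleComplement

variable {n : ℕ} {U : Set (Euc n)}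

theorem joinedIn (h : HasContractibleComplement n U) (hc : IsClosed (unitSphere n \ U))
    {x y : Euc n} (hx : x ∈ unitSphere n \ U)
    (hy : y ∈ connectedComponentIn (unitSphere n \ U) x) : JoinedIn (unitSphere n \ U) x y := by
  obtain ⟨κ, h₁, h₂⟩ := h.exists_index hc
  rw [connectedComponentIn_eq_of_index h₁ h₂ hx] at hy
  exact h₂ x hx y hy.1 (Eq.symm hy.2)

theorem locConstOn_component (h : HasContractibleComplement n U)
    (hc : IsClosed (unitSphere n \ U)) :
    LocConstOn (connectedComponentIn (unitSphere n \ U)) (unitSphere n \ U) := by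
  obtain ⟨κ, h₁, h₂⟩ := h.exists_index hc
  exact (h₁.postcomp fun a => (unitSphere n \ U) ∩ κ ⁻¹' {a}).congr
    fun x hx => connectedComponentIn_eq_of_index h₁ h₂ hx

end HasContractibleComplement

theorem one_lt_rank_euc {n : ℕ} (hn : 1 ≤ n) : 1 < Module.rank ℝ (Euc n) := by
  rw [← Module.finrank_eq_rank, finrank_euclideanSpace_fin]
  exact_mod_cast Nat.lt_succ_of_le hn

/-- The component is closed, and so is the union of the other components with the closure of `U`.
These two sets cover the sphere, which is connected for n ≥ 1, so they meet; they can only meet in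
the closure of `U`. -/
theorem HasContractibleComplement.exists_boundary {n : ℕ} (hn : 1 ≤ n) {U : Set (Euc n)}
    (h : HasContractibleComplement n U) (hc : IsClosed (unitSphere n \ U))
    (hU : (unitSphere n ∩ U).Nonempty) {x : Euc n} (hx : x ∈ unitSphere n \ U) :
    ∃ y, y ∈ connectedComponentIn (unitSphere n \ U) x ∩ closure U := by
  have hL := h.locConstOn_component hc
  have hK : IsClosed (connectedComponentIn (unitSphere n \ U) x) := by
    obtain ⟨κ, h₁, h₂⟩ := h.exists_index hc
    rw [connectedComponentIn_eq_of_index h₁ h₂ hx]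
    exact h₁ _
  have hK' := (hL {connectedComponentIn (unitSphere n \ U) x}ᶜ)
  have hS : IsPreconnected (unitSphere n) := isPreconnected_sphere (one_lt_rank_euc hn) 0 1
  suffices h : (unitSphere n ∩ (connectedComponentIn (unitSphere n \ U) x ∩
      (closure U ∪ ((unitSphere n \ U) ∩ connectedComponentIn (unitSphere n \ U) ⁻¹'
        {connectedComponentIn (unitSphere n \ U) x}ᶜ)))).Nonempty by
    obtain ⟨y, -, hy⟩ := h
    exact ⟨y, hy.1, hy.2.resolve_right fun hy' => hy'.2 (connectedComponentIn_eq hy.1).symm⟩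
  refine isPreconnected_closed_iff.1 hS _ _ hK (isClosed_closure.union hK') ?_ ?_ ?_
  · intro y hy
    by_cases hyU : y ∈ U
    · exact Or.inr (Or.inl (subset_closure hyU))
    by_cases hyC : connectedComponentIn (unitSphere n \ U) y =
        connectedComponentIn (unitSphere n \ U) x
    · exact Or.inl (hyC ▸ mem_connectedComponentIn ⟨hy, hyU⟩)
    · exact Or.inr (Or.inr ⟨⟨hy, hyU⟩, hyC⟩)
  · exact ⟨x, hx.1, mem_connectedComponentIn hx⟩
  · exact hU.mono fun y hy => ⟨hy.1, Or.inl (subset_closure hy.2)⟩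

/-! ### Moving complement components to the boundary -/

open Classical in
/-- The identity on `U`; on the complement of `U` in the sphere, it moves each component to one of
its boundary points. -/
noncomputable def pick {n : ℕ} (U : Set (Euc n)) (x : unitSphere n) : unitSphere n :=
  if x.1 ∈ U then x else @Classical.epsilon (unitSphere n) ⟨x⟩ fun y =>
    y.1 ∈ connectedComponentIn (unitSphere n \ U) x.1 ∩ closure U

theorem pick_of_mem {n : ℕ} {U : Set (Euc n)} {x : unitSphere n} (hx : x.1 ∈ U) :
    pick U x = x := if_pos hx

/-- The predicate under `epsilon` sees x only through its component, so one choice serves the whole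
component. -/
theorem pick_congr {n : ℕ} {U : Set (Euc n)} {x y : unitSphere n} (hx : x.1 ∉ U) (hy : y.1 ∉ U)
    (h : connectedComponentIn (unitSphere n \ U) x.1 = connectedComponentIn (unitSphere n \ U) y.1) :
    pick U x = pick U y := by
  simp only [pick, if_neg hx, if_neg hy, h]

/-! ## Families of open convex sets that carve the disk -/

/-- The part of the disk outside all members of the family. -/
def blueprintOf {n : ℕ} {I : Type} (O : I → Set (Euc n)) : Set (Euc n) := unitDisk n \ ⋃ i, O i

/-- The family consists of disjoint open convex sets that cut out timber with contractible
complement components, and its blueprint is a finite union of closed convex sets all of whose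
path-components meet the sphere. -/
structure IsCarving {n : ℕ} {I : Type} (O : I → Set (Euc n)) : Prop where
  isOpen : ∀ i, IsOpen (O i)
  convex : ∀ i, Convex ℝ (O i)
  disjoint : ∀ i j, i ≠ j → Disjoint (O i) (O j)
  nonempty : ∀ i, (unitSphere n ∩ O i).Nonempty
  contractible : ∀ i, HasContractibleComplement n (unitSphere n ∩ O i)
  finConvex : FinConvex (blueprintOf O)
  exists_sphere : ∀ x ∈ blueprintOf O, ∃ y ∈ unitSphere n, JoinedIn (blueprintOf O) x y

/-- The map is constant along the path-components of `β`. -/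
def IsConstantAlong {n : ℕ} {M : Type*} [TopologicalSpace M] (β : Set (Euc n))
    (f : C(unitSphere n, M)) : Prop :=
  ∀ x y : unitSphere n, JoinedIn β x y → f x = f y

theorem mem_blueprintOf {n : ℕ} {I : Type} {O : I → Set (Euc n)} {x : Euc n} :
    x ∈ blueprintOf O ↔ x ∈ unitDisk n ∧ ∀ i, x ∉ O i := by
  simp [blueprintOf]

theorem sphere_subset_disk (n : ℕ) : unitSphere n ⊆ unitDisk n := Metric.sphere_subset_closedBall

namespace IsCarving

variable {n : ℕ} {I : Type} {O : I → Set (Euc n)}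

/-- A point of the `i`-th timber. -/
noncomputable def centre (C : IsCarving O) (i : I) : Euc n := (C.nonempty i).some

theorem centre_mem (C : IsCarving O) (i : I) : C.centre i ∈ O i := (C.nonempty i).some_mem.2

theorem norm_centre (C : IsCarving O) (i : I) : ‖C.centre i‖ = 1 :=
  mem_sphere_zero_iff_norm.1 (C.nonempty i).some_mem.1

theorem isClosed_compl (C : IsCarving O) (i : I) :
    IsClosed (unitSphere n \ (unitSphere n ∩ O i)) := by
  rw [sdiff_self_inter]
  exact Metric.isClosed_sphere.sdiff (C.isOpen i)

/-- The other members are open and disjoint from `O i`, hence also from its closure. -/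
theorem mem_of_closure (C : IsCarving O) {i : I} {z : Euc n} (hz : z ∈ unitDisk n)
    (h : z ∈ closure (O i)) (h' : z ∉ O i) : z ∈ blueprintOf O := by
  refine mem_blueprintOf.2 ⟨hz, fun j hj => ?_⟩
  rcases eq_or_ne i j with rfl | hij
  · exact h' hj
  · exact ((C.disjoint i j hij).closure_left (C.isOpen j)).le_bot ⟨h, hj⟩

/-- The radial retraction of the disk to the closure of the `i`-th member. -/
noncomputable def retract (C : IsCarving O) (i : I) : Euc n → Euc n :=
  radialRetract (O i) (C.centre i)

theorem continuous_retract (C : IsCarving O) (i : I) : Continuous (C.retract i) :=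
  continuous_radialRetract (C.isOpen i) (C.convex i) (C.centre_mem i)

theorem retract_eq (C : IsCarving O) {i : I} {z : Euc n} (hz : z ∈ closure (O i)) :
    C.retract i z = z :=
  radialRetract_eq (C.isOpen i) (C.convex i) (C.centre_mem i) hz

theorem centre_mem_disk (C : IsCarving O) (i : I) : C.centre i ∈ unitDisk n := by
  simp [C.norm_centre i]

theorem retract_mem_disk (C : IsCarving O) {i : I} {z : Euc n} (hz : z ∈ unitDisk n) :
    C.retract i z ∈ unitDisk n :=
  (convex_closedBall 0 1).segment_subset (C.centre_mem_disk i) hz (radialRetract_mem_segment z)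

theorem retract_mem_closure (C : IsCarving O) (i : I) (z : Euc n) :
    C.retract i z ∈ closure (O i) :=
  radialRetract_mem_closure (C.isOpen i) (C.convex i) (C.centre_mem i) z

theorem retract_mem (C : IsCarving O) {i : I} {z : Euc n} (hz : z ∈ unitDisk n) (h : z ∉ O i) :
    C.retract i z ∈ blueprintOf O :=
  C.mem_of_closure (C.retract_mem_disk hz) (C.retract_mem_closure i z)
    (radialRetract_notMem (C.isOpen i) (C.convex i) (C.centre_mem i) h)

theorem pick_spec (C : IsCarving O) (hn : 1 ≤ n) {i : I} {x : unitSphere n} (hx : x.1 ∉ O i) :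
    (pick (unitSphere n ∩ O i) x).1 ∈
      connectedComponentIn (unitSphere n \ (unitSphere n ∩ O i)) x.1 ∩
        closure (unitSphere n ∩ O i) := by
  have hx' : x.1 ∉ unitSphere n ∩ O i := fun h => hx h.2
  rw [pick, if_neg hx']
  obtain ⟨y, hy⟩ := (C.contractible i).exists_boundary hn (C.isClosed_compl i)
    (by rw [← inter_assoc, inter_self]; exact C.nonempty i) ⟨x.2, hx'⟩
  exact Classical.epsilon_spec (p := fun y : unitSphere n => y.1 ∈
    connectedComponentIn (unitSphere n \ (unitSphere n ∩ O i)) x.1 ∩ closure (unitSphere n ∩ O i))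
    ⟨⟨y, (connectedComponentIn_subset _ _ hy.1).1⟩, hy⟩

/-- A path outside the `i`-th timber may run through other members. The retraction moves it to the
frontier of `O i`, which no member meets, and keeps it in the disk. -/
theorem joinedIn_retract (C : IsCarving O) {i : I} {x y : Euc n}
    (h : JoinedIn (unitSphere n \ (unitSphere n ∩ O i)) x y) :
    JoinedIn (blueprintOf O) (C.retract i x) (C.retract i y) :=
  (h.map (C.continuous_retract i)).mono (by
    rintro _ ⟨z, hz, rfl⟩
    exact C.retract_mem (sphere_subset_disk n hz.1) fun h => hz.2 ⟨hz.1, h⟩)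

/-- The retraction fixes boundary points, so all boundary points of the component of x are joined in
the blueprint to the retraction of x. This makes the map c to the path-components well defined. -/
theorem joinedIn_boundary (C : IsCarving O) {i : I} {x y : Euc n}
    (hx : x ∈ unitSphere n) (hx' : x ∉ O i)
    (hy : y ∈ connectedComponentIn (unitSphere n \ (unitSphere n ∩ O i)) x ∩
      closure (unitSphere n ∩ O i)) :
    JoinedIn (blueprintOf O) (C.retract i x) y := by
  have h := C.joinedIn_retract
    ((C.contractible i).joinedIn (C.isClosed_compl i) ⟨hx, fun h => hx' h.2⟩ hy.1)
  rwa [C.retract_eq (closure_mono inter_subset_right hy.2)] at h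

theorem joinedIn_pick (C : IsCarving O) (hn : 1 ≤ n) {i : I} {x : unitSphere n} (hx : x.1 ∉ O i) :
    JoinedIn (blueprintOf O) (C.retract i x) (pick (unitSphere n ∩ O i) x).1 :=
  C.joinedIn_boundary x.2 hx (C.pick_spec hn hx)

/-- A frontier point of the timber is fixed by the retraction, so it is joined in the blueprint to
the boundary point chosen for its component. -/
theorem pick_eq_of_constant (C : IsCarving O) (hn : 1 ≤ n) {i : I} {M : Type*} [TopologicalSpace M]
    {f : C(unitSphere n, M)} (hf : IsConstantAlong (blueprintOf O) f) {x : unitSphere n}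
    (hx : x.1 ∈ closure (unitSphere n ∩ O i)) : f (pick (unitSphere n ∩ O i) x) = f x := by
  by_cases h : x.1 ∈ O i
  · rw [pick_of_mem (U := unitSphere n ∩ O i) ⟨x.2, h⟩]
  · have := C.joinedIn_pick hn h
    rw [C.retract_eq (closure_mono inter_subset_right hx)] at this
    exact (hf x _ this).symm

theorem locConstOn_pick (C : IsCarving O) (i : I) :
    LocConstOn (pick (unitSphere n ∩ O i))
      (Subtype.val ⁻¹' (unitSphere n \ (unitSphere n ∩ O i)) : Set (unitSphere n)) := by
  classical
  have h := ((C.contractible i).locConstOn_component (C.isClosed_compl i)).preimage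
    (continuous_subtype_val : Continuous (Subtype.val : unitSphere n → Euc n))
  intro A
  -- On the complement `pick` factors through the component, so the preimage of A is the preimage of
  -- a set of components.
  have e : ∀ x : unitSphere n, x.1 ∈ unitSphere n \ (unitSphere n ∩ O i) →
      (x ∈ pick (unitSphere n ∩ O i) ⁻¹' A ↔
        x ∈ (connectedComponentIn (unitSphere n \ (unitSphere n ∩ O i)) ∘ Subtype.val) ⁻¹'
          {K | ∃ y : unitSphere n, y.1 ∈ unitSphere n \ (unitSphere n ∩ O i) ∧
            connectedComponentIn (unitSphere n \ (unitSphere n ∩ O i)) y.1 = K ∧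
            pick (unitSphere n ∩ O i) y ∈ A}) := by
    intro x hx
    refine ⟨fun h => ⟨x, hx, rfl, h⟩, ?_⟩
    rintro ⟨y, hy, hyx, hA⟩
    rw [mem_preimage, pick_congr hx.2 hy.2 hyx.symm]
    exact hA
  convert h {K | ∃ y : unitSphere n, y.1 ∈ unitSphere n \ (unitSphere n ∩ O i) ∧
    connectedComponentIn (unitSphere n \ (unitSphere n ∩ O i)) y.1 = K ∧
    pick (unitSphere n ∩ O i) y ∈ A} using 1
  ext x
  exact and_congr_right fun hx => e x hx

/-- The closure of the timber and its complement are closed and cover the sphere. On the first the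
map is evaluation of `F`; on the second it is locally constant in the sphere variable. Joint
continuity gives a continuous left leg by currying. -/
theorem continuous_uncurry_pick (C : IsCarving O) (hn : 1 ≤ n) {Z M : Type*} [TopologicalSpace Z]
    [TopologicalSpace M] (F : C(Z, C(unitSphere n, M)))
    (hF : ∀ z, IsConstantAlong (blueprintOf O) (F z)) (i : I) :
    Continuous fun p : Z × unitSphere n => F p.1 (pick (unitSphere n ∩ O i) p.2) := by
  have h₁ : ContinuousOn (fun p : Z × unitSphere n => F p.1 (pick (unitSphere n ∩ O i) p.2))
      (univ ×ˢ (Subtype.val ⁻¹' closure (unitSphere n ∩ O i))) := by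
    refine ContinuousOn.congr (f := fun p : Z × unitSphere n => F p.1 p.2)
      (Continuous.continuousOn (by fun_prop)) ?_
    rintro ⟨z, x⟩ ⟨-, hx⟩
    exact C.pick_eq_of_constant hn (hF z) hx
  have h₂ : ContinuousOn (fun p : Z × unitSphere n => F p.1 (pick (unitSphere n ∩ O i) p.2))
      (univ ×ˢ (Subtype.val ⁻¹' (unitSphere n \ (unitSphere n ∩ O i)))) :=
    (C.locConstOn_pick i).continuousOn_prod (fun x _ => by dsimp only; fun_prop)
      fun z x _ y _ h => congrArg (F z) h
  rw [← continuousOn_univ]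
  refine (h₁.union_of_isClosed h₂ ?_ ?_).mono ?_
  · exact isClosed_univ.prod (isClosed_closure.preimage continuous_subtype_val)
  · exact isClosed_univ.prod ((C.isClosed_compl i).preimage continuous_subtype_val)
  · rintro ⟨z, x⟩ -
    by_cases h : x.1 ∈ unitSphere n ∩ O i
    · exact Or.inl ⟨mem_univ _, subset_closure h⟩
    · exact Or.inr ⟨mem_univ _, x.2, h⟩

end IsCarving

instance nonempty_unitSphere (n : ℕ) : Nonempty (unitSphere n) :=
  ⟨⟨EuclideanSpace.single 0 1, by simp⟩⟩

/-- A point of the sphere in the path-component of `z` in `β`. -/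
noncomputable def sphereRep {n : ℕ} (β : Set (Euc n)) (z : Euc n) : unitSphere n :=
  Classical.epsilon fun y => JoinedIn β z y

theorem pick_mem_closure {n : ℕ} (hn : 1 ≤ n) {I : Type} {O : I → Set (Euc n)} (C : IsCarving O)
    (i : I) (x : unitSphere n) :
    (pick (unitSphere n ∩ O i) x).1 ∈ closure (unitSphere n ∩ O i) := by
  by_cases h : x.1 ∈ O i
  · rw [pick_of_mem (U := unitSphere n ∩ O i) ⟨x.2, h⟩]
    exact subset_closure ⟨x.2, h⟩
  · exact (C.pick_spec hn h).2

/-! ### Representatives on the sphere and projection from a point of the timber -/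

namespace IsCarving

variable {n : ℕ} {I : Type} {O : I → Set (Euc n)}

theorem joinedIn_sphereRep (C : IsCarving O) {z : Euc n} (hz : z ∈ blueprintOf O) :
    JoinedIn (blueprintOf O) z (sphereRep (blueprintOf O) z) := by
  obtain ⟨y, hy, h⟩ := C.exists_sphere z hz
  exact Classical.epsilon_spec (p := fun y : unitSphere n => JoinedIn (blueprintOf O) z y)
    ⟨⟨y, hy⟩, h⟩

/-- This extends f from the trace of the blueprint to all of it: constancy of f along
path-components makes the chosen representative irrelevant. -/
theorem locConstOn_sphereRep (C : IsCarving O) {M : Type*} [TopologicalSpace M]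
    {f : C(unitSphere n, M)} (hf : IsConstantAlong (blueprintOf O) f) :
    LocConstOn (fun z => f (sphereRep (blueprintOf O) z)) (blueprintOf O) :=
  C.finConvex.locConstOn fun _ _ h => hf _ _
    ((C.joinedIn_sphereRep h.source_mem).symm.trans
      (h.trans (C.joinedIn_sphereRep h.target_mem)))

theorem ne_centre (C : IsCarving O) {i : I} {z : Euc n} (h : z ∉ O i) : z ≠ C.centre i :=
  fun e => h (e ▸ C.centre_mem i)

theorem radialProj_notMem (C : IsCarving O) {i : I} {z : Euc n} (hz : z ∈ unitDisk n)
    (h : z ∉ O i) : radialProj (C.centre i) z ∉ O i := fun h' =>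
  h ((C.convex i).segment_subset (C.centre_mem i) h' (mem_segment_radialProj (C.norm_centre i)
    (mem_closedBall_zero_iff.1 hz) (C.ne_centre h)))

/-- The centre, z, u and the projection lie on a line in this order. If u were in the convex set `O
i`, so would be z, which lies between the centre and u. -/
theorem segment_radialProj (C : IsCarving O) {i : I} {z : Euc n} (hz : z ∈ unitDisk n)
    (h : z ∉ O i) : segment ℝ z (radialProj (C.centre i) z) ⊆ unitDisk n \ O i := by
  intro u hu
  refine ⟨(convex_closedBall 0 1).segment_subset hz (sphere_subset_disk n
    (mem_sphere_zero_iff_norm.2 (norm_radialProj (C.norm_centre i) (C.ne_centre h)))) hu,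
    fun hu' => h ((C.convex i).segment_subset (C.centre_mem i) hu' ?_)⟩
  have h₁ := mem_segment_iff_wbtw.1 (mem_segment_radialProj (C.norm_centre i)
    (mem_closedBall_zero_iff.1 hz) (C.ne_centre h))
  exact mem_segment_iff_wbtw.2 (h₁.trans_right_left (mem_segment_iff_wbtw.1 hu))

open Classical in
/-- The radial projection from the point of the `i`-th timber to the sphere. -/
noncomputable def proj (C : IsCarving O) (i : I) (z : Euc n) : unitSphere n :=
  if h : z ∈ O i then ⟨C.centre i, by simp [C.norm_centre i]⟩ else
    ⟨radialProj (C.centre i) z,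
      mem_sphere_zero_iff_norm.2 (norm_radialProj (C.norm_centre i) (C.ne_centre h))⟩

theorem proj_val (C : IsCarving O) {i : I} {z : Euc n} (h : z ∉ O i) :
    (C.proj i z).1 = radialProj (C.centre i) z := by
  rw [proj, dif_neg h]

theorem proj_eq (C : IsCarving O) {i : I} {x : unitSphere n} (h : x.1 ∉ O i) :
    C.proj i x.1 = x :=
  Subtype.ext ((C.proj_val h).trans
    (radialProj_eq (C.norm_centre i) (mem_sphere_zero_iff_norm.1 x.2) (C.ne_centre h)))

theorem continuousOn_proj (C : IsCarving O) (i : I) : ContinuousOn (C.proj i) (O i)ᶜ := by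
  rw [IsInducing.subtypeVal.continuousOn_iff]
  exact ((continuousOn_radialProj (C.centre i)).mono fun z hz => C.ne_centre hz).congr
    fun z hz => C.proj_val hz

theorem proj_notMem (C : IsCarving O) {i : I} {z : Euc n} (hz : z ∈ unitDisk n)
    (h : z ∉ O i) : (C.proj i z).1 ∉ O i := by
  rw [C.proj_val h]
  exact C.radialProj_notMem hz h

theorem joinedIn_proj (C : IsCarving O) {i : I} {z : Euc n} (hz : z ∈ unitDisk n)
    (h : z ∉ O i) : JoinedIn (unitDisk n \ O i) z (C.proj i z) := by
  rw [C.proj_val h]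
  exact JoinedIn.of_segment_subset (C.segment_radialProj hz h)

/-! ### The relation on the sphere depends on the timber only -/

theorem mem_blueprintOf_of_timber_eq {O' : I → Set (Euc n)}
    (h : ∀ i, unitSphere n ∩ O i = unitSphere n ∩ O' i) {x : Euc n} (hx : x ∈ unitSphere n)
    (hxO : x ∈ blueprintOf O) : x ∈ blueprintOf O' := by
  rw [mem_blueprintOf] at hxO ⊢
  refine ⟨hxO.1, fun i hi => hxO.2 i ?_⟩
  have : x ∈ unitSphere n ∩ O' i := ⟨hx, hi⟩
  rw [← h i] at this
  exact this.2

/-- A locally constant function on the intersection of the sphere and the blueprint which is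
constant on the boundaries of the complement components of the timber extends to the blueprint. -/
theorem eq_of_joinedIn_of_boundary [Finite I] (hn : 1 ≤ n) (C : IsCarving O) {g : Euc n → ℤ}
    (hg : LocConstOn g (unitSphere n ∩ blueprintOf O))
    (hb : ∀ i, ∀ x : unitSphere n, x.1 ∈ closure (unitSphere n ∩ O i) → x.1 ∉ O i →
      g (pick (unitSphere n ∩ O i) x) = g x)
    {x y : Euc n} (hx : x ∈ unitSphere n) (hy : y ∈ unitSphere n)
    (hxy : JoinedIn (blueprintOf O) x y) : g x = g y := by
  classical
  have := Fintype.ofFinite I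
  -- `G i` carries the boundary values of g on the complement components of timber i inwards along
  -- rays from the centre. Integers allow subtraction, and in them continuity is local constancy.
  set G : I → Euc n → ℤ := fun i z => g (pick (unitSphere n ∩ O i) (C.proj i z)) with hG
  have hGc : ∀ i, ContinuousOn (G i) (unitDisk n \ O i) := by
    intro i
    refine ((C.locConstOn_pick i).postcomp fun z => g z.1).continuousOn.comp
      ((C.continuousOn_proj i).mono fun z hz => hz.2) ?_
    intro z hz
    exact ⟨(C.proj i z).2, fun h => C.proj_notMem hz.1 hz.2 h.2⟩
  -- On entering `O i` the terms g and `G i` are both dropped. By `hb` they agree on the boundary of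
  -- the timber, so h has no jump there.
  set h : Euc n → ℤ := fun z =>
    (if z ∈ blueprintOf O then g z else 0) - ∑ i, if z ∈ O i then 0 else G i z with hh
  have hβ : ∀ z ∈ blueprintOf O, h z = g z - ∑ i, G i z := by
    intro z hz
    have hz' := (mem_blueprintOf.1 hz).2
    simp [hh, hz, hz']
  have hsum : ContinuousOn (fun z => ∑ i, G i z) (blueprintOf O) :=
    continuousOn_finsetSum _ fun i _ => (hGc i).mono fun z hz =>
      ⟨(mem_blueprintOf.1 hz).1, (mem_blueprintOf.1 hz).2 i⟩
  have h₁ : LocConstOn h (unitSphere n ∩ blueprintOf O) :=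
    (LocConstOn.of_continuousOn (k := fun z => g z - ∑ i, G i z) hg.isClosed
      (hg.continuousOn.sub (hsum.mono inter_subset_right))).congr fun z hz => hβ z hz.2
  have h₂ : ∀ i, LocConstOn h (closure (unitSphere n ∩ O i)) := by
    intro i
    -- For j ≠ i, the function `G j` is constant on the convex set where the disk meets the closure
    -- of `O i`. This yields the constant, evaluated at the centre.
    refine LocConstOn.const isClosed_closure
      (-∑ j ∈ Finset.univ.erase i, G j (C.centre i)) fun z hz => ?_
    have hzS : z ∈ unitSphere n :=
      Metric.isClosed_sphere.closure_subset_iff.2 inter_subset_left hz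
    have hzO : z ∈ closure (O i) := closure_mono inter_subset_right hz
    have hT : IsPreconnected (unitDisk n ∩ closure (O i)) :=
      ((convex_closedBall 0 1).inter (C.convex i).closure).isPreconnected
    have hdis : ∀ j, j ≠ i → unitDisk n ∩ closure (O i) ⊆ unitDisk n \ O j := fun j hj u hu =>
      ⟨hu.1, fun h => ((C.disjoint i j hj.symm).closure_left (C.isOpen j)).le_bot ⟨hu.2, h⟩⟩
    have hGz : ∀ j, j ≠ i → G j z = G j (C.centre i) := fun j hj =>
      hT.constant ((hGc j).mono (hdis j hj)) ⟨sphere_subset_disk n hzS, hzO⟩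
        ⟨C.centre_mem_disk i, subset_closure (C.centre_mem i)⟩
    have hnot : ∀ j, j ≠ i → z ∉ O j := fun j hj =>
      (hdis j hj ⟨sphere_subset_disk n hzS, hzO⟩).2
    have hsum' : ∑ j ∈ Finset.univ.erase i, (if z ∈ O j then 0 else G j z) =
        ∑ j ∈ Finset.univ.erase i, G j (C.centre i) := by
      refine Finset.sum_congr rfl fun j hj => ?_
      rw [if_neg (hnot j (Finset.ne_of_mem_erase hj)), hGz j (Finset.ne_of_mem_erase hj)]
    simp only [hh]
    rw [← Finset.add_sum_erase _ _ (Finset.mem_univ i), hsum']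
    by_cases hzi : z ∈ O i
    · have : z ∉ blueprintOf O := fun h => (mem_blueprintOf.1 h).2 i hzi
      simp [hzi, this]
    · have hzβ := C.mem_of_closure (sphere_subset_disk n hzS) hzO hzi
      have : G i z = g z := by
        have e := C.proj_eq (x := ⟨z, hzS⟩) hzi
        simp only [hG]
        simp only at e
        rw [e]
        exact hb i ⟨z, hzS⟩ hz hzi
      simp [hzi, hzβ, this]
  have hS : IsPreconnected (unitSphere n) := isPreconnected_sphere (one_lt_rank_euc hn) 0 1
  have hcover : unitSphere n ⊆
      (unitSphere n ∩ blueprintOf O) ∪ ⋃ i, closure (unitSphere n ∩ O i) := by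
    intro z hz
    by_cases hz' : z ∈ blueprintOf O
    · exact Or.inl ⟨hz, hz'⟩
    · rw [mem_blueprintOf] at hz'
      push Not at hz'
      obtain ⟨i, hi⟩ := hz' (sphere_subset_disk n hz)
      exact Or.inr (mem_iUnion.2 ⟨i, subset_closure ⟨hz, hi⟩⟩)
  -- h is constant on the connected sphere, and ∑ G i is constant along the path in the blueprint;
  -- hence so is g at its ends.
  have e₁ := (h₁.union (LocConstOn.iUnion h₂)).eq_of_isPreconnected hS hcover hx hy
  have e₂ : ∑ i, G i x = ∑ i, G i y :=
    (LocConstOn.of_continuousOn C.finConvex.isClosed hsum).eq_of_joinedIn hxy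
  rw [hβ x hxy.source_mem, hβ y hxy.target_mem, e₂] at e₁
  exact sub_left_inj.1 e₁

/-- The test function g is the indicator of the path-component of x in the blueprint of `O'`. The
boundary condition holds because in that blueprint, too, the boundary of a complement component lies
in one path-component. -/
theorem joinedIn_of_timber_eq [Finite I] (hn : 1 ≤ n) (C : IsCarving O) {O' : I → Set (Euc n)}
    (C' : IsCarving O') (h : ∀ i, unitSphere n ∩ O i = unitSphere n ∩ O' i) {x y : Euc n}
    (hx : x ∈ unitSphere n) (hy : y ∈ unitSphere n) (hxy : JoinedIn (blueprintOf O) x y) :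
    JoinedIn (blueprintOf O') x y := by
  classical
  have hx' := mem_blueprintOf_of_timber_eq h hx hxy.source_mem
  set g : Euc n → ℤ := fun z => if JoinedIn (blueprintOf O') x z then 1 else 0 with hg
  have hgj : ∀ a b, JoinedIn (blueprintOf O') a b → g a = g b := by
    intro a b hab
    have : JoinedIn (blueprintOf O') x a ↔ JoinedIn (blueprintOf O') x b :=
      ⟨fun h => h.trans hab, fun h => h.trans hab.symm⟩
    simp [hg, this]
  have hset : unitSphere n ∩ blueprintOf O ⊆ blueprintOf O' := fun z hz =>
    mem_blueprintOf_of_timber_eq h hz.1 hz.2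
  have key : g x = g y := by
    refine C.eq_of_joinedIn_of_boundary hn ((C'.finConvex.locConstOn hgj).mono hset
      (Metric.isClosed_sphere.inter C.finConvex.isClosed)) ?_ hx hy hxy
    intro i z hz hzi
    have hzi' : z.1 ∉ O' i := fun hz' => by
      have : z.1 ∈ unitSphere n ∩ O' i := ⟨z.2, hz'⟩
      rw [← h i] at this
      exact hzi this.2
    rw [h i] at hz ⊢
    have := C'.joinedIn_pick hn hzi'
    rw [C'.retract_eq (closure_mono inter_subset_right hz)] at this
    exact (hgj _ _ this).symm
  by_contra hne
  simp [hg, hne, JoinedIn.refl hx'] at key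

theorem isConstantAlong_iff [Finite I] (hn : 1 ≤ n) (C : IsCarving O) {O' : I → Set (Euc n)}
    (C' : IsCarving O') (h : ∀ i, unitSphere n ∩ O i = unitSphere n ∩ O' i) {M : Type*}
    [TopologicalSpace M] (f : C(unitSphere n, M)) :
    IsConstantAlong (blueprintOf O) f ↔ IsConstantAlong (blueprintOf O') f :=
  ⟨fun hf x y hxy => hf x y (C'.joinedIn_of_timber_eq hn C (fun i => (h i).symm) x.2 y.2 hxy),
    fun hf x y hxy => hf x y (C.joinedIn_of_timber_eq hn C' h x.2 y.2 hxy)⟩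

/-! ### Composition -/

section Composition

variable {J : Type} {Q : J → Set (Euc n)} {i : I} {M : Type*} [TopologicalSpace M]
  {f g : C(unitSphere n, M)}

/-- The family in which the `i`-th member is replaced by another family. -/
def _root_.insertFamily (O : I → Set (Euc n)) (i : I) (Q : J → Set (Euc n)) :
    {x : I // x ≠ i} ⊕ J → Set (Euc n) :=
  Sum.elim (fun x => O x.1) Q

theorem blueprintOf_subset_insert (hQ : ∀ j, Q j ⊆ O i) :
    blueprintOf O ⊆ blueprintOf (insertFamily O i Q) := by
  intro z hz
  rw [mem_blueprintOf] at hz ⊢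
  refine ⟨hz.1, ?_⟩
  rintro (x | j)
  · exact hz.2 x.1
  · exact fun h => hz.2 i (hQ j h)

theorem sdiff_subset_blueprintOf (hQ : ∀ j, Q j ⊆ O i) : unitDisk n \ O i ⊆ blueprintOf Q :=
  fun _ hz => mem_blueprintOf.2 ⟨hz.1, fun j h => hz.2 (hQ j h)⟩

theorem inter_closure_subset_insert (C : IsCarving O) :
    blueprintOf Q ∩ closure (O i) ⊆ blueprintOf (insertFamily O i Q) := by
  rintro z ⟨hz, hzi⟩
  rw [mem_blueprintOf] at hz ⊢
  refine ⟨hz.1, ?_⟩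
  rintro (x | j)
  · exact fun h => ((C.disjoint i x.1 x.2.symm).closure_left (C.isOpen x.1)).le_bot ⟨hzi, h⟩
  · exact hz.2 j

/-- Used to define a function on the composite blueprint piecewise, over two sets that are closed
for carvings. -/
theorem insert_subset_union :
    blueprintOf (insertFamily O i Q) ⊆ blueprintOf O ∪ (blueprintOf Q ∩ closure (O i)) := by
  intro z hz
  rw [mem_blueprintOf] at hz
  by_cases h : z ∈ O i
  · exact Or.inr ⟨mem_blueprintOf.2 ⟨hz.1, fun j => hz.2 (Sum.inr j)⟩, subset_closure h⟩
  · refine Or.inl (mem_blueprintOf.2 ⟨hz.1, fun x => ?_⟩)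
    rcases eq_or_ne x i with rfl | hx
    · exact h
    · exact hz.2 (Sum.inl ⟨x, hx⟩)

theorem isConstantAlong_of_insert (hQ : ∀ j, Q j ⊆ O i)
    (hf : IsConstantAlong (blueprintOf (insertFamily O i Q)) f) :
    IsConstantAlong (blueprintOf O) f :=
  fun x y hxy => hf x y (hxy.mono (blueprintOf_subset_insert hQ))

/-- The retraction to the closure of `O i` carries the blueprint of Q into the composite one: it
fixes points of `O i`, and points outside go to the blueprint of O. It thus transports a path
joining x and y, and at the ends it stays joined to the points given by `pick`. -/
theorem isConstantAlong_extend_of_insert (hn : 1 ≤ n) (C : IsCarving O) (hQ : ∀ j, Q j ⊆ O i)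
    (hf : IsConstantAlong (blueprintOf (insertFamily O i Q)) f)
    (hg : ∀ x, g x = f (pick (unitSphere n ∩ O i) x)) : IsConstantAlong (blueprintOf Q) g := by
  have key : ∀ x : unitSphere n, x.1 ∈ blueprintOf Q →
      JoinedIn (blueprintOf (insertFamily O i Q)) (C.retract i x)
        (pick (unitSphere n ∩ O i) x).1 := by
    intro x hx
    by_cases h : x.1 ∈ O i
    · rw [pick_of_mem (U := unitSphere n ∩ O i) ⟨x.2, h⟩, C.retract_eq (subset_closure h)]
      exact JoinedIn.refl (inter_closure_subset_insert C ⟨hx, subset_closure h⟩)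
    · exact (C.joinedIn_pick hn h).mono (blueprintOf_subset_insert hQ)
  intro x y hxy
  rw [hg, hg]
  refine hf _ _ ((key x hxy.source_mem).symm.trans (JoinedIn.trans ?_ (key y hxy.target_mem)))
  refine (hxy.map (C.continuous_retract i)).mono ?_
  rintro _ ⟨z, hz, rfl⟩
  by_cases h : z ∈ O i
  · rw [C.retract_eq (subset_closure h)]
    exact inter_closure_subset_insert C ⟨hz, subset_closure h⟩
  · exact blueprintOf_subset_insert hQ (C.retract_mem (mem_blueprintOf.1 hz).1 h)

/-- The values of f on the trace of the composite blueprint extend to a function that is locally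
constant along it. It comes from f on the blueprint of O and from g on the rest, and the only issue
is agreement on the overlap. -/
theorem isConstantAlong_insert (hn : 1 ≤ n) (C : IsCarving O) (CQ : IsCarving Q)
    (hQ : ∀ j, Q j ⊆ O i) (hf : IsConstantAlong (blueprintOf O) f)
    (hg : ∀ x, g x = f (pick (unitSphere n ∩ O i) x)) (hgQ : IsConstantAlong (blueprintOf Q) g) :
    IsConstantAlong (blueprintOf (insertFamily O i Q)) f := by
  classical
  set k : Euc n → M := fun z => if z ∈ blueprintOf O then f (sphereRep (blueprintOf O) z) else
    g (sphereRep (blueprintOf Q) z) with hk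
  have h₁ : LocConstOn k (blueprintOf O) :=
    (C.locConstOn_sphereRep hf).congr fun z hz => by simp [hk, hz]
  have h₂ : LocConstOn k (blueprintOf Q ∩ closure (O i)) := by
    refine ((CQ.locConstOn_sphereRep hgQ).mono inter_subset_left
      (CQ.finConvex.isClosed.inter isClosed_closure)).congr fun z hz => ?_
    by_cases hzO : z ∈ blueprintOf O
    · simp only [hk, if_pos hzO]
      -- Project z radially to the sphere. The path outside `O i` lies in the blueprint of Q and
      -- identifies the value of g; its retraction lies in the blueprint of O and identifies the
      -- value of f at the chosen boundary point.
      have hzD := (mem_blueprintOf.1 hzO).1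
      have hzi := (mem_blueprintOf.1 hzO).2 i
      have hp := C.joinedIn_proj hzD hzi
      have e₁ : g (sphereRep (blueprintOf Q) z) = g (C.proj i z) :=
        hgQ _ _ ((CQ.joinedIn_sphereRep hz.1).symm.trans (hp.mono (sdiff_subset_blueprintOf hQ)))
      rw [e₁, hg]
      refine hf _ _ ((C.joinedIn_sphereRep hzO).symm.trans
        (JoinedIn.trans ?_ (C.joinedIn_pick hn (C.proj_notMem hzD hzi))))
      have hr := (hp.map (C.continuous_retract i)).mono (V := blueprintOf O) (by
        rintro _ ⟨u, hu, rfl⟩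
        exact C.retract_mem hu.1 hu.2)
      rwa [C.retract_eq hz.2] at hr
    · simp only [hk, if_neg hzO]
  have h₃ : ∀ x : unitSphere n, x.1 ∈ blueprintOf (insertFamily O i Q) → k x = f x := by
    intro x hx
    by_cases hxO : x.1 ∈ blueprintOf O
    · simp only [hk, if_pos hxO]
      exact hf _ _ (C.joinedIn_sphereRep hxO).symm
    · have hxQ := (insert_subset_union hx).resolve_left hxO
      have hxi : x.1 ∈ O i := by
        by_contra hxi
        exact hxO (C.mem_of_closure (mem_blueprintOf.1 hx).1 hxQ.2 hxi)
      simp only [hk, if_neg hxO]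
      rw [hgQ _ x (CQ.joinedIn_sphereRep hxQ.1).symm, hg,
        pick_of_mem (U := unitSphere n ∩ O i) ⟨x.2, hxi⟩]
  intro x y hxy
  rw [← h₃ x hxy.source_mem, ← h₃ y hxy.target_mem]
  exact (h₁.union h₂).eq_of_joinedIn (hxy.mono insert_subset_union)

/-- Points chosen for `Q j` lie in the closure of the `i`-th timber, where g and f agree. Hence the
left legs of the two factors compose to the left leg of the composite. -/
theorem extend_pick (hn : 1 ≤ n) (C : IsCarving O) (CQ : IsCarving Q) (hQ : ∀ j, Q j ⊆ O i)
    (hf : IsConstantAlong (blueprintOf O) f) (hg : ∀ x, g x = f (pick (unitSphere n ∩ O i) x))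
    (j : J) (x : unitSphere n) :
    g (pick (unitSphere n ∩ Q j) x) = f (pick (unitSphere n ∩ Q j) x) := by
  rw [hg]
  exact C.pick_eq_of_constant hn hf
    (closure_mono (inter_subset_inter_right _ (hQ j)) (pick_mem_closure hn CQ j x))

end Composition

end IsCarving

/-! ## The families of regions of cleaving trees -/

/-- Each point of the set inside the open disk is the midpoint of a segment in the set. -/
def HasSegments {n : ℕ} (B : Set (Euc n)) : Prop :=
  ∀ x ∈ B, ‖x‖ < 1 → ∃ v ≠ 0, ∀ᶠ s in 𝓝 (0 : ℝ), x + s • v ∈ B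

theorem exists_ne_zero_inner_eq_zero_euc {n : ℕ} (hn : 1 ≤ n) (a : Euc n) :
    ∃ v : Euc n, v ≠ 0 ∧ inner ℝ a v = 0 := by
  have h : (ℝ ∙ a)ᗮ ≠ ⊥ := by
    intro h
    have h₁ := Submodule.finrank_add_finrank_orthogonal (ℝ ∙ a)
    rw [h, finrank_bot, finrank_euclideanSpace_fin] at h₁
    have h₂ := finrank_span_le_card (R := ℝ) ({a} : Set (Euc n))
    simp at h₂
    omega
  obtain ⟨v, hv, hv0⟩ := Submodule.exists_mem_ne_zero_of_ne_bot h
  exact ⟨v, hv0, Submodule.mem_orthogonal_singleton_iff_inner_right.1 hv⟩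

theorem eventually_add_smul_mem {n : ℕ} {B : Set (Euc n)} (hB : IsOpen B) {x : Euc n} (hx : x ∈ B)
    (v : Euc n) : ∀ᶠ s in 𝓝 (0 : ℝ), x + s • v ∈ B := by
  have hc : Continuous fun s : ℝ => x + s • v := by fun_prop
  exact hc.continuousAt.eventually_mem (hB.mem_nhds (by simpa using hx))

theorem eventually_add_smul_mem_disk {n : ℕ} {x : Euc n} (hx : ‖x‖ < 1) (v : Euc n) :
    ∀ᶠ s in 𝓝 (0 : ℝ), x + s • v ∈ unitDisk n :=
  (eventually_add_smul_mem Metric.isOpen_ball (mem_ball_zero_iff.2 hx) v).mono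
    fun _ h => Metric.ball_subset_closedBall h

/-! ### Half-spaces -/

namespace Hyp

variable {n : ℕ} (P : Hyp n)

theorem isOpen_minus : IsOpen P.minus := isOpen_lt (by fun_prop) continuous_const

theorem isOpen_plus : IsOpen P.plus := isOpen_lt continuous_const (by fun_prop)

theorem convex_minus : Convex ℝ P.minus :=
  convex_halfSpace_lt (innerₛₗ ℝ P.normal.1).isLinear _

theorem convex_plus : Convex ℝ P.plus :=
  convex_halfSpace_gt (innerₛₗ ℝ P.normal.1).isLinear _

theorem disjoint_minus_plus : Disjoint P.minus P.plus :=
  Set.disjoint_left.2 fun x (h : inner ℝ P.normal.1 x < P.offset) h' => h.asymm h'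

theorem finConvex_compl_minus : FinConvex P.minusᶜ := by
  refine .of_convex P.isOpen_minus.isClosed_compl ?_
  have e : P.minusᶜ = {x | P.offset ≤ innerₛₗ ℝ P.normal.1 x} := by
    ext x
    simp [minus]
  rw [e]
  exact convex_halfSpace_ge (innerₛₗ ℝ P.normal.1).isLinear P.offset

theorem finConvex_compl_plus : FinConvex P.plusᶜ := by
  refine .of_convex P.isOpen_plus.isClosed_compl ?_
  have e : P.plusᶜ = {x | innerₛₗ ℝ P.normal.1 x ≤ P.offset} := by
    ext x
    simp [plus]
  rw [e]
  exact convex_halfSpace_le (innerₛₗ ℝ P.normal.1).isLinear P.offset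

/-- Translation along the hyperplane preserves sides, and a nonzero such direction exists because
the dimension n + 1 is at least 2. -/
theorem exists_parallel (hn : 1 ≤ n) : ∃ v : Euc n, v ≠ 0 ∧ ∀ (x : Euc n) (s : ℝ),
    (x + s • v ∈ P.minus ↔ x ∈ P.minus) ∧ (x + s • v ∈ P.plus ↔ x ∈ P.plus) := by
  obtain ⟨v, hv, h⟩ := exists_ne_zero_inner_eq_zero_euc hn P.normal.1
  refine ⟨v, hv, fun x s => ?_⟩
  simp [minus, plus, inner_add_right, inner_smul_right, h]

end Hyp

/-- The properties of the intersections of finitely many open half-spaces that are needed here. -/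
structure IsCutRegion {n : ℕ} (V : Set (Euc n)) : Prop where
  isOpen : IsOpen V
  convex : Convex ℝ V
  finConvex : FinConvex (unitDisk n \ V)
  hasSegments : HasSegments (unitDisk n \ V)

namespace IsCutRegion

variable {n : ℕ} {V H : Set (Euc n)}

theorem univ (n : ℕ) : IsCutRegion (univ : Set (Euc n)) where
  isOpen := isOpen_univ
  convex := convex_univ
  finConvex := by
    rw [sdiff_univ]
    exact .of_convex isClosed_empty convex_empty
  hasSegments := by simp [HasSegments]

theorem inter (h : IsCutRegion V) (hH : IsOpen H) (hc : Convex ℝ H) (hf : FinConvex Hᶜ)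
    (hv : ∃ v : Euc n, v ≠ 0 ∧ ∀ (x : Euc n) (s : ℝ), x + s • v ∈ H ↔ x ∈ H) :
    IsCutRegion (V ∩ H) where
  isOpen := h.isOpen.inter hH
  convex := h.convex.inter hc
  finConvex := by
    rw [sdiff_inter, sdiff_eq _ H]
    exact h.finConvex.union ((FinConvex.of_convex Metric.isClosed_closedBall
      (convex_closedBall 0 1)).inter hf)
  hasSegments := by
    rintro x ⟨hxD, hx⟩ hx1
    -- A point of `V` on the wrong side slides parallel to the cut; a point outside `V` keeps the
    -- segment it already had.
    by_cases hxV : x ∈ V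
    · obtain ⟨v, hv0, hv⟩ := hv
      refine ⟨v, hv0, (eventually_add_smul_mem_disk hx1 v).mono fun s hs => ⟨hs, fun h => ?_⟩⟩
      exact hx ⟨hxV, (hv x s).1 h.2⟩
    · obtain ⟨v, hv0, hv⟩ := h.hasSegments x ⟨hxD, hxV⟩ hx1
      exact ⟨v, hv0, hv.mono fun s hs => ⟨hs.1, fun h => hs.2 h.1⟩⟩

theorem minus (hn : 1 ≤ n) (h : IsCutRegion V) (P : Hyp n) : IsCutRegion (V ∩ P.minus) :=
  h.inter P.isOpen_minus P.convex_minus P.finConvex_compl_minus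
    (let ⟨v, hv, h⟩ := P.exists_parallel hn; ⟨v, hv, fun x s => (h x s).1⟩)

theorem plus (hn : 1 ≤ n) (h : IsCutRegion V) (P : Hyp n) : IsCutRegion (V ∩ P.plus) :=
  h.inter P.isOpen_plus P.convex_plus P.finConvex_compl_plus
    (let ⟨v, hv, h⟩ := P.exists_parallel hn; ⟨v, hv, fun x s => (h x s).2⟩)

theorem piece (hn : 1 ≤ n) : ∀ (t : CutTree n) {V : Set (Euc n)}, IsCutRegion V →
    ∀ x : t.Leaf, IsCutRegion (t.piece V x)
  | .leaf, _, h, _ => h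
  | .node P l _, _, h, Sum.inl x => piece hn l (h.minus hn P) x
  | .node P _ r, _, h, Sum.inr x => piece hn r (h.plus hn P) x

end IsCutRegion

/-! ### Pieces and blueprints of trees -/

namespace CutTree

variable {n : ℕ}

/-- Cutting is intersection with half-spaces. Timber and its region are therefore the traces on the
sphere and the disk of one region of the whole space. -/
theorem piece_inter (A : Set (Euc n)) : ∀ (t : CutTree n) (V : Set (Euc n)) (x : t.Leaf),
    t.piece (A ∩ V) x = A ∩ t.piece V x
  | leaf, _, _ => rfl
  | node P l _, V, Sum.inl x => by
    simp only [piece]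
    rw [inter_assoc]
    exact piece_inter A l _ x
  | node P _ r, V, Sum.inr x => by
    simp only [piece]
    rw [inter_assoc]
    exact piece_inter A r _ x

theorem piece_subset : ∀ (t : CutTree n) (V : Set (Euc n)) (x : t.Leaf), t.piece V x ⊆ V
  | leaf, _, _ => Subset.rfl
  | node _ l _, _, Sum.inl x => (piece_subset l _ x).trans inter_subset_left
  | node _ _ r, _, Sum.inr x => (piece_subset r _ x).trans inter_subset_left

theorem piece_nonempty : ∀ (t : CutTree n) (V : Set (Euc n)), t.Cleaves V → V.Nonempty →
    ∀ x : t.Leaf, (t.piece V x).Nonempty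
  | leaf, _, _, h, _ => h
  | node _ l _, _, h, _, Sum.inl x => piece_nonempty l _ h.2.2.2.1 h.2.1 x
  | node _ _ r, _, h, _, Sum.inr x => piece_nonempty r _ h.2.2.2.2 h.2.2.1 x

theorem disjoint_piece : ∀ (t : CutTree n) (V : Set (Euc n)) (x y : t.Leaf), x ≠ y →
    Disjoint (t.piece V x) (t.piece V y)
  | leaf, _, _, _, h => (h rfl).elim
  | node _ l _, _, Sum.inl x, Sum.inl y, h => disjoint_piece l _ x y fun e => h (congrArg _ e)
  | node _ _ r, _, Sum.inr x, Sum.inr y, h => disjoint_piece r _ x y fun e => h (congrArg _ e)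
  | node P l r, _, Sum.inl x, Sum.inr y, _ =>
    P.disjoint_minus_plus.mono ((piece_subset l _ x).trans inter_subset_right)
      ((piece_subset r _ y).trans inter_subset_right)
  | node P l r, _, Sum.inr x, Sum.inl y, _ =>
    P.disjoint_minus_plus.symm.mono ((piece_subset r _ x).trans inter_subset_right)
      ((piece_subset l _ y).trans inter_subset_right)

theorem mem_blueprint {t : CutTree n} {V : Set (Euc n)} {z : Euc n} :
    z ∈ t.blueprint V ↔ z ∈ unitDisk n ∧ ∀ x, z ∉ t.piece V x := by
  simp [blueprint]

theorem blueprint_leaf (V : Set (Euc n)) : (leaf : CutTree n).blueprint V = unitDisk n \ V := by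
  ext z
  exact mem_blueprint.trans (and_congr_right fun _ => ⟨fun h => h (), fun h _ => h⟩)

theorem blueprint_node (P : Hyp n) (l r : CutTree n) (V : Set (Euc n)) :
    (node P l r).blueprint V = l.blueprint (V ∩ P.minus) ∩ r.blueprint (V ∩ P.plus) := by
  ext z
  rw [mem_inter_iff, mem_blueprint, mem_blueprint, mem_blueprint]
  exact ⟨fun h => ⟨⟨h.1, fun x => h.2 (Sum.inl x)⟩, h.1, fun x => h.2 (Sum.inr x)⟩,
    fun h => ⟨h.1.1, fun x => x.casesOn h.1.2 h.2.2⟩⟩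

theorem finConvex_blueprint (hn : 1 ≤ n) : ∀ (t : CutTree n) {V : Set (Euc n)}, IsCutRegion V →
    FinConvex (t.blueprint V)
  | leaf, V, h => by
    rw [blueprint_leaf]
    exact h.finConvex
  | node P l r, V, h => by
    rw [blueprint_node]
    exact (finConvex_blueprint hn l (h.minus hn P)).inter (finConvex_blueprint hn r (h.plus hn P))

/-- Four positions of x are possible. In one of the two open halves of `V`, the segment from that
subtree stays in the half for small parameters and avoids the pieces of the other subtree. On the
hyperplane within `V`, slide along the hyperplane. Outside `V`, the segment that avoids `V` avoids
all pieces. -/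
theorem hasSegments_blueprint (hn : 1 ≤ n) : ∀ (t : CutTree n) {V : Set (Euc n)}, IsCutRegion V →
    HasSegments (t.blueprint V)
  | leaf, V, h => by
    rw [blueprint_leaf]
    exact h.hasSegments
  | node P l r, V, h => by
    rw [blueprint_node]
    have hl := hasSegments_blueprint hn l (h.minus hn P)
    have hr := hasSegments_blueprint hn r (h.plus hn P)
    have hout : ∀ (t : CutTree n) (B : Set (Euc n)), ∀ z ∈ unitDisk n, z ∉ B →
        z ∈ t.blueprint B := fun t B z hz hzB =>
      mem_blueprint.2 ⟨hz, fun x hx => hzB (t.piece_subset B x hx)⟩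
    rintro x ⟨hxl, hxr⟩ hx1
    by_cases hm : x ∈ V ∩ P.minus
    · obtain ⟨v, hv0, hv⟩ := hl x hxl hx1
      refine ⟨v, hv0, ?_⟩
      filter_upwards [hv, eventually_add_smul_mem (h.minus hn P).isOpen hm v] with s hs hs'
      exact ⟨hs, hout r _ _ (mem_blueprint.1 hs).1 fun h' =>
        P.disjoint_minus_plus.le_bot ⟨hs'.2, h'.2⟩⟩
    by_cases hp : x ∈ V ∩ P.plus
    · obtain ⟨v, hv0, hv⟩ := hr x hxr hx1
      refine ⟨v, hv0, ?_⟩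
      filter_upwards [hv, eventually_add_smul_mem (h.plus hn P).isOpen hp v] with s hs hs'
      exact ⟨hout l _ _ (mem_blueprint.1 hs).1 fun h' =>
        P.disjoint_minus_plus.le_bot ⟨h'.2, hs'.2⟩, hs⟩
    by_cases hV : x ∈ V
    · obtain ⟨v, hv0, hv⟩ := P.exists_parallel hn
      refine ⟨v, hv0, (eventually_add_smul_mem_disk hx1 v).mono fun s hs => ⟨?_, ?_⟩⟩
      · exact hout l _ _ hs fun h' => hm ⟨hV, (hv x s).1.1 h'.2⟩
      · exact hout r _ _ hs fun h' => hp ⟨hV, (hv x s).2.1 h'.2⟩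
    · obtain ⟨v, hv0, hv⟩ := h.hasSegments x ⟨(mem_blueprint.1 hxl).1, hV⟩ hx1
      exact ⟨v, hv0, hv.mono fun s hs => ⟨hout l _ _ hs.1 fun h' => hs.2 h'.1,
        hout r _ _ hs.1 fun h' => hs.2 h'.1⟩⟩

end CutTree

/-- Every path-component reaches the sphere. -/
theorem HasSegments.exists_sphere {n : ℕ} {B : Set (Euc n)} (h : HasSegments B) (hB : FinConvex B)
    (hD : B ⊆ unitDisk n) {x : Euc n} (hx : x ∈ B) : ∃ y ∈ unitSphere n, JoinedIn B x y := by
  -- The path-component of x is closed, hence compact; a point of maximal norm in it must lie on the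
  -- sphere.
  have hL : LocConstOn (fun z => JoinedIn B x z) B := hB.locConstOn fun a b hab =>
    propext ⟨fun h => h.trans hab, fun h => h.trans hab.symm⟩
  have hK : IsCompact (B ∩ (fun z => JoinedIn B x z) ⁻¹' {True}) :=
    (isCompact_closedBall (0 : Euc n) 1).of_isClosed_subset (hL _) fun z hz => hD hz.1
  obtain ⟨y, hy, hmax⟩ := hK.exists_isMaxOn ⟨x, hx, by simpa using JoinedIn.refl hx⟩
    continuous_norm.continuousOn
  have hxy : JoinedIn B x y := by simpa using hy.2
  refine ⟨y, ?_, hxy⟩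
  rw [mem_sphere_zero_iff_norm]
  refine le_antisymm (mem_closedBall_zero_iff.1 (hD hy.1)) (not_lt.1 fun hlt => ?_)
  obtain ⟨v, hv0, hv⟩ := h y hy.1 hlt
  obtain ⟨ε, hε, hv⟩ := Metric.eventually_nhds_iff.1 hv
  have key : ∀ s : ℝ, |s| < ε → ‖y + s • v‖ ≤ ‖y‖ := by
    intro s hs
    have hseg : segment ℝ y (y + s • v) ⊆ B := by
      rw [segment_eq_image']
      rintro _ ⟨t, ⟨ht0, ht1⟩, rfl⟩
      have : t • (y + s • v - y) = (t * s) • v := by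
        rw [add_sub_cancel_left, smul_smul]
      simp only [this]
      apply hv
      rw [Real.dist_eq, sub_zero, abs_mul, abs_of_nonneg ht0]
      exact (mul_le_of_le_one_left (abs_nonneg s) ht1).trans_lt hs
    have hj := hxy.trans (JoinedIn.of_segment_subset hseg)
    exact hmax ⟨hj.target_mem, by simpa using hj⟩
  have h₁ := key (ε / 2) (by rw [abs_of_pos (by positivity)]; linarith)
  have h₂ := key (-(ε / 2)) (by rw [abs_neg, abs_of_pos (by positivity)]; linarith)
  -- With u = (ε / 2) • v, the sum ‖y + u‖² + ‖y − u‖² exceeds 2‖y‖², so one end of the segment is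
  -- farther out than y.
  have h₃ := parallelogram_law_with_norm ℝ y ((ε / 2) • v)
  rw [neg_smul, ← sub_eq_add_neg] at h₂
  have h₄ : 0 < ‖(ε / 2) • v‖ := norm_pos_iff.2 (smul_ne_zero (by positivity) hv0)
  nlinarith [norm_nonneg (y + (ε / 2) • v), norm_nonneg (y - (ε / 2) • v)]

/-! ### From decorated trees to carvings -/

namespace PreCleavage

variable {n : ℕ} {I J : Type}

/-- The regions at the leaves, for the region `V` of the incoming colour. -/
def family (p : PreCleavage n I) (V : Set (Euc n)) (i : I) : Set (Euc n) :=
  p.tree.piece V (p.label i)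

theorem sphere_inter_family (p : PreCleavage n I) {V : Set (Euc n)}
    (hV : p.source.1 = unitSphere n ∩ V) (i : I) : unitSphere n ∩ p.family V i = p.timber i := by
  rw [timber, hV, CutTree.piece_inter]
  rfl

theorem source_nonempty (p : PreCleavage n I) : p.source.1.Nonempty := by
  obtain ⟨t, ht, x, hx⟩ := p.source.2.1
  rw [← hx]
  exact t.piece_nonempty _ ht (nonempty_coe_sort.1 inferInstance) x

theorem blueprintOf_family (p : PreCleavage n I) (V : Set (Euc n)) :
    blueprintOf (p.family V) = p.tree.blueprint V := by
  ext z
  rw [mem_blueprintOf, CutTree.mem_blueprint, p.label.surjective.forall]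
  rfl

/-- The blueprint only tests points of the disk, so the region in the disk may be replaced by an
open region of the whole space. -/
theorem blueprint_eq (p : PreCleavage n I) (V : Set (Euc n)) :
    p.blueprint (unitDisk n ∩ V) = blueprintOf (p.family V) := by
  rw [blueprintOf_family]
  ext z
  rw [blueprint, CutTree.mem_blueprint, CutTree.mem_blueprint]
  refine and_congr_right fun hz => forall_congr' fun x => ?_
  rw [CutTree.piece_inter]
  exact not_congr (and_iff_right hz)

theorem isCarving_family (hn : 1 ≤ n) (p : PreCleavage n I) {V : Set (Euc n)} (h : IsCutRegion V)
    (hV : p.source.1 = unitSphere n ∩ V) : IsCarving (p.family V) where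
  isOpen i := (h.piece hn p.tree _).isOpen
  convex i := (h.piece hn p.tree _).convex
  disjoint i j hij := p.tree.disjoint_piece V _ _ (p.label.injective.ne hij)
  nonempty i := by
    rw [p.sphere_inter_family hV]
    exact p.tree.piece_nonempty _ p.cleaves p.source_nonempty _
  contractible i := by
    rw [p.sphere_inter_family hV]
    exact p.contractible i
  finConvex := by
    rw [blueprintOf_family]
    exact p.tree.finConvex_blueprint hn h
  exists_sphere x hx := by
    rw [blueprintOf_family] at hx ⊢
    exact (p.tree.hasSegments_blueprint hn h).exists_sphere (p.tree.finConvex_blueprint hn h)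
      sdiff_subset hx

end PreCleavage

/-- Run the same tree on the whole space, and intersect with the sphere and the disk. -/
theorem IsRegionOf.exists_cutRegion {n : ℕ} (hn : 1 ≤ n) {U W : Set (Euc n)}
    (h : IsRegionOf U W) :
    ∃ V, IsCutRegion V ∧ U = unitSphere n ∩ V ∧ W = unitDisk n ∩ V := by
  obtain ⟨t, -, x, hU, hW⟩ := h
  refine ⟨t.piece univ x, (IsCutRegion.univ n).piece hn t x, ?_, ?_⟩
  · rw [← hU, ← CutTree.piece_inter, inter_univ]
  · rw [← hW, ← CutTree.piece_inter, inter_univ]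

theorem IsTimber.exists_cutRegion {n : ℕ} (hn : 1 ≤ n) {U : Set (Euc n)} (h : IsTimber n U) :
    ∃ V, IsCutRegion V ∧ U = unitSphere n ∩ V := by
  obtain ⟨t, ht, x, hU⟩ := h
  obtain ⟨V, h₁, h₂, -⟩ := IsRegionOf.exists_cutRegion hn ⟨t, ht, x, hU, rfl⟩
  exact ⟨V, h₁, h₂⟩

/-! ## The pullback square -/

theorem zerothHomotopy_mk_eq_iff {E : Type*} [TopologicalSpace E] {β : Set E} {x y : E} (hx : x ∈ β)
    (hy : y ∈ β) : ZerothHomotopy.mk (X := β) ⟨x, hx⟩ = ZerothHomotopy.mk ⟨y, hy⟩ ↔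
      JoinedIn β x y := by
  rw [joinedIn_iff_joined hx hy]
  exact Quotient.eq (r := pathSetoid β)

namespace IsCarving

variable {n : ℕ} {I : Type} {O : I → Set (Euc n)}

/-- The space of maps that are constant along the path-components of the blueprint. -/
abbrev Maps (_ : IsCarving O) (M : Type u) [TopologicalSpace M] : Type u :=
  {f : C(unitSphere n, M) // IsConstantAlong (blueprintOf O) f}

/-- The left leg of the action: the `i`-th map agrees with the given one on the `i`-th timber. -/
noncomputable def leftLeg (C : IsCarving O) (hn : 1 ≤ n) (M : Type u) [TopologicalSpace M] :
    C(C.Maps M, I → C(unitSphere n, M)) where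
  toFun f i := ⟨fun x => f.1 (pick (unitSphere n ∩ O i) x),
    (C.continuous_uncurry_pick hn ⟨fun f : C.Maps M => f.1, continuous_subtype_val⟩
      (fun f => f.2) i).comp (Continuous.prodMk_right f)⟩
  continuous_toFun := continuous_pi fun i => ContinuousMap.continuous_of_continuous_uncurry _
    (C.continuous_uncurry_pick hn ⟨fun f : C.Maps M => f.1, continuous_subtype_val⟩
      (fun f => f.2) i)

theorem leftLeg_apply (C : IsCarving O) (hn : 1 ≤ n) {M : Type u} [TopologicalSpace M]
    (f : C.Maps M) (i : I) (x : unitSphere n) :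
    C.leftLeg hn M f i x = f.1 (pick (unitSphere n ∩ O i) x) := rfl

/-- The correspondence by which the carving acts. -/
noncomputable def span (C : IsCarving O) (hn : 1 ≤ n) (M : Type u) [TopologicalSpace M] :
    TopSpan (TopCat.of (I → C(unitSphere n, M))) (TopCat.of C(unitSphere n, M)) :=
  ⟨TopCat.of (C.Maps M), C.leftLeg hn M, ⟨Subtype.val, continuous_subtype_val⟩⟩

/-- The complement of the `i`-th timber. -/
abbrev timberCompl (O : I → Set (Euc n)) (i : I) : Set (Euc n) :=
  unitSphere n \ (unitSphere n ∩ O i)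

theorem pick_mem_blueprintOf (C : IsCarving O) (hn : 1 ≤ n) {i : I} {x : unitSphere n}
    (hx : x.1 ∉ O i) : (pick (unitSphere n ∩ O i) x).1 ∈ blueprintOf O :=
  (C.joinedIn_pick hn hx).target_mem

theorem notMem_of_timberCompl {i : I} {x : Euc n} (hx : x ∈ timberCompl O i) : x ∉ O i :=
  fun h => hx.2 ⟨hx.1, h⟩

/-- The map from the complement of the `i`-th timber to the set of path-components of the
blueprint. -/
noncomputable def component (C : IsCarving O) (hn : 1 ≤ n) (i : I) (x : timberCompl O i) :
    ZerothHomotopy (blueprintOf O) :=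
  ZerothHomotopy.mk ⟨pick (unitSphere n ∩ O i) ⟨x.1, x.2.1⟩,
    C.pick_mem_blueprintOf hn (notMem_of_timberCompl x.2)⟩

theorem component_eq (C : IsCarving O) (hn : 1 ≤ n) (i : I) (x : timberCompl O i) {y : Euc n}
    (hy : y ∈ connectedComponentIn (timberCompl O i) x ∩ closure (unitSphere n ∩ O i)) :
    ∃ h : y ∈ blueprintOf O, C.component hn i x = ZerothHomotopy.mk ⟨y, h⟩ := by
  have hj := C.joinedIn_boundary x.2.1 (notMem_of_timberCompl x.2) hy
  refine ⟨hj.target_mem, (zerothHomotopy_mk_eq_iff _ _).2 ?_⟩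
  exact (C.joinedIn_pick hn (x := ⟨x.1, x.2.1⟩) (notMem_of_timberCompl x.2)).symm.trans hj

/-- The map factors through `pick`, which is already locally constant on the complement. -/
theorem locConstOn_component (C : IsCarving O) (hn : 1 ≤ n) (i : I) :
    LocConstOn (C.component hn i) univ := by
  intro A
  have h := (C.locConstOn_pick i).preimage (g := fun x : timberCompl O i => ⟨x.1, x.2.1⟩)
    (by fun_prop)
  convert h {s | ∃ hs : s.1 ∈ blueprintOf O, ZerothHomotopy.mk ⟨s.1, hs⟩ ∈ A} using 1
  ext x
  constructor
  · rintro ⟨-, hx⟩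
    exact ⟨x.2, C.pick_mem_blueprintOf hn (notMem_of_timberCompl x.2), hx⟩
  · rintro ⟨-, h, hx⟩
    exact ⟨mem_univ _, hx⟩

theorem continuous_uncurry_component (C : IsCarving O) (hn : 1 ≤ n) (M : Type u)
    [TopologicalSpace M] (i : I) :
    Continuous fun p : (ZerothHomotopy (blueprintOf O) → M) × timberCompl O i =>
      p.1 (C.component hn i p.2) := by
  rw [← continuousOn_univ, ← univ_prod_univ]
  exact (C.locConstOn_component hn i).continuousOn_prod (fun x _ => continuous_apply (C.component hn i x))
    fun z x _ y _ h => congrArg z h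

/-- The map of mapping spaces induced by `component`. -/
noncomputable def pullbackMap (C : IsCarving O) (hn : 1 ≤ n) (M : Type u) [TopologicalSpace M] :
    C(ZerothHomotopy (blueprintOf O) → M, (i : I) → C(timberCompl O i, M)) where
  toFun g i := ⟨fun x => g (C.component hn i x),
    (C.continuous_uncurry_component hn M i).comp (Continuous.prodMk_right g)⟩
  continuous_toFun := continuous_pi fun i => ContinuousMap.continuous_of_continuous_uncurry _
    (C.continuous_uncurry_component hn M i)

/-- A point of the sphere in a path-component of the blueprint. -/
noncomputable def componentRep (_ : IsCarving O) (q : ZerothHomotopy (blueprintOf O)) :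
    unitSphere n :=
  sphereRep (blueprintOf O) (Quotient.out q).1

theorem componentRep_mem (C : IsCarving O) (q : ZerothHomotopy (blueprintOf O)) :
    (C.componentRep q).1 ∈ blueprintOf O :=
  (C.joinedIn_sphereRep (Quotient.out q).2).target_mem

theorem mk_componentRep (C : IsCarving O) (q : ZerothHomotopy (blueprintOf O)) :
    ZerothHomotopy.mk ⟨(C.componentRep q).1, C.componentRep_mem q⟩ = q := by
  refine Eq.trans ?_ (Quotient.out_eq q)
  exact (zerothHomotopy_mk_eq_iff _ (Quotient.out q).2).2
    (C.joinedIn_sphereRep (Quotient.out q).2).symm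

/-- Evaluation at the path-components of the blueprint. -/
noncomputable def evalComponents (C : IsCarving O) (M : Type u) [TopologicalSpace M] :
    C(C.Maps M, ZerothHomotopy (blueprintOf O) → M) where
  toFun f q := f.1 (C.componentRep q)
  continuous_toFun := by fun_prop

theorem evalComponents_mk (C : IsCarving O) {M : Type u} [TopologicalSpace M] (f : C.Maps M)
    (x : unitSphere n) (hx : x.1 ∈ blueprintOf O) :
    C.evalComponents M f (ZerothHomotopy.mk ⟨x.1, hx⟩) = f.1 x :=
  f.2 _ _ ((zerothHomotopy_mk_eq_iff (C.componentRep_mem _) hx).1 (C.mk_componentRep _))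

/-! ### Gluing and the universal property of the square -/

section Lift

variable {M : Type u} [TopologicalSpace M] {Z : Type u} [TopologicalSpace Z]

open Classical in
/-- The map glued from maps on the closures of the timber and from values on the path-components
of the blueprint. -/
noncomputable def glue (_ : IsCarving O) (a : C(Z, I → C(unitSphere n, M)))
    (b : C(Z, ZerothHomotopy (blueprintOf O) → M)) (z : Z) (x : unitSphere n) : M :=
  if h : x.1 ∈ blueprintOf O then b z (ZerothHomotopy.mk ⟨x.1, h⟩) else
    a z (Classical.choose (show ∃ i, x.1 ∈ O i by
      by_contra h'
      exact h (mem_blueprintOf.2 ⟨sphere_subset_disk n x.2, not_exists.1 h'⟩))) x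

theorem glue_of_mem_blueprintOf (C : IsCarving O) (a : C(Z, I → C(unitSphere n, M)))
    (b : C(Z, ZerothHomotopy (blueprintOf O) → M)) (z : Z) {x : unitSphere n}
    (h : x.1 ∈ blueprintOf O) : C.glue a b z x = b z (ZerothHomotopy.mk ⟨x.1, h⟩) := dif_pos h

theorem glue_of_mem (C : IsCarving O) (a : C(Z, I → C(unitSphere n, M)))
    (b : C(Z, ZerothHomotopy (blueprintOf O) → M)) (z : Z) {x : unitSphere n} {i : I}
    (h : x.1 ∈ O i) : C.glue a b z x = a z i x := by
  have hx : x.1 ∉ blueprintOf O := fun h' => (mem_blueprintOf.1 h').2 i h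
  have hex : ∃ i, x.1 ∈ O i := ⟨i, h⟩
  have e : Classical.choose hex = i := by
    by_contra hne
    exact (C.disjoint _ _ hne).le_bot ⟨Classical.choose_spec hex, h⟩
  rw [glue, dif_neg hx, e]

/-- A frontier point of the timber lies in its own complement component and on the boundary of it,
so c sends it to its own path-component. There compatibility identifies the two formulas. -/
theorem glue_of_mem_closure (C : IsCarving O) (hn : 1 ≤ n) {a : C(Z, I → C(unitSphere n, M))}
    {b : C(Z, ZerothHomotopy (blueprintOf O) → M)}
    (hab : ∀ z i (x : timberCompl O i), a z i ⟨x.1, x.2.1⟩ = b z (C.component hn i x)) (z : Z)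
    {x : unitSphere n} {i : I} (hx : x.1 ∈ closure (unitSphere n ∩ O i)) :
    C.glue a b z x = a z i x := by
  by_cases h : x.1 ∈ O i
  · exact C.glue_of_mem a b z h
  · have hxc : x.1 ∈ timberCompl O i := ⟨x.2, fun h' => h h'.2⟩
    obtain ⟨hβ, e⟩ := C.component_eq hn i ⟨x.1, hxc⟩ ⟨mem_connectedComponentIn hxc, hx⟩
    rw [C.glue_of_mem_blueprintOf a b z hβ, ← e]
    exact (hab z i ⟨x.1, hxc⟩).symm

theorem continuous_glue [Finite I] (C : IsCarving O) (hn : 1 ≤ n)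
    {a : C(Z, I → C(unitSphere n, M))} {b : C(Z, ZerothHomotopy (blueprintOf O) → M)}
    (hab : ∀ z i (x : timberCompl O i), a z i ⟨x.1, x.2.1⟩ = b z (C.component hn i x)) :
    Continuous fun p : Z × unitSphere n => C.glue a b p.1 p.2 := by
  have h₁ : ContinuousOn (fun p : Z × unitSphere n => C.glue a b p.1 p.2)
      (univ ×ˢ (Subtype.val ⁻¹' blueprintOf O)) := by
    -- The representative serves as a locally constant label of the path-component, through which b
    -- is evaluated.
    have hL : LocConstOn (sphereRep (blueprintOf O)) (blueprintOf O) :=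
      C.finConvex.locConstOn fun x y hxy => by
        have : (fun s : unitSphere n => JoinedIn (blueprintOf O) x s.1) =
            fun s : unitSphere n => JoinedIn (blueprintOf O) y s.1 :=
          funext fun s => propext ⟨fun h => hxy.symm.trans h, fun h => hxy.trans h⟩
        simp only [sphereRep, this]
    refine (hL.preimage (continuous_subtype_val (p := (· ∈ unitSphere n)))).continuousOn_prod ?_ ?_
    · intro x hx
      simp only [C.glue_of_mem_blueprintOf a b _ hx]
      fun_prop
    · intro z x hx y hy h
      simp only [C.glue_of_mem_blueprintOf a b _ hx, C.glue_of_mem_blueprintOf a b _ hy]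
      refine congrArg (b z) ((zerothHomotopy_mk_eq_iff (x := x.1) (y := y.1) hx hy).2 ?_)
      have hxr := C.joinedIn_sphereRep hx
      have hyr := C.joinedIn_sphereRep hy
      have h' : sphereRep (blueprintOf O) x.1 = sphereRep (blueprintOf O) y.1 := h
      rw [h'] at hxr
      exact hxr.trans hyr.symm
  have h₂ : ∀ i, ContinuousOn (fun p : Z × unitSphere n => C.glue a b p.1 p.2)
      (univ ×ˢ (Subtype.val ⁻¹' closure (unitSphere n ∩ O i))) := by
    intro i
    refine ContinuousOn.congr (f := fun p : Z × unitSphere n => a p.1 i p.2)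
      (Continuous.continuousOn (by fun_prop)) ?_
    rintro ⟨z, x⟩ ⟨-, hx⟩
    exact C.glue_of_mem_closure hn hab z hx
  -- A finite closed cover of the sphere: `none` stands for the blueprint, `some i` for the closure
  -- of the `i`-th timber.
  refine (locallyFinite_of_finite fun o : Option I => (univ : Set Z) ×ˢ
    (Subtype.val ⁻¹' (o.elim (blueprintOf O) fun i => closure (unitSphere n ∩ O i)) :
      Set (unitSphere n))).continuous (iUnion_eq_univ_iff.2 ?_) ?_ ?_
  · rintro ⟨z, x⟩
    by_cases h : x.1 ∈ blueprintOf O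
    · exact ⟨none, mem_univ _, h⟩
    · rw [mem_blueprintOf] at h
      push Not at h
      obtain ⟨i, hi⟩ := h (sphere_subset_disk n x.2)
      exact ⟨some i, mem_univ _, subset_closure ⟨x.2, hi⟩⟩
  · rintro (_ | i)
    · exact isClosed_univ.prod (C.finConvex.isClosed.preimage continuous_subtype_val)
    · exact isClosed_univ.prod (isClosed_closure.preimage continuous_subtype_val)
  · rintro (_ | i)
    · exact h₁
    · exact h₂ i

theorem isConstantAlong_glue (C : IsCarving O) {a : C(Z, I → C(unitSphere n, M))}
    {b : C(Z, ZerothHomotopy (blueprintOf O) → M)} (z : Z) {x y : unitSphere n}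
    (hxy : JoinedIn (blueprintOf O) x.1 y.1) : C.glue a b z x = C.glue a b z y := by
  rw [C.glue_of_mem_blueprintOf a b z hxy.source_mem,
    C.glue_of_mem_blueprintOf a b z hxy.target_mem]
  exact congrArg (b z) ((zerothHomotopy_mk_eq_iff _ _).2 hxy)

/-- The universal map to the pullback. -/
noncomputable def lift [Finite I] (C : IsCarving O) (hn : 1 ≤ n)
    (a : C(Z, I → C(unitSphere n, M))) (b : C(Z, ZerothHomotopy (blueprintOf O) → M))
    (hab : ∀ z i (x : timberCompl O i), a z i ⟨x.1, x.2.1⟩ = b z (C.component hn i x)) :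
    C(Z, C.Maps M) :=
  let k : C(Z, C(unitSphere n, M)) := ContinuousMap.curry
    ⟨fun p : Z × unitSphere n => C.glue a b p.1 p.2, C.continuous_glue hn hab⟩
  ⟨fun z => ⟨k z, fun _ _ hxy => C.isConstantAlong_glue z hxy⟩, k.continuous.subtype_mk _⟩

end Lift

/-- The restriction to the complements of the timber. -/
def restrict (O : I → Set (Euc n)) (M : Type u) [TopologicalSpace M] :
    C(I → C(unitSphere n, M), (i : I) → C(timberCompl O i, M)) where
  toFun f i := (f i).comp ⟨Set.inclusion Set.sdiff_subset, continuous_inclusion Set.sdiff_subset⟩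
  continuous_toFun := by fun_prop

/-- A compatible pair prescribes a map on the blueprint and on each timber, and these cover the
sphere; this gives uniqueness, and gluing gives existence. On the complement of a timber the left
leg recovers the given map because this map factors through c there. -/
theorem isPullback [Finite I] (C : IsCarving O) (hn : 1 ≤ n) (M : Type u) [TopologicalSpace M] :
    IsPullback (TopCat.ofHom (C.leftLeg hn M)) (TopCat.ofHom (C.evalComponents M))
      (TopCat.ofHom (restrict O M)) (TopCat.ofHom (C.pullbackMap hn M)) := by
  have hw : TopCat.ofHom (C.leftLeg hn M) ≫ TopCat.ofHom (restrict O M) =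
      TopCat.ofHom (C.evalComponents M) ≫ TopCat.ofHom (C.pullbackMap hn M) := by
    refine TopCat.hom_ext (ContinuousMap.ext fun f => funext fun i => ContinuousMap.ext fun x => ?_)
    exact (C.evalComponents_mk f (pick (unitSphere n ∩ O i) ⟨x.1, x.2.1⟩)
      (C.pick_mem_blueprintOf hn (notMem_of_timberCompl x.2))).symm
  have hab : ∀ s : Limits.PullbackCone (TopCat.ofHom (restrict O M))
      (TopCat.ofHom (C.pullbackMap hn M)), ∀ z i (x : timberCompl O i),
      s.fst.hom z i ⟨x.1, x.2.1⟩ = s.snd.hom z (C.component hn i x) := fun s z i x =>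
    congrArg (fun k : (i : I) → C(timberCompl O i, M) => k i x)
      (congrArg (fun k => k.hom z) s.condition)
  refine ⟨⟨hw⟩, ⟨Limits.PullbackCone.IsLimit.mk hw
    (fun s => TopCat.ofHom (C.lift hn s.fst.hom s.snd.hom (hab s))) (fun s => ?_) (fun s => ?_)
    (fun s m h₁ h₂ => ?_)⟩⟩
  · refine TopCat.hom_ext (ContinuousMap.ext fun z => funext fun i => ContinuousMap.ext fun x => ?_)
    change C.glue s.fst.hom s.snd.hom z (pick (unitSphere n ∩ O i) x) = s.fst.hom z i x
    by_cases hx : x.1 ∈ O i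
    · rw [pick_of_mem (U := unitSphere n ∩ O i) ⟨x.2, hx⟩, C.glue_of_mem _ _ z hx]
    · have hxc : x.1 ∈ timberCompl O i := ⟨x.2, fun h' => hx h'.2⟩
      rw [C.glue_of_mem_blueprintOf _ _ z (C.pick_mem_blueprintOf hn hx)]
      exact (hab s z i ⟨x.1, hxc⟩).symm
  · refine TopCat.hom_ext (ContinuousMap.ext fun z => funext fun q => ?_)
    change C.glue s.fst.hom s.snd.hom z (C.componentRep q) = s.snd.hom z q
    rw [C.glue_of_mem_blueprintOf _ _ z (C.componentRep_mem q), C.mk_componentRep]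
  · refine TopCat.hom_ext (ContinuousMap.ext fun z => Subtype.ext (ContinuousMap.ext fun x => ?_))
    change (m.hom z).1 x = C.glue s.fst.hom s.snd.hom z x
    by_cases hx : x.1 ∈ blueprintOf O
    · rw [C.glue_of_mem_blueprintOf _ _ z hx, ← h₂]
      exact (C.evalComponents_mk (m.hom z) x hx).symm
    · rw [mem_blueprintOf] at hx
      push Not at hx
      obtain ⟨i, hi⟩ := hx (sphere_subset_disk n x.2)
      rw [C.glue_of_mem _ _ z hi, ← h₁]
      change _ = (m.hom z).1 (pick (unitSphere n ∩ O i) x)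
      rw [pick_of_mem (U := unitSphere n ∩ O i) ⟨x.2, hi⟩]

end IsCarving

/-- `ξ` is given by the pullback construction for the set `β`, the family `U` and the subspace `K`
of the mapping space. -/
def IsPullbackFor {n : ℕ} {I : Type} (M : Type u) [TopologicalSpace M] (β : Set (Euc n))
    (U : I → Set (Euc n)) (K : C(unitSphere n, M) → Prop)
    (ξ : (Corr.of (TopCat.of C(unitSphere n, M))).pow I ⟶
      Corr.of (TopCat.of C(unitSphere n, M))) : Prop :=
  ∃ (c : (i : I) → ↥(unitSphere n \ U i) → ZerothHomotopy β)
    (φ : C(ZerothHomotopy β → M, (i : I) → C(↥(unitSphere n \ U i), M)))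
    (ev : C({f // K f}, ZerothHomotopy β → M))
    (φ' : C({f // K f}, I → C(unitSphere n, M))),
    (∀ (i : I) (x : ↥(unitSphere n \ U i)),
      ∀ y ∈ connectedComponentIn (unitSphere n \ U i) x ∩ closure (U i),
      ∃ hy : y ∈ β, c i x = ZerothHomotopy.mk ⟨y, hy⟩) ∧
    (∀ (g : ZerothHomotopy β → M) (i : I) (x : ↥(unitSphere n \ U i)), φ g i x = g (c i x)) ∧
    (∀ (f : {f // K f}) (x : unitSphere n) (hx : x.1 ∈ β),
      ev f (ZerothHomotopy.mk ⟨x.1, hx⟩) = f.1 x) ∧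
    (∀ (f : {f // K f}) (i : I) (x : unitSphere n), x.1 ∈ U i → φ' f i x = f.1 x) ∧
    IsPullback (TopCat.ofHom φ') (TopCat.ofHom ev)
      (TopCat.ofHom (⟨fun f i => (f i).comp
        ⟨Set.inclusion Set.sdiff_subset, continuous_inclusion Set.sdiff_subset⟩, by fun_prop⟩ :
          C(I → C(unitSphere n, M), (i : I) → C(↥(unitSphere n \ U i), M))))
      (TopCat.ofHom φ) ∧
    ξ = Corr.mk ⟨TopCat.of {f // K f}, φ', ⟨Subtype.val, continuous_subtype_val⟩⟩

theorem IsCarving.isPullbackFor {n : ℕ} {I : Type} [Finite I] {O : I → Set (Euc n)}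
    (C : IsCarving O) (hn : 1 ≤ n) (M : Type u) [TopologicalSpace M] :
    IsPullbackFor M (blueprintOf O) (fun i => unitSphere n ∩ O i) (IsConstantAlong (blueprintOf O))
      (Corr.mk (C.span hn M)) :=
  ⟨C.component hn, C.pullbackMap hn M, C.evalComponents M, C.leftLeg hn M,
    fun i x _ hy => C.component_eq hn i x hy, fun _ _ _ => rfl, C.evalComponents_mk,
    fun f i x hx => by rw [C.leftLeg_apply, pick_of_mem hx], C.isPullback hn M, rfl⟩

theorem PreCleavage.isPullbackConstruction {n : ℕ} (hn : 1 ≤ n) {I : Type} [Finite I]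
    (p : PreCleavage n I) {W : Set (Euc n)} {O : I → Set (Euc n)} (C : IsCarving O)
    (hβ : p.blueprint W = blueprintOf O) (hU : p.timber = fun i => unitSphere n ∩ O i)
    (M : Type u) [TopologicalSpace M] :
    p.IsPullbackConstruction W M (Corr.mk (C.span hn M)) := by
  -- As the sets, the families and the predicates are equal, all the dependent data can be
  -- transported by rewriting.
  have hK : (fun f : C(unitSphere n, M) => ∀ (x y : unitSphere n) (hx : x.1 ∈ p.blueprint W)
      (hy : y.1 ∈ p.blueprint W), ZerothHomotopy.mk (X := p.blueprint W) ⟨x.1, hx⟩ =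
        ZerothHomotopy.mk ⟨y.1, hy⟩ → f x = f y) = IsConstantAlong (blueprintOf O) := by
    rw [← hβ]
    refine funext fun f => propext ⟨fun h x y hxy => ?_, fun h x y hx hy hxy => ?_⟩
    · exact h x y hxy.source_mem hxy.target_mem ((zerothHomotopy_mk_eq_iff _ _).2 hxy)
    · exact h x y ((zerothHomotopy_mk_eq_iff _ _).1 hxy)
  change IsPullbackFor M (p.blueprint W) p.timber (fun f : C(unitSphere n, M) =>
    ∀ (x y : unitSphere n) (hx : x.1 ∈ p.blueprint W) (hy : y.1 ∈ p.blueprint W),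
      ZerothHomotopy.mk (X := p.blueprint W) ⟨x.1, hx⟩ = ZerothHomotopy.mk ⟨y.1, hy⟩ → f x = f y)
    (Corr.mk (C.span hn M))
  rw [hK, hβ, hU]
  exact C.isPullbackFor hn M

/-! ## The action -/

namespace IsCarving

variable {n : ℕ} {I J : Type} {O : I → Set (Euc n)}

theorem blueprintOf_comp (O : I → Set (Euc n)) {e : J → I} (he : Function.Surjective e) :
    blueprintOf (O ∘ e) = blueprintOf O := by
  ext z
  rw [mem_blueprintOf, mem_blueprintOf, he.forall]
  rfl

theorem reindex (C : IsCarving O) {e : J → I} (he : Function.Bijective e) :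
    IsCarving (O ∘ e) where
  isOpen j := C.isOpen (e j)
  convex j := C.convex (e j)
  disjoint i j hij := C.disjoint _ _ (he.1.ne hij)
  nonempty j := C.nonempty (e j)
  contractible j := C.contractible (e j)
  finConvex := by
    rw [blueprintOf_comp O he.2]
    exact C.finConvex
  exists_sphere := by
    rw [blueprintOf_comp O he.2]
    exact C.exists_sphere

/-- `pick` involves the timber only, and so does the constancy condition by `isConstantAlong_iff`.
The correspondence is thus invariant under chop-equivalence and under the choice of regions. -/
theorem span_equiv [Finite I] (C : IsCarving O) {O' : I → Set (Euc n)} (C' : IsCarving O')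
    (hn : 1 ≤ n) (h : ∀ i, unitSphere n ∩ O i = unitSphere n ∩ O' i) (M : Type u)
    [TopologicalSpace M] : C.span hn M ≈ C'.span hn M := by
  have hK := fun f : C(unitSphere n, M) => C.isConstantAlong_iff hn C' h f
  refine ⟨⟨⟨fun f => ⟨f.1, (hK f.1).1 f.2⟩, fun f => ⟨f.1, (hK f.1).2 f.2⟩, fun _ => rfl,
    fun _ => rfl⟩, continuous_subtype_val.subtype_mk _, continuous_subtype_val.subtype_mk _⟩,
    fun f => funext fun i => ContinuousMap.ext fun x => ?_, fun f => rfl⟩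
  change f.1 (pick (unitSphere n ∩ O' i) x) = f.1 (pick (unitSphere n ∩ O i) x)
  rw [h i]

end IsCarving

/-- The diagonal correspondence, by which operations with a single input act. -/
def diagonalSpan (I : Type) (A : TopCat.{u}) : TopSpan (TopCat.of (I → A)) A :=
  ⟨A, ⟨fun a _ => a, by fun_prop⟩, ContinuousMap.id A⟩

theorem CutTree.nonempty_leaf {n : ℕ} : ∀ t : CutTree n, Nonempty t.Leaf
  | leaf => ⟨()⟩
  | node _ l _ => (nonempty_leaf l).map Sum.inl

namespace PreCleavage

variable {n : ℕ} {I J : Type}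

theorem nonempty_label (p : PreCleavage n I) : Nonempty I :=
  p.tree.nonempty_leaf.map p.label.symm

/-- A trivalent vertex would produce two distinct leaves, so the tree is a single leaf. -/
theorem target_eq_source [Subsingleton I] (p : PreCleavage n I) (i : I) :
    p.target i = p.source := by
  obtain ⟨U, t, label, -, -⟩ := p
  cases t with
  | leaf => rfl
  | node P l r =>
    obtain ⟨x⟩ := l.nonempty_leaf
    obtain ⟨y⟩ := r.nonempty_leaf
    have := label.symm.injective (Subsingleton.elim (label.symm (Sum.inl x))
      (label.symm (Sum.inr y)))
    cases this

theorem exists_carving (hn : 1 ≤ n) (p : PreCleavage n I) :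
    ∃ O : I → Set (Euc n), IsCarving O ∧ ∀ i, unitSphere n ∩ O i = (p.target i).1 := by
  obtain ⟨V, hV, hU⟩ := p.source.2.1.exists_cutRegion hn
  exact ⟨p.family V, p.isCarving_family hn hV hU, fun i => p.sphere_inter_family hU i⟩

/-- The region for q has to be the `i`-th region of p, not an arbitrary one of the same colour. Then
the regions of the grafted tree are exactly the inserted family. -/
theorem exists_carving_graft (hn : 1 ≤ n) (p : PreCleavage n I) (i : I) (q : PreCleavage n J)
    (h : q.source = p.target i) : ∃ (O : I → Set (Euc n)) (Q : J → Set (Euc n)),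
      IsCarving O ∧ IsCarving Q ∧ IsCarving (insertFamily O i Q) ∧
      (∀ i, unitSphere n ∩ O i = (p.target i).1) ∧ (∀ j, unitSphere n ∩ Q j = (q.target j).1) ∧
      ∀ j, Q j ⊆ O i := by
  obtain ⟨V, hV, hU⟩ := p.source.2.1.exists_cutRegion hn
  have hq : q.source.1 = unitSphere n ∩ p.family V i := by
    rw [h, p.sphere_inter_family hU i]
    rfl
  have e : (p.graft i q h).family V = insertFamily (p.family V) i (q.family (p.family V i)) := by
    funext z
    rcases z with x | y
    · exact CutTree.piece_graft_inl p.tree (p.label i) q.tree _ V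
    · exact CutTree.piece_graft_inr p.tree (p.label i) q.tree (q.label y) V
  refine ⟨p.family V, q.family (p.family V i), p.isCarving_family hn hV hU,
    q.isCarving_family hn (hV.piece hn p.tree _) hq, ?_, fun i => p.sphere_inter_family hU i,
    fun j => q.sphere_inter_family hq j, fun j => q.tree.piece_subset _ _⟩
  rw [← e]
  exact (p.graft i q h).isCarving_family hn hV hU

end PreCleavage

/-! ### The action of operations and its compatibility with the operad structure -/

namespace Cleavage

variable {n : ℕ} {I J : Type}

theorem exists_carving (hn : 1 ≤ n) (f : Cleavage n I) :
    ∃ O : I → Set (Euc n), IsCarving O ∧ ∀ i, unitSphere n ∩ O i = (f.target i).1 := by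
  induction f using Quotient.inductionOn with
  | _ p => exact p.exists_carving hn

theorem nonempty_label (f : Cleavage n I) : Nonempty I := by
  induction f using Quotient.inductionOn with
  | _ p => exact p.nonempty_label

theorem target_eq_source [Subsingleton I] (f : Cleavage n I) (i : I) :
    f.target i = f.source := by
  induction f using Quotient.inductionOn with
  | _ p => exact p.target_eq_source i

open Classical in
/-- The correspondence by which a cleavage acts. -/
noncomputable def act (hn : 1 ≤ n) (M : Type u) [TopologicalSpace M] (f : Cleavage n I) :
    (Corr.of (TopCat.of C(unitSphere n, M))).pow I ⟶ Corr.of (TopCat.of C(unitSphere n, M)) :=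
  -- With one input the span of a carving would in general impose constancy along the complement of
  -- the colour, and then the unit would not act by the identity.
  if Nontrivial I then Corr.mk ((f.exists_carving hn).choose_spec.1.span hn M) else
    Corr.mk (diagonalSpan I (TopCat.of C(unitSphere n, M)))

variable (hn : 1 ≤ n) (M : Type u) [TopologicalSpace M]

/-- The chosen carving may be replaced by any with the same timber; this makes the action computable
on convenient representatives. -/
theorem act_of_nontrivial [Finite I] [Nontrivial I] (f : Cleavage n I) {O : I → Set (Euc n)}
    (C : IsCarving O) (h : ∀ i, unitSphere n ∩ O i = (f.target i).1) :
    f.act hn M = Corr.mk (C.span hn M) := by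
  rw [act, if_pos ‹Nontrivial I›]
  exact Corr.mk_eq (IsCarving.span_equiv _ C hn
    (fun i => ((f.exists_carving hn).choose_spec.2 i).trans (h i).symm) M)

theorem act_of_subsingleton (hI : ¬ Nontrivial I) (f : Cleavage n I) :
    f.act hn M = Corr.mk (diagonalSpan I (TopCat.of C(unitSphere n, M))) := if_neg hI

theorem act_trivial (U : Colour n) : (mk (PreCleavage.trivial U)).act hn M =
    (Corr.mkIso (X := (Corr.of (TopCat.of C(unitSphere n, M))).pow Unit)
      (Y := Corr.of (TopCat.of C(unitSphere n, M)))
      (Homeomorph.funUnique Unit C(unitSphere n, M))).hom := by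
  rw [act_of_subsingleton hn M (not_nontrivial Unit)]
  exact Corr.mk_eq ⟨(Homeomorph.funUnique Unit C(unitSphere n, M)).symm, fun _ => rfl,
    fun _ => rfl⟩

theorem act_relabel [Finite I] [Finite J] (e : I ≃ J) (f : Cleavage n I) :
    (f.relabel e).act hn M =
      (Corr.mkIso ((Corr.of (TopCat.of C(unitSphere n, M))).powCongr e)).hom ≫ f.act hn M := by
  by_cases hI : Nontrivial I
  · have hJ : Nontrivial J := e.symm.nontrivial
    obtain ⟨O, C, h⟩ := f.exists_carving hn
    have C' : IsCarving (O ∘ e.symm) := C.reindex e.symm.bijective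
    rw [act_of_nontrivial hn M f C h, act_of_nontrivial hn M (f.relabel e) C'
      fun j => by rw [target_relabel]; exact h _]
    refine Eq.trans ?_ (Corr.relabel_mk e _).symm
    have hβ : blueprintOf (O ∘ e.symm) = blueprintOf O :=
      IsCarving.blueprintOf_comp O e.symm.surjective
    exact Corr.mk_eq ⟨⟨⟨fun f => ⟨f.1, hβ ▸ f.2⟩, fun f => ⟨f.1, hβ.symm ▸ f.2⟩, fun _ => rfl,
      fun _ => rfl⟩, continuous_subtype_val.subtype_mk _, continuous_subtype_val.subtype_mk _⟩,
      fun f => rfl, fun f => rfl⟩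
  · have hJ : ¬ Nontrivial J := fun h => hI e.nontrivial
    rw [act_of_subsingleton hn M hI, act_of_subsingleton hn M hJ]
    exact (Corr.relabel_mk e (diagonalSpan I (TopCat.of C(unitSphere n, M)))).symm

theorem act_comp_nontrivial [Finite I] [Finite J] [Nontrivial I] [Nontrivial J]
    (f : Cleavage n I) (i : I) (g : Cleavage n J) (h : g.source = f.target i) :
    (f.comp i g h).act hn M = Corr.insertComp (f.act hn M) i (g.act hn M) := by
  obtain ⟨p, rfl⟩ : ∃ p, mk p = f := Quotient.exists_rep f
  obtain ⟨q, rfl⟩ : ∃ q, mk q = g := Quotient.exists_rep g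
  have : Nontrivial ({x : I // x ≠ i} ⊕ J) := Sum.inr_injective.nontrivial
  obtain ⟨O, Q, C, CQ, CR, hO, hQ, hsub⟩ := p.exists_carving_graft hn i q h
  rw [act_of_nontrivial hn M (mk p) C hO, act_of_nontrivial hn M (mk q) CQ hQ,
    act_of_nontrivial hn M _ CR ?_]
  · refine Eq.trans ?_ (Corr.insertComp_mk (A := TopCat.of C(unitSphere n, M))
      (C.span hn M) i (CQ.span hn M)).symm
    -- In the fibre product the second map is the `i`-th left leg of the first, so only the first is
    -- data. The conditions on the pair amount to constancy along the composite blueprint.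
    let e : CR.Maps M ≃ₜ {s : C.Maps M × CQ.Maps M // C.leftLeg hn M s.1 i = s.2.1} :=
      { toFun f := ⟨(⟨f.1, IsCarving.isConstantAlong_of_insert hsub f.2⟩,
          ⟨C.leftLeg hn M ⟨f.1, IsCarving.isConstantAlong_of_insert hsub f.2⟩ i,
            IsCarving.isConstantAlong_extend_of_insert hn C hsub f.2 fun _ => rfl⟩), rfl⟩
        invFun s := ⟨s.1.1.1, IsCarving.isConstantAlong_insert hn C CQ hsub s.1.1.2
          (fun x => (DFunLike.congr_fun s.2 x).symm) s.1.2.2⟩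
        left_inv _ := rfl
        right_inv s := Subtype.ext (Prod.ext rfl (Subtype.ext s.2))
        continuous_toFun := by
          refine Continuous.subtype_mk (Continuous.prodMk (continuous_subtype_val.subtype_mk _)
            (Continuous.subtype_mk ?_ _)) _
          exact (continuous_apply i).comp ((C.leftLeg hn M).continuous.comp
            (continuous_subtype_val.subtype_mk _))
        continuous_invFun := Continuous.subtype_mk (continuous_subtype_val.comp
          (continuous_fst.comp continuous_subtype_val)) _ }
    refine Corr.mk_eq ⟨e, fun f => funext ?_, fun f => rfl⟩
    rintro (x | y)
    · rfl
    · refine ContinuousMap.ext fun x => ?_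
      exact IsCarving.extend_pick hn C CQ hsub
        (IsCarving.isConstantAlong_of_insert hsub f.2)
        (g := C.leftLeg hn M ⟨f.1, IsCarving.isConstantAlong_of_insert hsub f.2⟩ i)
        (fun _ => rfl) y x
  · rintro (x | y)
    · rw [target_comp_inl]
      exact hO x
    · rw [target_comp_inr]
      exact hQ y

/-- The operation g has equal incoming and outgoing colours, so composing with it only renames the
label i. The same carving serves after reindexing. -/
theorem act_comp_right [Finite I] [Finite J] [Nontrivial I] (hJ : ¬ Nontrivial J)
    (f : Cleavage n I) (i : I) (g : Cleavage n J) (h : g.source = f.target i) :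
    (f.comp i g h).act hn M = Corr.insertComp (f.act hn M) i (g.act hn M) := by
  have hJ' : Subsingleton J := not_nontrivial_iff_subsingleton.1 hJ
  obtain ⟨y⟩ := g.nonempty_label
  obtain ⟨O, C, hO⟩ := f.exists_carving hn
  set e : {x : I // x ≠ i} ⊕ J → I := Sum.elim (fun x => x.1) (fun _ => i) with he
  have hbij : Function.Bijective e := by
    constructor
    · rintro (⟨a, ha⟩ | a) (⟨b, hb⟩ | b) hab
      · exact congrArg Sum.inl (Subtype.ext hab)
      · exact (ha hab).elim
      · exact (hb hab.symm).elim
      · exact congrArg Sum.inr (Subsingleton.elim a b)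
    · intro x
      by_cases hx : x = i
      · exact ⟨Sum.inr y, hx.symm⟩
      · exact ⟨Sum.inl ⟨x, hx⟩, rfl⟩
  have C' : IsCarving (O ∘ e) := C.reindex hbij
  have : Nontrivial ({x : I // x ≠ i} ⊕ J) := (Equiv.ofBijective e hbij).nontrivial
  have hβ : blueprintOf (O ∘ e) = blueprintOf O := IsCarving.blueprintOf_comp O hbij.2
  rw [act_of_subsingleton hn M hJ, act_of_nontrivial hn M f C hO, act_of_nontrivial hn M _ C' ?_]
  · refine Eq.trans ?_ (Corr.insertComp_mk (A := TopCat.of C(unitSphere n, M)) (C.span hn M) i (diagonalSpan J (TopCat.of C(unitSphere n, M)))).symm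
    let k : C'.Maps M ≃ₜ {s : C.Maps M × C(unitSphere n, M) // C.leftLeg hn M s.1 i = s.2} :=
      { toFun f := ⟨(⟨f.1, hβ ▸ f.2⟩, C.leftLeg hn M ⟨f.1, hβ ▸ f.2⟩ i), rfl⟩
        invFun s := ⟨s.1.1.1, hβ.symm ▸ s.1.1.2⟩
        left_inv _ := rfl
        right_inv s := Subtype.ext (Prod.ext rfl s.2)
        continuous_toFun := by
          refine Continuous.subtype_mk (Continuous.prodMk
            (continuous_subtype_val.subtype_mk _) ?_) _
          exact (continuous_apply i).comp ((C.leftLeg hn M).continuous.comp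
            (continuous_subtype_val.subtype_mk _))
        continuous_invFun := Continuous.subtype_mk (continuous_subtype_val.comp
          (continuous_fst.comp continuous_subtype_val)) _ }
    refine Corr.mk_eq ⟨k, fun f => funext ?_, fun f => rfl⟩
    rintro (x | y) <;> rfl
  · rintro (x | y)
    · rw [target_comp_inl]
      exact hO x
    · rw [target_comp_inr, target_eq_source, h]
      exact hO i

/-- The only input of f is i, so the composite has the labels and the timber of g. -/
theorem act_comp_left [Finite I] [Finite J] [Nontrivial J] (hI : ¬ Nontrivial I)
    (f : Cleavage n I) (i : I) (g : Cleavage n J) (h : g.source = f.target i) :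
    (f.comp i g h).act hn M = Corr.insertComp (f.act hn M) i (g.act hn M) := by
  have hI' : Subsingleton I := not_nontrivial_iff_subsingleton.1 hI
  obtain ⟨Q, C, hQ⟩ := g.exists_carving hn
  set e : {x : I // x ≠ i} ⊕ J → J :=
    Sum.elim (fun x => (x.2 (Subsingleton.elim _ _)).elim) id with he
  have hbij : Function.Bijective e := by
    refine ⟨?_, fun y => ⟨Sum.inr y, rfl⟩⟩
    rintro (⟨a, ha⟩ | a) (⟨b, hb⟩ | b) hab
    · exact (ha (Subsingleton.elim _ _)).elim
    · exact (ha (Subsingleton.elim _ _)).elim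
    · exact (hb (Subsingleton.elim _ _)).elim
    · exact congrArg Sum.inr hab
  have C' : IsCarving (Q ∘ e) := C.reindex hbij
  have : Nontrivial ({x : I // x ≠ i} ⊕ J) := (Equiv.ofBijective e hbij).nontrivial
  have hβ : blueprintOf (Q ∘ e) = blueprintOf Q := IsCarving.blueprintOf_comp Q hbij.2
  rw [act_of_subsingleton hn M hI, act_of_nontrivial hn M g C hQ, act_of_nontrivial hn M _ C' ?_]
  · refine Eq.trans ?_ (Corr.insertComp_mk (A := TopCat.of C(unitSphere n, M)) (diagonalSpan I (TopCat.of C(unitSphere n, M))) i (C.span hn M)).symm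
    let k : C'.Maps M ≃ₜ {s : C(unitSphere n, M) × C.Maps M // s.1 = s.2.1} :=
      { toFun f := ⟨(f.1, ⟨f.1, hβ ▸ f.2⟩), rfl⟩
        invFun s := ⟨s.1.2.1, hβ.symm ▸ s.1.2.2⟩
        left_inv _ := rfl
        right_inv s := Subtype.ext (Prod.ext s.2.symm rfl)
        continuous_toFun := Continuous.subtype_mk (Continuous.prodMk continuous_subtype_val
          (continuous_subtype_val.subtype_mk _)) _
        continuous_invFun := Continuous.subtype_mk (continuous_subtype_val.comp
          (continuous_snd.comp continuous_subtype_val)) _ }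
    refine Corr.mk_eq ⟨k, fun f => funext ?_, fun f => rfl⟩
    rintro (x | y)
    · exact (x.2 (Subsingleton.elim _ _)).elim
    · rfl
  · rintro (x | y)
    · exact (x.2 (Subsingleton.elim _ _)).elim
    · rw [target_comp_inr]
      exact hQ y

theorem act_comp_subsingleton (hI : ¬ Nontrivial I) (hJ : ¬ Nontrivial J)
    (f : Cleavage n I) (i : I) (g : Cleavage n J) (h : g.source = f.target i) :
    (f.comp i g h).act hn M = Corr.insertComp (f.act hn M) i (g.act hn M) := by
  have hI' : Subsingleton I := not_nontrivial_iff_subsingleton.1 hI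
  have hJ' : Subsingleton J := not_nontrivial_iff_subsingleton.1 hJ
  have hK : ¬ Nontrivial ({x : I // x ≠ i} ⊕ J) := by
    rw [not_nontrivial_iff_subsingleton]
    refine ⟨?_⟩
    rintro (⟨a, ha⟩ | a) (⟨b, hb⟩ | b)
    · exact (ha (Subsingleton.elim _ _)).elim
    · exact (ha (Subsingleton.elim _ _)).elim
    · exact (hb (Subsingleton.elim _ _)).elim
    · exact congrArg Sum.inr (Subsingleton.elim a b)
  rw [act_of_subsingleton hn M hI, act_of_subsingleton hn M hJ, act_of_subsingleton hn M hK]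
  refine Eq.trans ?_ (Corr.insertComp_mk (A := TopCat.of C(unitSphere n, M)) (diagonalSpan I (TopCat.of C(unitSphere n, M))) i (diagonalSpan J (TopCat.of C(unitSphere n, M)))).symm
  refine Corr.mk_eq ⟨⟨⟨fun a => ⟨(a, a), rfl⟩, fun s => s.1.1, fun _ => rfl, fun s => ?_⟩, ?_, ?_⟩,
    fun f => ?_, fun f => rfl⟩
  · exact Subtype.ext (Prod.ext rfl s.2)
  · exact Continuous.subtype_mk (Continuous.prodMk continuous_id continuous_id) _
  · exact continuous_fst.comp continuous_subtype_val
  · refine funext ?_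
    rintro (x | y) <;> rfl

theorem act_comp [Finite I] [Finite J] (f : Cleavage n I) (i : I) (g : Cleavage n J)
    (h : g.source = f.target i) :
    (f.comp i g h).act hn M = Corr.insertComp (f.act hn M) i (g.act hn M) := by
  by_cases hI : Nontrivial I <;> by_cases hJ : Nontrivial J
  · exact act_comp_nontrivial hn M f i g h
  · exact act_comp_right hn M hJ f i g h
  · exact act_comp_left hn M hI f i g h
  · exact act_comp_subsingleton hn M hI hJ f i g h

end Cleavage

/-- The action of the cleavage operad on the space of maps from the sphere. -/
noncomputable def cleavageAction {n : ℕ} (hn : 1 ≤ n) (M : Type u) [TopologicalSpace M] :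
    OperadFunctor (Cleav n) (EndOperad (Corr.of (TopCat.of C(unitSphere n, M)))) where
  onOb _ := ()
  onOp f := Cleavage.act hn M f
  map_inc _ := rfl
  map_out _ _ := rfl
  map_one U := Cleavage.act_trivial hn M U
  map_relabel e f := Cleavage.act_relabel hn M e f
  map_comp f i g h := Cleavage.act_comp hn M f i g h

/-- If every timber is the whole sphere, the blueprint misses the sphere: the constancy condition is
vacuous and `pick` is the identity. -/
theorem diagonalSpan_equiv {n : ℕ} (hn : 1 ≤ n) (M : Type u) [TopologicalSpace M] {I : Type}
    [Nonempty I] {O : I → Set (Euc n)} (C : IsCarving O)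
    (h : ∀ i, unitSphere n ∩ O i = unitSphere n) :
    diagonalSpan I (TopCat.of C(unitSphere n, M)) ≈ C.span hn M := by
  obtain ⟨i₀⟩ := ‹Nonempty I›
  have hK : ∀ f : C(unitSphere n, M), IsConstantAlong (blueprintOf O) f := fun f x y hxy =>
    ((mem_blueprintOf.1 hxy.source_mem).2 i₀ ((h i₀).symm.subset x.2).2).elim
  refine ⟨⟨⟨fun f => ⟨f, hK f⟩, fun f => f.1, fun _ => rfl, fun _ => rfl⟩,
    continuous_id.subtype_mk _, continuous_subtype_val⟩, fun f => funext fun i =>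
    ContinuousMap.ext fun x => ?_, fun f => rfl⟩
  change (show C(unitSphere n, M) from f) (pick (unitSphere n ∩ O i) x) =
    (show C(unitSphere n, M) from f) x
  rw [h i, pick_of_mem x.2]

theorem theoremA (n : ℕ) (hn : 1 ≤ n) (M : Type u) [TopologicalSpace M] :
    ∃ α : OperadFunctor (Cleav n) (EndOperad (Corr.of (TopCat.of C(unitSphere n, M)))),
      ∀ (I : Type) [Finite I] (p : PreCleavage n I) (W : Set (Euc n)),
        IsRegionOf p.source.1 W → (Nontrivial I ∨ p.source.1 = unitSphere n) →
          p.IsPullbackConstruction W M (α.onOp (Cleavage.mk p)) := by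
  refine ⟨cleavageAction hn M, fun I _ p W hW hI => ?_⟩
  obtain ⟨V, hV, hU, rfl⟩ := hW.exists_cutRegion hn
  have C := p.isCarving_family hn hV hU
  have e : (Cleavage.mk p).act hn M = Corr.mk (C.span hn M) := by
    by_cases hI' : Nontrivial I
    · exact Cleavage.act_of_nontrivial hn M _ C fun i => p.sphere_inter_family hU i
    · have : Subsingleton I := not_nontrivial_iff_subsingleton.1 hI'
      have := p.nonempty_label
      rw [Cleavage.act_of_subsingleton hn M hI']
      refine Corr.mk_eq (diagonalSpan_equiv hn M C fun i => ?_)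
      -- With a single input the colour must be the sphere, by the remaining alternative of the
      -- hypothesis, and the outgoing colour equals it.
      rw [p.sphere_inter_family hU i, ← hI.resolve_left hI']
      exact congrArg Subtype.val (p.target_eq_source i)
  change p.IsPullbackConstruction _ M ((Cleavage.mk p).act hn M)
  rw [e]
  exact p.isPullbackConstruction hn C (p.blueprint_eq V)
    (funext fun i => (p.sphere_inter_family hU i).symm) M
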